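/- Let $\mathbb H$ be the hexagonal lattice, whose edges have three directions (horizontal, NW-SE, NE-SW), written in coordinates $(p,q)\in\mathbb Z^2$: $(p,q)$ is joined to $(p,q\pm1)$ by a NW-SE and a NE-SW edge (so that, for fixed $p$, these edges form a zigzag path), and $(p,q)$ is joined to $(p+1,q)$ by a horizontal edge when $p+q$ is even; a vertex $(p,q)$ with $p+q$ even has its NW-SE edge to $(p,q+1)$ and its NE-SW edge to $(p,q-1)$. A 1-2 model configuration on $\mathbb H$ is a set $\omega$ of ("present") edges such that every vertex is incident to one or two edges of $\omega$. For a finite vertex set $\Lambda$ let $E_\Lambda$ be the set of edges with both endpoints in $\Lambda$ and $F_\Lambda$ the set of hexagonal faces with all vertices in $\Lambda$. A boundary condition $\beta$ prescribes the states of all edges outside $E_\Lambda$; it is admissible if some 1-2 model configuration on $\mathbb H$ agrees with it outside $E_\Lambda$. Let $\Omega_{\Lambda,\beta}$ be the finite set of 1-2 model configurations that agree with $\beta$ outside $E_\Lambda$. Let $a,b,c>0$ and put $w_{\mathrm{horizontal}}=a$, $w_{\mathrm{NW\text{-}SE}}=b$, $w_{\mathrm{NE\text{-}SW}}=c$. At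 each vertex exactly one incident edge has a state different from that of the two others; the local weight $w(\omega|_v)$ is $w_x$, where $x$ is the direction of that edge. Let $\pi(\omega)\propto\prod_{v\in\Lambda}w(\omega|_v)$ on $\Omega_{\Lambda,\beta}$. Let $$C_\Lambda=\frac{\min\{a,b,c\}}{2(|E_\Lambda|+|F_\Lambda|)\max\{a,b,c\}} .$$ The 1-2 model Markov chain on $\Omega_{\Lambda,\beta}$ has the following transition probabilities $P(\omega_1,\omega_2)$ for $\omega_1\ne\omega_2$. * If $\omega_1,\omega_2$ differ at exactly one edge $e$, of direction $d$, let $x$ and $y$ be the directions of the present edges other than $e$ at the two endpoints of $e$. If $x\neq y$ then $P(\omega_1,\omega_2)=C_\Lambda$. If $x=y$, let $z$ be the direction different from $d$ and $x$; then $P(\omega_1,\omega_2)=C_\Lambda w_x/w_z$ if $e$ is present in $\omega_1$, and $P(\omega_1,\omega_2)=C_\Lambda w_z/w_x$ if $e$ is present in $\omega_2$. * If $\omega_1,\omega_2$ differ exactly at the six boundary edges of one face, these six edges being alternately present and absent in $\omega_1$ (hence in $\omega_2$), and the six edges with exactly one endpoint on the face are also alternately present and absent in cyclic order, then $P(\omega_1,\omega_2)=C_\Lambda$.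 * Otherwise $P(\omega_1,\omega_2)=0$. The diagonal entries are $P(\omega,\omega)=1-\sum_{\omega'\neq\omega}P(\omega,\omega')$. The mixing time is $t_{\mathrm{mix}}=\min\{t\in\{1,2,\dots\}:\max_{\omega}\|P^t(\omega,\cdot)-\pi\|_{TV}\le \tfrac14\}$. **Theorem.** For every $k\ge 2$ there are $N=N(k)\in\mathbb N$ and $B(k)>0$, and for all $a,b,c>0$ there is $C(k)=C(k;a,b,c)>0$, such that the following holds for all $n\ge N$, every $k\times n$ box $\Lambda_{k,n}=\{(p,q): p_0\le p<p_0+k,\ q_0\le q<q_0+n\}$ (with $p_0,q_0\in\mathbb Z$) and every admissible boundary condition: the 1-2 model Markov chain on $\Omega_{\Lambda_{k,n},\beta}$ has $\pi$ as its unique stationary distribution, and its mixing time is finite and satisfies $$B(k)\,n\le t_{\mathrm{mix}}\le C(k)\,n^2 .$$ -/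

import Mathlib

namespace OneTwo

/-- The three directions of edges of the hexagonal lattice: horizontal, NW-SE and NE-SW. -/
inductive Dir : Type
  | H
  | NW
  | NE
  deriving DecidableEq

instance : Fintype Dir where
  elems := {Dir.H, Dir.NW, Dir.NE}
  complete d := by cases d <;> simp

/-- Vertices of the hexagonal lattice in brick-wall coordinates. For fixed `p` the vertices `(p, q)`,
`q ∈ ℤ`, form a zigzag path made of NW-SE and NE-SW edges; consecutive zigzag paths are joined by
horizontal edges. -/
abbrev Vert : Type := ℤ × ℤ

/-- The black vertices of the bipartite colouring. -/
def IsBlack (v : Vert) : Prop := Even (v.1 + v.2)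

open Classical in
/-- The neighbour of `v` along the edge of direction `d`. A black vertex has its neighbours to the
east, north-west and south-west; a white one to the west, south-east and north-east. -/
noncomputable def nbr (d : Dir) (v : Vert) : Vert :=
  match d with
  | Dir.H => if IsBlack v then (v.1 + 1, v.2) else (v.1 - 1, v.2)
  | Dir.NW => if IsBlack v then (v.1, v.2 + 1) else (v.1, v.2 - 1)
  | Dir.NE => if IsBlack v then (v.1, v.2 - 1) else (v.1, v.2 + 1)

theorem isBlack_nbr (d : Dir) (v : Vert) : IsBlack (nbr d v) ↔ ¬ IsBlack v := by
  unfold IsBlack nbr IsBlack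
  cases d <;> dsimp only <;> split_ifs with h <;> simp only [Int.even_iff] at * <;> omega

theorem nbr_nbr (d : Dir) (v : Vert) : nbr d (nbr d v) = v := by
  have h := isBlack_nbr d v
  by_cases hv : IsBlack v <;> cases d <;> simp_all [nbr]

theorem nbr_ne (d : Dir) (v : Vert) : nbr d v ≠ v := by
  intro h
  have := isBlack_nbr d v
  rw [h] at this
  tauto

/-- The hexagonal lattice. -/
def hexLattice : SimpleGraph Vert where
  Adj u v := ∃ d : Dir, v = nbr d u
  symm := ⟨by
    rintro u v ⟨d, rfl⟩
    exact ⟨d, (nbr_nbr d u).symm⟩⟩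
  loopless := ⟨by
    rintro u ⟨d, h⟩
    exact nbr_ne d u h.symm⟩

/-- The edge of direction `d` at the vertex `v`. -/
noncomputable def edgeAt (v : Vert) (d : Dir) : Sym2 Vert := s(v, nbr d v)

/-- `ω` (the set of present edges) is a 1-2 model configuration on the whole lattice: each vertex is
incident to one or two present edges. -/
def IsConfig (ω : Set (Sym2 Vert)) : Prop :=
  ω ⊆ hexLattice.edgeSet ∧
    ∀ v : Vert, {d : Dir | edgeAt v d ∈ ω}.ncard = 1 ∨ {d : Dir | edgeAt v d ∈ ω}.ncard = 2

open Classical in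
/-- The edge set of the subgraph induced by the finite vertex set `Λ`. -/
noncomputable def edges (Λ : Finset Vert) : Finset (Sym2 Vert) :=
  Λ.sym2.filter (fun e => e ∈ hexLattice.edgeSet)

/-- The six vertices, in cyclic order, of the face whose south-west corner is the
black vertex `f`. -/
def faceVert (f : Vert) (i : ZMod 6) : Vert :=
  match i with
  | 0 => (f.1, f.2)
  | 1 => (f.1 + 1, f.2)
  | 2 => (f.1 + 1, f.2 + 1)
  | 3 => (f.1 + 1, f.2 + 2)
  | 4 => (f.1, f.2 + 2)
  | 5 => (f.1, f.2 + 1)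

/-- The boundary edges of the face `f`, in cyclic order. -/
def faceEdge (f : Vert) (i : ZMod 6) : Sym2 Vert := s(faceVert f i, faceVert f (i + 1))

/-- The direction of the edge at the `i`-th vertex of a face that is not on the face's boundary. -/
def outDir (i : ZMod 6) : Dir :=
  match i with
  | 0 => Dir.NE
  | 1 => Dir.NW
  | 2 => Dir.H
  | 3 => Dir.NE
  | 4 => Dir.NW
  | 5 => Dir.H

/-- The six incident edges of the face `f`, in cyclic order: the edges with exactly one endpoint on
the boundary of `f`. -/
noncomputable def outEdge (f : Vert) (i : ZMod 6) : Sym2 Vert := edgeAt (faceVert f i) (outDir i)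

open Classical in
/-- The faces of the subgraph induced by `Λ`, represented by their south-west corners. -/
noncomputable def faces (Λ : Finset Vert) : Finset Vert :=
  Λ.filter (fun f => IsBlack f ∧ ∀ i, faceVert f i ∈ Λ)

/-- `ω` agrees with the boundary condition `b` on all edges outside the subgraph induced by `Λ`
(the part of `b` inside `Λ` is irrelevant). -/
def AgreesOutside (Λ : Finset Vert) (b ω : Set (Sym2 Vert)) : Prop :=
  ∀ e ∈ hexLattice.edgeSet, e ∉ edges Λ → (e ∈ ω ↔ e ∈ b)

/-- The boundary condition `b` is admissible: some 1-2 model configuration on the whole lattice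
agrees with it outside `Λ`. -/
def Admissible (Λ : Finset Vert) (b : Set (Sym2 Vert)) : Prop :=
  ∃ ω, IsConfig ω ∧ AgreesOutside Λ b ω

/-- The 1-2 model configurations on `Λ` with boundary condition `b`; each is represented by its
union with the boundary condition, a configuration on the whole lattice. -/
def State (Λ : Finset Vert) (b : Set (Sym2 Vert)) : Type :=
  {ω : Set (Sym2 Vert) // IsConfig ω ∧ AgreesOutside Λ b ω}

instance (Λ : Finset Vert) (b : Set (Sym2 Vert)) : Finite (State Λ b) := by
  classical
  refine Finite.of_injective
    (fun s : State Λ b => (fun e : edges Λ => e.1 ∈ s.1 : edges Λ → Prop)) ?_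
  rintro ⟨s, hs, hsb⟩ ⟨t, ht, htb⟩ h
  apply Subtype.ext
  ext e
  by_cases he : e ∈ hexLattice.edgeSet
  · by_cases heΛ : e ∈ edges Λ
    · exact iff_of_eq (congrFun h ⟨e, heΛ⟩)
    · exact (hsb e he heΛ).trans (htb e he heΛ).symm
  · exact ⟨fun h' => absurd (hs.1 h') he, fun h' => absurd (ht.1 h') he⟩

noncomputable instance (Λ : Finset Vert) (b : Set (Sym2 Vert)) : Fintype (State Λ b) :=
  Fintype.ofFinite _

/-- The weight attached to a direction: `a` to horizontal, `b` to NW-SE, `c` to NE-SW. -/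
def dirWeight (a b c : ℝ) : Dir → ℝ
  | Dir.H => a
  | Dir.NW => b
  | Dir.NE => c

open Classical in
/-- The weight of the local configuration of `ω` at `v`: it is the weight of the direction of the
edge at `v` whose state differs from the common state of the other two edges at `v`,
and `0` if all three edges at `v` have the same state. -/
noncomputable def localWeight (a b c : ℝ) (ω : Set (Sym2 Vert)) (v : Vert) : ℝ :=
  ∑ d : Dir, if ∀ d', d' ≠ d → (edgeAt v d' ∈ ω ↔ edgeAt v d ∉ ω) then dirWeight a b c d else 0

/-- The weight of a configuration: the product of the local weights. -/
noncomputable def weight (Λ : Finset Vert) (a b c : ℝ) (ω : Set (Sym2 Vert)) : ℝ :=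
  ∏ v ∈ Λ, localWeight a b c ω v

/-- The 1-2 model measure: the probability of a configuration is proportional to its weight. -/
noncomputable def gibbs (Λ : Finset Vert) (bd : Set (Sym2 Vert)) (a b c : ℝ) (ω : State Λ bd) : ℝ :=
  weight Λ a b c ω.1 / ∑ ω' : State Λ bd, weight Λ a b c ω'.1

/-- `ω₁` and `ω₂` differ exactly at the edge `e` of direction `d` with endpoints `v` and `nbr d v`,
and `x`, `y` are the directions of the present edges, other than `e`, at these two endpoints. -/
def DiffEdge (ω₁ ω₂ : Set (Sym2 Vert)) (v : Vert) (d x y : Dir) : Prop :=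
  symmDiff ω₁ ω₂ = {edgeAt v d} ∧ x ≠ d ∧ y ≠ d ∧
    edgeAt v x ∈ ω₁ ∧ edgeAt v x ∈ ω₂ ∧ edgeAt (nbr d v) y ∈ ω₁ ∧ edgeAt (nbr d v) y ∈ ω₂

/-- Exactly one edge differs, and the two other present edges at its endpoints are not parallel. -/
def NonParallel (ω₁ ω₂ : Set (Sym2 Vert)) : Prop :=
  ∃ v d x y, DiffEdge ω₁ ω₂ v d x y ∧ x ≠ y

/-- Exactly one edge `e` differs, it has direction `d`, it is present in `ω₁` and absent in `ω₂`, and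
the two other present edges at its endpoints both have direction `x`. -/
def Removes (ω₁ ω₂ : Set (Sym2 Vert)) (d x : Dir) : Prop :=
  ∃ v, DiffEdge ω₁ ω₂ v d x x ∧ edgeAt v d ∈ ω₁ ∧ edgeAt v d ∉ ω₂

/-- `ω₁` and `ω₂` differ exactly at the six boundary edges of one face; around this face the
boundary edges are alternately present and absent in both, and so are the six incident edges. -/
def FaceFlip (ω₁ ω₂ : Set (Sym2 Vert)) : Prop :=
  ∃ f, IsBlack f ∧ symmDiff ω₁ ω₂ = Set.range (faceEdge f) ∧
    (∀ i, faceEdge f i ∈ ω₁ ↔ faceEdge f (i + 1) ∉ ω₁) ∧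
    (∀ i, faceEdge f i ∈ ω₂ ↔ faceEdge f (i + 1) ∉ ω₂) ∧
    (∀ i, outEdge f i ∈ ω₁ ↔ outEdge f (i + 1) ∉ ω₁) ∧
    (∀ i, outEdge f i ∈ ω₂ ↔ outEdge f (i + 1) ∉ ω₂)

/-- The normalising constant of the transition matrix. -/
noncomputable def rateConst (Λ : Finset Vert) (a b c : ℝ) : ℝ :=
  min (min a b) c / (2 * (((edges Λ).card : ℝ) + ((faces Λ).card : ℝ)) * max (max a b) c)

open Classical in
/-- The off-diagonal entries of the transition matrix. -/
noncomputable def rate (Λ : Finset Vert) (a b c : ℝ) (ω₁ ω₂ : Set (Sym2 Vert)) : ℝ :=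
  if FaceFlip ω₁ ω₂ ∨ NonParallel ω₁ ω₂ then rateConst Λ a b c
  else if Removes ω₁ ω₂ Dir.H Dir.NW ∨ Removes ω₂ ω₁ Dir.H Dir.NE then rateConst Λ a b c * b / c
  else if Removes ω₂ ω₁ Dir.H Dir.NW ∨ Removes ω₁ ω₂ Dir.H Dir.NE then rateConst Λ a b c * c / b
  else if Removes ω₁ ω₂ Dir.NW Dir.H ∨ Removes ω₂ ω₁ Dir.NW Dir.NE then rateConst Λ a b c * a / c
  else if Removes ω₂ ω₁ Dir.NW Dir.H ∨ Removes ω₁ ω₂ Dir.NW Dir.NE then rateConst Λ a b c * c / a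
  else if Removes ω₁ ω₂ Dir.NE Dir.NW ∨ Removes ω₂ ω₁ Dir.NE Dir.H then rateConst Λ a b c * b / a
  else if Removes ω₂ ω₁ Dir.NE Dir.NW ∨ Removes ω₁ ω₂ Dir.NE Dir.H then rateConst Λ a b c * a / b
  else 0

open Classical in
/-- The transition matrix of the 1-2 model Markov chain on `Λ` with boundary condition `bd`. -/
noncomputable def transition (Λ : Finset Vert) (bd : Set (Sym2 Vert)) (a b c : ℝ) :
    Matrix (State Λ bd) (State Λ bd) ℝ :=
  fun ω₁ ω₂ =>
    if ω₁ = ω₂ then 1 - ∑ ω' ∈ Finset.univ.erase ω₁, rate Λ a b c ω₁.1 ω'.1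
    else rate Λ a b c ω₁.1 ω₂.1

section MarkovChain

/-- `π` is a stationary distribution of the transition matrix `P`. -/
def IsStationary {S : Type} [Fintype S] (P : Matrix S S ℝ) (π : S → ℝ) : Prop :=
  (∀ x, 0 ≤ π x) ∧ ∑ x, π x = 1 ∧ ∀ y, ∑ x, π x * P x y = π y

/-- Total variation distance, the maximum of `|μ(A) - ν(A)|` over all events `A`. -/
noncomputable def tvDist {S : Type} [Fintype S] (μ ν : S → ℝ) : ℝ :=
  ⨆ A : Finset S, |∑ x ∈ A, μ x - ∑ x ∈ A, ν x|

open Classical in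
/-- The maximal distance `d(t)` to `π` after `t` steps. -/
noncomputable def distAt {S : Type} [Fintype S] (P : Matrix S S ℝ) (π : S → ℝ) (t : ℕ) : ℝ :=
  ⨆ x : S, tvDist ((P ^ t) x) π

/-- `t` is the mixing time at level `ε`: the least `t = 1, 2, …` with `d(t) ≤ ε`
(in particular such a time exists). -/
def IsMixingTime {S : Type} [Fintype S] (P : Matrix S S ℝ) (π : S → ℝ) (ε : ℝ) (t : ℕ) : Prop :=
  IsLeast {s : ℕ | 1 ≤ s ∧ distAt P π s ≤ ε} t

end MarkovChain

/-- The vertices `(p, q)` of the `k × n` box whose corner is at `o`: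
`k` zigzag paths of `n` vertices each. -/
noncomputable def box (o : Vert) (k n : ℕ) : Finset Vert :=
  Finset.Ico o.1 (o.1 + k) ×ˢ Finset.Ico o.2 (o.2 + n)

end OneTwo

/-! Upper bound. The chain is reversible with respect to `gibbs` (`weight_mul_rate`) and holds with
probability at least 1/2 (`sum_rate_le`), so a Poincaré inequality with constant `l / n`
(`exists_poincare`) gives both uniqueness of the stationary distribution and exponential decay at
rate `l / n`. Since every state has probability at least `exp (-O(n))`, about `n` relaxation times
suffice, hence `O(n ^ 2)` steps (`distAt_le_quarter`). The factor `1 / n` is only the normalisation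
`rateConst`; without it the gap is bounded below uniformly in `n`, because the box is a strip of
fixed width and correlations decay along it.

Irreducibility (`reach_box`), by induction on the size of the set `D` of edges on which two
configurations differ. If an edge of `D` can be flipped, `D` shrinks. If none can, a double count
(`locked_structure`) makes `D` a union of disjoint cycles, and the edges at these cycles that are
not in `D` alternate along them in a rigid way. This rigidity allows the same sequence of flips to
be pushed into the enclosed region in both configurations (`push`); afterwards `D` is the same but
is no longer locked (`connected_of_push`). When no cycle vertex has an enclosed off-`D` neighbour,
some whole face boundary lies in `D` and can be split off or, when it is all of `D`, removed by one
face move.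

Uniform gap. The strip is covered by overlapping windows of bounded length. Averaging over one
window at a time contracts, by path coupling, the Lipschitz seminorm, and for a self-adjoint
operator this contraction passes to the variance (`inner_le_of_lipschitz`,
`variance_le_of_contraction`). The contraction needs that resampling a window depends little on a
change in an adjacent one (`classAvg_window_sub_le`). This is decay of correlations
(`fiberWeight_ratio_le`): two independent samples agree on one of many successive cuts with
probability close to 1, and at the first such cut their inner parts can be exchanged without
changing the product of the weights. The chance of agreeing at each cut is bounded below because
four columns suffice to interpolate between arbitrary configurations on the left and on the right
(`exists_bridge`). Inside a window of bounded size, irreducibility alone bounds the conditional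
variance by the Dirichlet form (`sum_sub_classAvg_le`).

Lower bound. One step changes at most six edges, and there are two states that differ in at least `n
- 8` edges (`exists_far_states`); before time of order `n` the distributions started from them have
disjoint supports. -/

namespace OneTwo

/-! ### Edges, local configurations and single edge flips -/

theorem Dir.forall_iff {P : Dir → Prop} : (∀ d, P d) ↔ P Dir.H ∧ P Dir.NW ∧ P Dir.NE :=
  ⟨fun h => ⟨h _, h _, h _⟩, fun h d => by cases d; exacts [h.1, h.2.1, h.2.2]⟩

theorem Dir.exists_iff {P : Dir → Prop} : (∃ d, P d) ↔ P Dir.H ∨ P Dir.NW ∨ P Dir.NE :=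
  ⟨fun ⟨d, h⟩ => by cases d <;> simp [h], fun h => by rcases h with h | h | h <;> exact ⟨_, h⟩⟩

/-- The direction different from two given distinct directions. -/
def third : Dir → Dir → Dir
  | Dir.H, Dir.NW => Dir.NE
  | Dir.NW, Dir.H => Dir.NE
  | Dir.H, Dir.NE => Dir.NW
  | Dir.NE, Dir.H => Dir.NW
  | _, _ => Dir.H

theorem third_ne_left {d x : Dir} (h : x ≠ d) : third d x ≠ d := by
  cases d <;> cases x <;> simp_all [third]

theorem third_ne_right {d x : Dir} (h : x ≠ d) : third d x ≠ x := by
  cases d <;> cases x <;> simp_all [third]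

theorem eq_third {d x y : Dir} (h : x ≠ d) (h1 : y ≠ d) (h2 : y ≠ x) : y = third d x := by
  cases d <;> cases x <;> cases y <;> simp_all [third]

theorem nbr_inj {d d' : Dir} {v : Vert} (h : nbr d v = nbr d' v) : d = d' := by
  by_cases hv : IsBlack v <;> cases d <;> cases d' <;> simp_all [nbr] <;> omega

theorem edgeAt_nbr (d : Dir) (v : Vert) : edgeAt (nbr d v) d = edgeAt v d := by
  unfold edgeAt
  rw [nbr_nbr, Sym2.eq_swap]

theorem edgeAt_eq_iff {v v' : Vert} {d d' : Dir} :
    edgeAt v d = edgeAt v' d' ↔ d = d' ∧ (v' = v ∨ v' = nbr d v) := by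
  constructor
  · intro h
    unfold edgeAt at h
    rcases Sym2.eq_iff.1 h with ⟨h1, h2⟩ | ⟨h1, h2⟩
    · subst h1
      exact ⟨nbr_inj h2, Or.inl rfl⟩
    · subst h2
      rw [← nbr_nbr d v] at h1
      nth_rw 2 [nbr_nbr] at h1
      exact ⟨nbr_inj h1, Or.inr rfl⟩
  · rintro ⟨rfl, rfl | rfl⟩
    · rfl
    · rw [edgeAt_nbr]

theorem edgeAt_inj {v : Vert} {d d' : Dir} : edgeAt v d = edgeAt v d' ↔ d = d' := by
  rw [edgeAt_eq_iff]
  simp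

theorem mem_edgeSet {e : Sym2 Vert} : e ∈ hexLattice.edgeSet ↔ ∃ v d, e = edgeAt v d := by
  induction e with
  | _ x y =>
    rw [SimpleGraph.mem_edgeSet]
    constructor
    · rintro ⟨d, rfl⟩
      exact ⟨x, d, rfl⟩
    · rintro ⟨v, d, h⟩
      rcases Sym2.eq_iff.1 h with ⟨h1, h2⟩ | ⟨h1, h2⟩
      · subst h1 h2
        exact ⟨d, rfl⟩
      · subst h1 h2
        exact ⟨d, (nbr_nbr _ _).symm⟩

theorem edgeAt_mem_edgeSet (v : Vert) (d : Dir) : edgeAt v d ∈ hexLattice.edgeSet :=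
  mem_edgeSet.2 ⟨v, d, rfl⟩

theorem edgeAt_mem_edges {Λ : Finset Vert} {v : Vert} {d : Dir} :
    edgeAt v d ∈ edges Λ ↔ v ∈ Λ ∧ nbr d v ∈ Λ := by
  classical
  simp only [edges, Finset.mem_filter, edgeAt_mem_edgeSet, and_true]
  unfold edgeAt
  rw [Finset.mk_mem_sym2_iff]

theorem mem_edges {Λ : Finset Vert} {e : Sym2 Vert} :
    e ∈ edges Λ ↔ ∃ v d, e = edgeAt v d ∧ v ∈ Λ ∧ nbr d v ∈ Λ := by
  constructor
  · intro h
    classical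
    obtain ⟨v, d, rfl⟩ := mem_edgeSet.1 (Finset.mem_filter.1 h).2
    exact ⟨v, d, rfl, edgeAt_mem_edges.1 h⟩
  · rintro ⟨v, d, rfl, h⟩
    exact edgeAt_mem_edges.2 h

theorem edges_mono {Λ Λ' : Finset Vert} (h : Λ ⊆ Λ') : edges Λ ⊆ edges Λ' := by
  intro e he
  obtain ⟨v, d, rfl, h1, h2⟩ := mem_edges.1 he
  exact edgeAt_mem_edges.2 ⟨h h1, h h2⟩

/-- `ω` and `ω'` have the same local configuration at `v`. -/
def SameAt (v : Vert) (ω ω' : Set (Sym2 Vert)) : Prop :=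
  ∀ d, edgeAt v d ∈ ω ↔ edgeAt v d ∈ ω'

/-- The edge of direction `d` at `v` has a state different from that of the two others. -/
def OddAt (ω : Set (Sym2 Vert)) (v : Vert) (d : Dir) : Prop :=
  ∀ d', d' ≠ d → (edgeAt v d' ∈ ω ↔ edgeAt v d ∉ ω)

theorem SameAt.symm {v : Vert} {ω ω' : Set (Sym2 Vert)} (h : SameAt v ω ω') : SameAt v ω' ω :=
  fun d => (h d).symm

theorem SameAt.refl (v : Vert) (ω : Set (Sym2 Vert)) : SameAt v ω ω := fun _ => Iff.rfl

theorem SameAt.trans {v : Vert} {ω ω' ω'' : Set (Sym2 Vert)} (h : SameAt v ω ω')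
    (h' : SameAt v ω' ω'') : SameAt v ω ω'' := fun d => (h d).trans (h' d)

theorem SameAt.oddAt_iff {v : Vert} {ω ω' : Set (Sym2 Vert)} (h : SameAt v ω ω') (d : Dir) :
    OddAt ω v d ↔ OddAt ω' v d := by
  unfold OddAt
  simp only [h _]

theorem ncard_dir (P : Dir → Prop) :
    ({d : Dir | P d}.ncard = 1 ∨ {d : Dir | P d}.ncard = 2) ↔
      (∃ d, P d) ∧ ∃ d, ¬ P d := by
  classical
  have : {d : Dir | P d}.ncard = (if P Dir.H then 1 else 0) + (if P Dir.NW then 1 else 0) +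
      (if P Dir.NE then 1 else 0) := by
    rw [← Finset.coe_filter_univ, Set.ncard_coe_finset, Finset.card_filter]
    have : (Finset.univ : Finset Dir) = {Dir.H, Dir.NW, Dir.NE} := rfl
    rw [this, Finset.sum_insert (by simp), Finset.sum_insert (by simp), Finset.sum_singleton,
      add_assoc]
  rw [this, Dir.exists_iff, Dir.exists_iff]
  split_ifs <;> simp_all

theorem exists_oddAt_iff (ω : Set (Sym2 Vert)) (v : Vert) :
    (∃ d, OddAt ω v d) ↔ (∃ d, edgeAt v d ∈ ω) ∧ ∃ d, edgeAt v d ∉ ω := by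
  simp only [OddAt, Dir.exists_iff, Dir.forall_iff]
  by_cases h1 : edgeAt v Dir.H ∈ ω <;> by_cases h2 : edgeAt v Dir.NW ∈ ω <;>
    by_cases h3 : edgeAt v Dir.NE ∈ ω <;> simp [h1, h2, h3]

theorem OddAt.unique {ω : Set (Sym2 Vert)} {v : Vert} {d d' : Dir} (h : OddAt ω v d)
    (h' : OddAt ω v d') : d = d' := by
  by_contra hne
  have h1 := h d' (Ne.symm hne)
  have h2 := h' d hne
  have h3 := h (third d d') (third_ne_left (Ne.symm hne))
  have h4 := h' (third d d') (third_ne_right (Ne.symm hne))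
  tauto

/-- The degree condition only forbids three equal states at a vertex, so it amounts to the existence
of an odd edge. This form is symmetric in present and absent edges. -/
theorem isConfig_iff {ω : Set (Sym2 Vert)} :
    IsConfig ω ↔ ω ⊆ hexLattice.edgeSet ∧ ∀ v, ∃ d, OddAt ω v d := by
  unfold IsConfig
  simp only [ncard_dir, exists_oddAt_iff]

theorem IsConfig.exists_oddAt {ω : Set (Sym2 Vert)} (h : IsConfig ω) (v : Vert) :
    ∃ d, OddAt ω v d := (isConfig_iff.1 h).2 v

theorem localWeight_eq (a b c : ℝ) {ω : Set (Sym2 Vert)} {v : Vert} {d : Dir}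
    (h : OddAt ω v d) : localWeight a b c ω v = dirWeight a b c d := by
  classical
  unfold localWeight
  rw [Finset.sum_eq_single d]
  · exact if_pos h
  · intro d' _ hd'
    exact if_neg fun h' => hd' (OddAt.unique h' h)
  · simp

theorem SameAt.localWeight_eq {v : Vert} {ω ω' : Set (Sym2 Vert)} (h : SameAt v ω ω')
    (a b c : ℝ) : localWeight a b c ω v = localWeight a b c ω' v := by
  unfold localWeight
  classical
  exact Finset.sum_congr rfl fun d _ => if_congr (h.oddAt_iff d) rfl rfl

/-- The condition that defines `State Λ bd`. -/
def Compat (Λ : Finset Vert) (bd ω : Set (Sym2 Vert)) : Prop :=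
  IsConfig ω ∧ AgreesOutside Λ bd ω

theorem mem_symmDiff_iff {ω F : Set (Sym2 Vert)} {e : Sym2 Vert} :
    e ∈ symmDiff ω F ↔ (e ∈ ω ↔ e ∉ F) := by
  rw [Set.mem_symmDiff]
  tauto

/-- A set that looks locally everywhere like one of two compatible configurations is compatible. -/
theorem Compat.of_sameAt {Λ : Finset Vert} {bd ω ω' η : Set (Sym2 Vert)}
    (h : Compat Λ bd ω) (h' : Compat Λ bd ω') (hη : η ⊆ hexLattice.edgeSet)
    (hs : ∀ v, SameAt v η ω ∨ SameAt v η ω') : Compat Λ bd η := by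
  refine ⟨isConfig_iff.2 ⟨hη, fun v => ?_⟩, fun e he heΛ => ?_⟩
  · rcases hs v with hv | hv
    · obtain ⟨d, hd⟩ := h.1.exists_oddAt v
      exact ⟨d, (hv.oddAt_iff d).2 hd⟩
    · obtain ⟨d, hd⟩ := h'.1.exists_oddAt v
      exact ⟨d, (hv.oddAt_iff d).2 hd⟩
  · obtain ⟨v, d, rfl⟩ := mem_edgeSet.1 he
    rcases hs v with hv | hv
    · exact (hv d).trans (h.2 _ he heΛ)
    · exact (hv d).trans (h'.2 _ he heΛ)

theorem Compat.subset_edges {Λ : Finset Vert} {bd ω ω' : Set (Sym2 Vert)}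
    (h : Compat Λ bd ω) (h' : Compat Λ bd ω') : symmDiff ω ω' ⊆ ↑(edges Λ) := by
  intro e he
  by_contra hn
  have hn : e ∉ edges Λ := hn
  rw [mem_symmDiff_iff] at he
  by_cases hE : e ∈ hexLattice.edgeSet
  · have h1 := h.2 e hE hn
    have h2 := h'.2 e hE hn
    tauto
  · have h1 : e ∉ ω := fun h3 => hE (h.1.1 h3)
    have h2 : e ∉ ω' := fun h3 => hE (h'.1.1 h3)
    tauto

theorem symmDiff_edge_sameAt {ω : Set (Sym2 Vert)} {v u : Vert} {d : Dir} (h1 : u ≠ v)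
    (h2 : u ≠ nbr d v) : SameAt u (symmDiff ω {edgeAt v d}) ω := by
  intro d'
  rw [mem_symmDiff_iff, Set.mem_singleton_iff]
  have : edgeAt u d' ≠ edgeAt v d := by
    intro h
    obtain ⟨-, h | h⟩ := edgeAt_eq_iff.1 h.symm
    · exact h1 h
    · exact h2 h
  tauto

theorem exists_oddAt_flip {ω : Set (Sym2 Vert)} {v : Vert} {d : Dir}
    (hd : ¬ OddAt ω v d) : ∃ d', OddAt (symmDiff ω {edgeAt v d}) v d' := by
  rw [exists_oddAt_iff]
  simp only [mem_symmDiff_iff, Set.mem_singleton_iff, edgeAt_inj]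
  simp only [OddAt, Dir.forall_iff] at hd
  simp only [Dir.exists_iff]
  cases d <;> simp at hd ⊢ <;> tauto

/-- Flipping the odd edge of a vertex makes all three states equal, while flipping another edge does
not. Oddness at an endpoint is therefore the only obstruction to a flip. -/
theorem flip_compat {Λ : Finset Vert} {bd ω : Set (Sym2 Vert)} (h : Compat Λ bd ω) {v : Vert}
    {d : Dir} (he : edgeAt v d ∈ edges Λ) (h1 : ¬ OddAt ω v d) (h2 : ¬ OddAt ω (nbr d v) d) :
    Compat Λ bd (symmDiff ω {edgeAt v d}) := by
  refine ⟨isConfig_iff.2 ⟨?_, fun u => ?_⟩, fun e heE heΛ => ?_⟩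
  · intro e he'
    rcases he' with ⟨h3, -⟩ | ⟨h3, -⟩
    · exact h.1.1 h3
    · rw [Set.mem_singleton_iff.1 h3]
      exact edgeAt_mem_edgeSet v d
  · by_cases hu : u = v
    · subst hu
      exact exists_oddAt_flip h1
    by_cases hu' : u = nbr d v
    · subst hu'
      rw [← edgeAt_nbr]
      exact exists_oddAt_flip h2
    · obtain ⟨d', hd'⟩ := h.1.exists_oddAt u
      exact ⟨d', ((symmDiff_edge_sameAt hu hu').oddAt_iff d').2 hd'⟩
  · rw [mem_symmDiff_iff, Set.mem_singleton_iff]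
    have : e ≠ edgeAt v d := fun h3 => heΛ (h3 ▸ he)
    have := h.2 e heE heΛ
    tauto

end OneTwo

namespace OneTwo

/-! ### Differences without flippable edges -/

section Locked

open Classical in
/-- The indicator, on darts, of the edges of `D`. -/
noncomputable def dartInd (D : Set (Sym2 Vert)) (v : Vert) (d : Dir) : ℤ :=
  if edgeAt v d ∈ D then 1 else 0

open Classical in
/-- The indicator of the darts on `D` that are odd in `ω`. -/
noncomputable def dartOdd (D ω : Set (Sym2 Vert)) (v : Vert) (d : Dir) : ℤ :=
  if edgeAt v d ∈ D ∧ OddAt ω v d then 1 else 0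

/-- The sum is the degree of `v` in `D`, the difference, minus 2 if the odd edge of `ω` lies in `D`.
In that case the degree is at least 2, since `ω'` would otherwise have three equal states. The value
0 leaves only the degrees 0 and 2. -/
theorem local_count {ω ω' : Set (Sym2 Vert)} {v : Vert} (h : ∃ d, OddAt ω v d)
    (h' : ∃ d, OddAt ω' v d) :
    0 ≤ ∑ d, (dartInd (symmDiff ω ω') v d - 2 * dartOdd (symmDiff ω ω') ω v d) ∧
      (∑ d, (dartInd (symmDiff ω ω') v d - 2 * dartOdd (symmDiff ω ω') ω v d) = 0 →
        (∀ d, edgeAt v d ∉ symmDiff ω ω') ∨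
          ∃ d, edgeAt v d ∉ symmDiff ω ω' ∧ ∀ d', d' ≠ d → edgeAt v d' ∈ symmDiff ω ω') := by
  rw [exists_oddAt_iff] at h h'
  have : (Finset.univ : Finset Dir) = {Dir.H, Dir.NW, Dir.NE} := rfl
  rw [this, Finset.sum_insert (by simp), Finset.sum_insert (by simp), Finset.sum_singleton]
  simp only [Dir.exists_iff, Dir.forall_iff, dartInd, dartOdd, OddAt] at *
  by_cases h1 : edgeAt v Dir.H ∈ ω <;> by_cases h2 : edgeAt v Dir.NW ∈ ω <;>
    by_cases h3 : edgeAt v Dir.NE ∈ ω <;> by_cases h4 : edgeAt v Dir.H ∈ ω' <;>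
    by_cases h5 : edgeAt v Dir.NW ∈ ω' <;> by_cases h6 : edgeAt v Dir.NE ∈ ω' <;>
    simp [h1, h2, h3, h4, h5, h6, mem_symmDiff_iff, Dir.forall_iff] at h h' ⊢

/-- If no edge on which `ω` and `ω'` differ can be flipped in `ω`, then these edges form a
2-regular graph, and each of them is odd at exactly one of its endpoints. -/
theorem locked_structure {Λ : Finset Vert} {bd ω ω' : Set (Sym2 Vert)} (h : Compat Λ bd ω)
    (h' : Compat Λ bd ω')
    (hno : ∀ v d, edgeAt v d ∈ symmDiff ω ω' → OddAt ω v d ∨ OddAt ω (nbr d v) d) :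
    (∀ v d, edgeAt v d ∈ symmDiff ω ω' → ¬ (OddAt ω v d ∧ OddAt ω (nbr d v) d)) ∧
    ∀ v, (∀ d, edgeAt v d ∉ symmDiff ω ω') ∨
      ∃ d, edgeAt v d ∉ symmDiff ω ω' ∧ ∀ d', d' ≠ d → edgeAt v d' ∈ symmDiff ω ω' := by
  classical
  set D := symmDiff ω ω' with hD
  have hsub : ∀ v d, edgeAt v d ∈ D → v ∈ Λ ∧ nbr d v ∈ Λ := fun v d hv =>
    edgeAt_mem_edges.1 (h.subset_edges h' hv)
  -- `T` is the set of darts on `D`, so each edge counts twice, and reversing a dart permutes `T`.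
  let T : Finset (Vert × Dir) := (Λ ×ˢ Finset.univ).filter fun x => edgeAt x.1 x.2 ∈ D
  have hT : ∀ x, x ∈ T ↔ edgeAt x.1 x.2 ∈ D := by
    intro x
    simp only [T, Finset.mem_filter, Finset.mem_product, Finset.mem_univ, and_true]
    exact ⟨fun h => h.2, fun h => ⟨(hsub _ _ h).1, h⟩⟩
  have hsymm : ∑ x ∈ T, dartOdd D ω (nbr x.2 x.1) x.2 = ∑ x ∈ T, dartOdd D ω x.1 x.2 := by
    refine Finset.sum_nbij' (fun x => (nbr x.2 x.1, x.2)) (fun x => (nbr x.2 x.1, x.2)) ?_ ?_ ?_ ?_ ?_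
    · intro x hx
      rw [hT] at *
      simpa only [edgeAt_nbr] using hx
    · intro x hx
      rw [hT] at *
      simpa only [edgeAt_nbr] using hx
    · intro x _
      simp [nbr_nbr]
    · intro x _
      simp [nbr_nbr]
    · intro x _
      rfl
  have hlower : ∀ x ∈ T, 0 ≤ dartOdd D ω x.1 x.2 + dartOdd D ω (nbr x.2 x.1) x.2 - 1 := by
    intro x hx
    rw [hT] at hx
    unfold dartOdd
    rw [edgeAt_nbr]
    rcases hno x.1 x.2 hx with h1 | h1 <;> simp only [hx, h1, and_self, true_and, if_true] <;>
      split_ifs <;> norm_num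
  have hsum1 : ∑ x ∈ T, (dartOdd D ω x.1 x.2 + dartOdd D ω (nbr x.2 x.1) x.2 - 1) =
      2 * ∑ x ∈ T, dartOdd D ω x.1 x.2 - T.card := by
    rw [Finset.sum_sub_distrib, Finset.sum_add_distrib, hsymm]
    simp
    ring
  have hsum2 : ∑ v ∈ Λ, ∑ d, (dartInd D v d - 2 * dartOdd D ω v d) =
      T.card - 2 * ∑ x ∈ T, dartOdd D ω x.1 x.2 := by
    rw [← Finset.sum_product', Finset.sum_sub_distrib, ← Finset.mul_sum]
    congr 1
    · simp only [T, Finset.card_filter, dartInd]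
      push_cast
      rfl
    · congr 1
      rw [Finset.sum_filter]
      refine Finset.sum_congr rfl fun x _ => ?_
      unfold dartOdd
      split_ifs <;> tauto
  -- The edge count gives at least half of the darts odd, the vertex count at most half. The two
  -- nonnegative sums are opposite, so every term of both vanishes.
  have hnonneg1 := Finset.sum_nonneg hlower
  have hnonneg2 : ∀ v ∈ Λ, 0 ≤ ∑ d, (dartInd D v d - 2 * dartOdd D ω v d) := fun v _ =>
    (local_count (h.1.exists_oddAt v) (h'.1.exists_oddAt v)).1
  have hnonneg3 := Finset.sum_nonneg hnonneg2
  have hz1 := (Finset.sum_eq_zero_iff_of_nonneg hlower).1 (by linarith)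
  have hz2 := (Finset.sum_eq_zero_iff_of_nonneg hnonneg2).1 (by linarith)
  constructor
  · rintro v d hv ⟨h1, h2⟩
    have := hz1 (v, d) ((hT _).2 hv)
    simp [dartOdd, edgeAt_nbr, hv, h1, h2] at this
  · intro v
    by_cases hv : v ∈ Λ
    · exact (local_count (h.1.exists_oddAt v) (h'.1.exists_oddAt v)).2 (hz2 v hv)
    · exact Or.inl fun d hd => hv (hsub v d hd).1

end Locked

/-! ### Moves, and pushing into an enclosed region -/

/-- One move of the chain: a single edge flip or a face flip. -/
def Step (Λ : Finset Vert) (bd ω ω' : Set (Sym2 Vert)) : Prop :=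
  Compat Λ bd ω ∧ Compat Λ bd ω' ∧ ((∃ v d, symmDiff ω ω' = {edgeAt v d}) ∨ FaceFlip ω ω')

/-- Connectedness by moves. -/
def Reach (Λ : Finset Vert) (bd : Set (Sym2 Vert)) : Set (Sym2 Vert) → Set (Sym2 Vert) → Prop :=
  Relation.ReflTransGen (Step Λ bd)

theorem FaceFlip.symm {ω ω' : Set (Sym2 Vert)} (h : FaceFlip ω ω') : FaceFlip ω' ω := by
  obtain ⟨f, h0, h1, h2, h3, h4, h5⟩ := h
  exact ⟨f, h0, by rw [symmDiff_comm, h1], h3, h2, h5, h4⟩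

theorem Step.symm {Λ : Finset Vert} {bd ω ω' : Set (Sym2 Vert)} (h : Step Λ bd ω ω') :
    Step Λ bd ω' ω := by
  refine ⟨h.2.1, h.1, ?_⟩
  rcases h.2.2 with h1 | h1
  · left
    rwa [symmDiff_comm]
  · exact Or.inr h1.symm

theorem Reach.symm {Λ : Finset Vert} {bd ω ω' : Set (Sym2 Vert)} (h : Reach Λ bd ω ω') :
    Reach Λ bd ω' ω := by
  have : Std.Symm (Step Λ bd) := ⟨fun _ _ h => h.symm⟩
  exact Relation.ReflTransGen.stdSymm.symm _ _ h

theorem Reach.trans {Λ : Finset Vert} {bd ω ω' ω'' : Set (Sym2 Vert)} (h : Reach Λ bd ω ω')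
    (h' : Reach Λ bd ω' ω'') : Reach Λ bd ω ω'' :=
  Relation.ReflTransGen.trans h h'

theorem flip_step {Λ : Finset Vert} {bd ω : Set (Sym2 Vert)} (h : Compat Λ bd ω) {v : Vert}
    {d : Dir} (he : edgeAt v d ∈ edges Λ) (h1 : ¬ OddAt ω v d) (h2 : ¬ OddAt ω (nbr d v) d) :
    Step Λ bd ω (symmDiff ω {edgeAt v d}) := by
  refine ⟨h, flip_compat h he h1 h2, Or.inl ⟨v, d, ?_⟩⟩
  rw [symmDiff_symmDiff_cancel_left]

/-- Pushing along an alternating path into a region `U` which all boundary edges enter. -/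
theorem push (Λ : Finset Vert) (bd : Set (Sym2 Vert)) (τ : Prop) (n : ℕ) :
    ∀ (U : Finset Vert), U.card = n → ∀ (ω : Set (Sym2 Vert)),
      (∀ u ∈ U, u ∈ Λ ∧ ∀ d, nbr d u ∈ Λ) →
      (∀ x ∉ U, ∀ d, nbr d x ∈ U → (edgeAt x d ∈ ω ↔ (IsBlack x ↔ τ))) →
      ∀ x ∉ U, ∀ d, nbr d x ∈ U →
      ∃ F : Set (Sym2 Vert),
        (∀ v ∉ U, ∀ d', edgeAt v d' ∈ F ↔ edgeAt v d' = edgeAt x d) ∧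
        ∀ η, Compat Λ bd η → (∀ u ∈ U, SameAt u η ω) → ¬ OddAt η x d →
          Compat Λ bd (symmDiff η F) ∧ Reach Λ bd η (symmDiff η F) := by
  induction n with
  | zero =>
    intro U hU ω _ _ x _ d hd
    rw [Finset.card_eq_zero.1 hU] at hd
    simp at hd
  | succ n ih =>
    intro U hU ω hΛ hb x hx d hd
    set u := nbr d x with hu
    have hxu : x = nbr d u := (nbr_nbr d x).symm
    have hexu : edgeAt u d = edgeAt x d := edgeAt_nbr d x
    have hmem : edgeAt x d ∈ edges Λ := by
      rw [edgeAt_mem_edges]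
      refine ⟨?_, (hΛ u hd).1⟩
      rw [hxu]
      exact (hΛ u hd).2 d
    -- If the entering edge is not odd at its inner endpoint `u`, it can be flipped at once.
    -- Otherwise another edge of `u` has to be flipped before it.
    by_cases hodd : OddAt ω u d
    · obtain ⟨d', hd'⟩ : ∃ d', d' ≠ d := by cases d <;> simp [Dir.exists_iff]
      have hcol : IsBlack u ↔ ¬ IsBlack x := isBlack_nbr d x
      -- All outer neighbours of `u` have the colour of `x`, so their edges into `u` have the state
      -- of the edge `d`. The other two edges have the opposite state, hence they stay inside `U`.
      have hinU : ∀ d'', d'' ≠ d → nbr d'' u ∈ U := by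
        intro d'' hne
        by_contra hn
        have h1 := hb (nbr d'' u) hn d'' (by rwa [nbr_nbr])
        rw [edgeAt_nbr, isBlack_nbr, hodd d'' hne, hexu, hb x hx d hd] at h1
        tauto
      have hcard : (U.erase u).card = n := by rw [Finset.card_erase_of_mem hd, hU]; rfl
      -- With `u` removed from `U` the hypothesis on entering edges persists: both the colour and
      -- the state are reversed when passing from `x` to `u`.
      obtain ⟨F, hF1, hF2⟩ := ih (U.erase u) hcard ω
        (fun w hw => hΛ w (Finset.mem_of_mem_erase hw)) (by
          intro y hy d'' hyd
          have hyd' := Finset.mem_of_mem_erase hyd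
          by_cases hyU : y ∈ U
          · have hyu : y = u := by
              by_contra hne
              exact hy (Finset.mem_erase.2 ⟨hne, hyU⟩)
            subst hyu
            have hne : d'' ≠ d := by
              rintro rfl
              rw [← hxu] at hyd'
              exact hx hyd'
            rw [hodd d'' hne, hexu, hb x hx d hd]
            tauto
          · exact hb y hyU d'' hyd') u (Finset.notMem_erase u U) d'
          (Finset.mem_erase.2 ⟨nbr_ne d' u, hinU d' hd'⟩)
      have hxF : edgeAt x d ∉ F := by
        rw [hF1 x (fun h => hx (Finset.mem_of_mem_erase h)), ← hexu, edgeAt_inj]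
        exact Ne.symm hd'
      refine ⟨symmDiff F {edgeAt x d}, ?_, ?_⟩
      · intro v hv d''
        rw [mem_symmDiff_iff, Set.mem_singleton_iff,
          hF1 v (fun h => hv (Finset.mem_of_mem_erase h))]
        have : edgeAt v d'' ≠ edgeAt u d' := by
          intro h
          obtain ⟨-, h1 | h1⟩ := edgeAt_eq_iff.1 h.symm
          · exact hv (h1 ▸ hd)
          · exact hv (h1 ▸ hinU d' hd')
        tauto
      · intro η hη hsame hodd'
        have hno : ¬ OddAt η u d' := by
          rw [(hsame u hd).oddAt_iff]
          exact fun h => hd' (h.unique hodd)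
        obtain ⟨hc, hr⟩ := hF2 η hη (fun w hw => hsame w (Finset.mem_of_mem_erase hw)) hno
        have hsx : SameAt x (symmDiff η F) η := by
          intro d''
          rw [mem_symmDiff_iff, hF1 x (fun h => hx (Finset.mem_of_mem_erase h))]
          have : edgeAt x d'' ≠ edgeAt u d' := by
            intro h
            obtain ⟨-, h1 | h1⟩ := edgeAt_eq_iff.1 h.symm
            · exact hx (h1 ▸ hd)
            · exact hx (h1 ▸ hinU d' hd')
          tauto
        have hn2 : ¬ OddAt (symmDiff η F) u d := by
          intro h
          have h1 := h d' hd'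
          rw [mem_symmDiff_iff, mem_symmDiff_iff, hF1 u (Finset.notMem_erase u U),
            hF1 u (Finset.notMem_erase u U), edgeAt_inj, hsame u hd, hsame u hd,
            hodd d' hd', edgeAt_inj] at h1
          have : ¬ d = d' := Ne.symm hd'
          tauto
        have hst := flip_step hc hmem (by rwa [hsx.oddAt_iff]) hn2
        rw [← symmDiff_assoc]
        exact ⟨hst.2.1, hr.trans (Relation.ReflTransGen.single hst)⟩
    · refine ⟨{edgeAt x d}, fun v _ d' => Set.mem_singleton_iff, fun η hη hsame hodd' => ?_⟩
      have hst := flip_step hη hmem hodd' (by rwa [(hsame _ hd).oddAt_iff])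
      exact ⟨hst.2.1, Relation.ReflTransGen.single hst⟩

end OneTwo

namespace OneTwo

/-! ### A parity height function for an even edge set -/

/-- The zigzag edge from `v` to its right neighbour in the same zigzag path. -/
def zig (v : Vert) : Sym2 Vert := s(v, (v.1, v.2 + 1))

/-- The horizontal edge from `v` to the next zigzag path (an edge only if `v` is black). -/
def hor (v : Vert) : Sym2 Vert := s(v, (v.1 + 1, v.2))

open Classical in
theorem edgeAt_H (v : Vert) :
    edgeAt v Dir.H = if IsBlack v then hor v else hor (v.1 - 1, v.2) := by
  unfold edgeAt nbr hor
  split_ifs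
  · rfl
  · rw [Sym2.eq_swap]
    simp

open Classical in
theorem edgeAt_NW (v : Vert) :
    edgeAt v Dir.NW = if IsBlack v then zig v else zig (v.1, v.2 - 1) := by
  unfold edgeAt nbr zig
  split_ifs
  · rfl
  · rw [Sym2.eq_swap]
    simp

open Classical in
theorem edgeAt_NE (v : Vert) :
    edgeAt v Dir.NE = if IsBlack v then zig (v.1, v.2 - 1) else zig v := by
  unfold edgeAt nbr zig
  split_ifs
  · rw [Sym2.eq_swap]
    simp
  · rfl

theorem zig_eq_edgeAt (v : Vert) : ∃ d, zig v = edgeAt v d := by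
  classical
  by_cases h : IsBlack v
  · exact ⟨Dir.NW, by rw [edgeAt_NW, if_pos h]⟩
  · exact ⟨Dir.NE, by rw [edgeAt_NE, if_neg h]⟩

theorem zig_pred_eq_edgeAt (v : Vert) : ∃ d, zig (v.1, v.2 - 1) = edgeAt v d := by
  classical
  by_cases h : IsBlack v
  · exact ⟨Dir.NE, by rw [edgeAt_NE, if_pos h]⟩
  · exact ⟨Dir.NW, by rw [edgeAt_NW, if_neg h]⟩

theorem hor_mem_edgeSet {v : Vert} : hor v ∈ hexLattice.edgeSet ↔ IsBlack v := by
  classical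
  constructor
  · intro h
    rw [hor, SimpleGraph.mem_edgeSet] at h
    obtain ⟨d, hd⟩ := h
    by_contra hv
    cases d <;> simp [nbr, hv, Prod.ext_iff] at hd
    omega
  · intro h
    have := edgeAt_H v
    rw [if_pos h] at this
    rw [← this]
    exact edgeAt_mem_edgeSet _ _

theorem isBlack_pred {v : Vert} : IsBlack (v.1 - 1, v.2) ↔ ¬ IsBlack v := by
  simp only [IsBlack, Int.even_iff]
  omega

theorem edgeAt_vert {D : Set (Sym2 Vert)} (v : Vert) (h : ∀ d, edgeAt v d ∉ D)
    (hD : D ⊆ hexLattice.edgeSet) :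
    zig v ∉ D ∧ zig (v.1, v.2 - 1) ∉ D ∧ hor v ∉ D ∧ hor (v.1 - 1, v.2) ∉ D := by
  classical
  refine ⟨?_, ?_, ?_, ?_⟩
  · obtain ⟨d, hd⟩ := zig_eq_edgeAt v
    exact hd ▸ h d
  · obtain ⟨d, hd⟩ := zig_pred_eq_edgeAt v
    exact hd ▸ h d
  · intro h1
    have h2 := hor_mem_edgeSet.1 (hD h1)
    have := h Dir.H
    rw [edgeAt_H, if_pos h2] at this
    exact this h1
  · intro h1
    have h2 := isBlack_pred.1 (hor_mem_edgeSet.1 (hD h1))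
    have := h Dir.H
    rw [edgeAt_H, if_neg h2] at this
    exact this h1

open Classical in
/-- The parity of the number of edges of `D` crossed from the left boundary to the face to the
right of `v` and above the zigzag path of `v`. -/
noncomputable def height (D : Set (Sym2 Vert)) (q₀ p q : ℤ) : ZMod 2 :=
  ∑ j ∈ Finset.Icc q₀ q, if hor (p, j) ∈ D then 1 else 0

theorem mem_box {o v : Vert} {k n : ℕ} :
    v ∈ box o k n ↔ (o.1 ≤ v.1 ∧ v.1 < o.1 + k) ∧ o.2 ≤ v.2 ∧ v.2 < o.2 + n := by
  simp [box]

section Height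

variable {o : Vert} {k n : ℕ} {D : Set (Sym2 Vert)}

theorem hor_mem_box (hD : D ⊆ ↑(edges (box o k n))) {p q : ℤ} (h : hor (p, q) ∈ D) :
    IsBlack (p, q) ∧ (o.1 ≤ p ∧ p + 1 < o.1 + k) ∧ o.2 ≤ q ∧ q < o.2 + n := by
  classical
  have h1 := hD h
  rw [Finset.mem_coe] at h1
  have h2 : IsBlack (p, q) := hor_mem_edgeSet.1 (Finset.mem_filter.1 h1).2
  have h3 := edgeAt_H (p, q)
  rw [if_pos h2] at h3
  rw [← h3, edgeAt_mem_edges, mem_box, mem_box] at h1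
  simp only [nbr, if_pos h2] at h1
  exact ⟨h2, by omega⟩

theorem zig_mem_box (hD : D ⊆ ↑(edges (box o k n))) {p q : ℤ} (h : zig (p, q) ∈ D) :
    (o.1 ≤ p ∧ p < o.1 + k) ∧ o.2 ≤ q ∧ q + 1 < o.2 + n := by
  classical
  have h1 := hD h
  rw [Finset.mem_coe] at h1
  obtain ⟨hm, -⟩ := Finset.mem_filter.1 h1
  rw [zig, Finset.mk_mem_sym2_iff, mem_box, mem_box] at hm
  simp only at hm
  omega

open Classical in
theorem height_succ (hD : D ⊆ ↑(edges (box o k n))) (p q : ℤ) :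
    height D o.2 p q = height D o.2 p (q - 1) + if hor (p, q) ∈ D then 1 else 0 := by
  unfold height
  by_cases hq : o.2 ≤ q
  · have : Finset.Icc o.2 q = insert q (Finset.Icc o.2 (q - 1)) := by
      ext x
      simp only [Finset.mem_Icc, Finset.mem_insert]
      omega
    rw [this, Finset.sum_insert (by simp), add_comm]
  · rw [Finset.Icc_eq_empty (by omega), Finset.Icc_eq_empty (by omega), if_neg]
    · simp
    · intro h
      exact hq (hor_mem_box hD h).2.2.1

theorem height_left (p q : ℤ) (hq : q < o.2) : height D o.2 p q = 0 := by
  unfold height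
  rw [Finset.Icc_eq_empty (by omega), Finset.sum_empty]

open Classical in
-- Moving one column to the right changes the two heights by the horizontal edges at `(p, q)`. As
-- the degree in `D` is even, the sum changes exactly as the zigzag edge does; to the left of the
-- box everything is 0.
theorem height_zig (hD : D ⊆ ↑(edges (box o k n)))
    (hreg : ∀ v, (∀ d, edgeAt v d ∉ D) ∨ ∃ d, edgeAt v d ∉ D ∧ ∀ d', d' ≠ d → edgeAt v d' ∈ D)
    (p q : ℤ) :
    height D o.2 p q + height D o.2 (p - 1) q = if zig (p, q) ∈ D then 1 else 0 := by
  have hDE : D ⊆ hexLattice.edgeSet := fun e he => (Finset.mem_filter.1 (hD he)).2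
  have hdeg : ∀ v : Vert, (if zig v ∈ D then 1 else 0 : ZMod 2) +
      (if zig (v.1, v.2 - 1) ∈ D then 1 else 0) + (if hor v ∈ D then 1 else 0) +
      (if hor (v.1 - 1, v.2) ∈ D then 1 else 0) = 0 := by
    intro v
    rcases hreg v with h | ⟨d, hd, hd'⟩
    · obtain ⟨h1, h2, h3, h4⟩ := edgeAt_vert v h hDE
      simp [h1, h2, h3, h4]
    · have e1 := edgeAt_H v
      have e2 := edgeAt_NW v
      have e3 := edgeAt_NE v
      by_cases hv : IsBlack v
      · have hn : hor (v.1 - 1, v.2) ∉ D := fun h =>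
          isBlack_pred.1 (hor_mem_edgeSet.1 (hDE h)) hv
        rw [if_pos hv] at e1 e2 e3
        rw [← e1, ← e2, ← e3]
        cases d
        · simp [hd, hn, hd' Dir.NW, hd' Dir.NE, CharTwo.add_self_eq_zero]
        · simp [hd, hn, hd' Dir.H, hd' Dir.NE, CharTwo.add_self_eq_zero]
        · simp [hd, hn, hd' Dir.H, hd' Dir.NW, CharTwo.add_self_eq_zero]
      · have hn : hor v ∉ D := fun h => hv (hor_mem_edgeSet.1 (hDE h))
        rw [if_neg hv] at e1 e2 e3
        rw [← e1, ← e2, ← e3]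
        cases d
        · simp [hd, hn, hd' Dir.NW, hd' Dir.NE, CharTwo.add_self_eq_zero]
        · simp [hd, hn, hd' Dir.H, hd' Dir.NE, CharTwo.add_self_eq_zero]
        · simp [hd, hn, hd' Dir.H, hd' Dir.NW, CharTwo.add_self_eq_zero]
  have hleft : ∀ q, q < o.2 →
      height D o.2 p q + height D o.2 (p - 1) q = if zig (p, q) ∈ D then 1 else 0 := by
    intro q hq
    rw [height_left p q hq, height_left (p - 1) q hq, if_neg]
    · simp
    · intro h
      have := (zig_mem_box hD h).2.1
      omega
  by_cases hq : q < o.2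
  · exact hleft q hq
  · have key : ∀ q, o.2 - 1 ≤ q →
        height D o.2 p q + height D o.2 (p - 1) q = if zig (p, q) ∈ D then 1 else 0 := by
      intro q hq
      induction q, hq using Int.leInduction with
      | base => exact hleft _ (by omega)
      | succ q hq ih =>
        have h1 := height_succ hD p (q + 1)
        have h2 := height_succ hD (p - 1) (q + 1)
        have h3 := hdeg (p, q + 1)
        simp only [add_sub_cancel_right] at h1 h2 h3
        rw [h1, h2]
        have h4 : ∀ a b c d e f : ZMod 2, a + b = c → d + c + e + f = 0 →
            a + e + (b + f) = d := by decide
        exact h4 _ _ _ _ _ _ ih h3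
    exact key q (by omega)

/-- Beyond the right end of the box no zigzag edge lies in `D`, so the height there is the same in
all rows, and it is 0 in the row below the box. -/
theorem height_ne_zero (hD : D ⊆ ↑(edges (box o k n)))
    (hreg : ∀ v, (∀ d, edgeAt v d ∉ D) ∨ ∃ d, edgeAt v d ∉ D ∧ ∀ d', d' ≠ d → edgeAt v d' ∈ D)
    {p q : ℤ} (h : height D o.2 p q ≠ 0) : (p, q) ∈ box o k n := by
  classical
  have hrow : o.1 ≤ p ∧ p + 1 < o.1 + k := by
    unfold height at h
    obtain ⟨j, -, hj⟩ := Finset.exists_ne_zero_of_sum_ne_zero h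
    have : hor (p, j) ∈ D := by
      by_contra hn
      simp [hn] at hj
    exact (hor_mem_box hD this).2.1
  rw [mem_box]
  refine ⟨⟨hrow.1, by dsimp only; omega⟩, ?_, ?_⟩
  · by_contra hn
    exact h (height_left p q (not_le.1 hn))
  · by_contra hn
    dsimp only at hn
    apply h
    have key : ∀ p, o.1 - 1 ≤ p → height D o.2 p q = 0 := by
      intro p hp
      induction p, hp using Int.leInduction with
      | base =>
        unfold height
        refine Finset.sum_eq_zero fun j _ => if_neg fun hj => ?_
        have := (hor_mem_box hD hj).2.1
        omega
      | succ p hp ih =>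
        have h1 := height_zig hD hreg (p + 1) q
        rw [add_sub_cancel_right, ih, add_zero, if_neg] at h1
        · exact h1
        · intro hz
          have := zig_mem_box hD hz
          omega
    exact key p (by omega)

theorem height_nbr (hD : D ⊆ ↑(edges (box o k n)))
    (hreg : ∀ v, (∀ d, edgeAt v d ∉ D) ∨ ∃ d, edgeAt v d ∉ D ∧ ∀ d', d' ≠ d → edgeAt v d' ∈ D)
    {v : Vert} {d : Dir} (h1 : ∀ d', edgeAt v d' ∉ D) (h2 : ∀ d', edgeAt (nbr d v) d' ∉ D) :
    height D o.2 (nbr d v).1 (nbr d v).2 = height D o.2 v.1 v.2 := by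
  classical
  have hDE : D ⊆ hexLattice.edgeSet := fun e he => (Finset.mem_filter.1 (hD he)).2
  have hZ : ∀ p q, (∀ d', edgeAt (p, q + 1) d' ∉ D) →
      height D o.2 p (q + 1) = height D o.2 p q := by
    intro p q h
    rw [height_succ hD p (q + 1), if_neg (edgeAt_vert _ h hDE).2.2.1]
    simp
  have hH : ∀ p q, (∀ d', edgeAt (p + 1, q) d' ∉ D) →
      height D o.2 (p + 1) q = height D o.2 p q := by
    intro p q h
    have h3 := height_zig hD hreg (p + 1) q
    rw [if_neg (edgeAt_vert _ h hDE).1, add_sub_cancel_right] at h3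
    rwa [CharTwo.add_eq_zero] at h3
  obtain ⟨p, q⟩ := v
  by_cases hv : IsBlack (p, q) <;> cases d <;> simp only [nbr, hv, if_true, if_false] at h2 ⊢
  · exact hH p q h2
  · exact hZ p q h2
  · have := hZ p (q - 1) (by simpa using h1)
    rw [← this]
    simp
  · have := hH (p - 1) q (by simpa using h1)
    rw [← this]
    simp
  · have := hZ p (q - 1) (by simpa using h1)
    rw [← this]
    simp
  · exact hZ p q h2

end Height

/-- The direction of the `i`-th boundary edge of a face. -/
def faceDir (i : ZMod 6) : Dir :=
  match i with
  | 0 => Dir.H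
  | 1 => Dir.NE
  | 2 => Dir.NW
  | 3 => Dir.H
  | 4 => Dir.NE
  | 5 => Dir.NW

theorem zmod_six_forall {P : ZMod 6 → Prop} (h0 : P 0) (h1 : P 1) (h2 : P 2) (h3 : P 3)
    (h4 : P 4) (h5 : P 5) (i : ZMod 6) : P i := by
  fin_cases i
  exacts [h0, h1, h2, h3, h4, h5]

theorem faceVert_succ {f : Vert} (hf : IsBlack f) (i : ZMod 6) :
    faceVert f (i + 1) = nbr (faceDir i) (faceVert f i) := by
  have h0 : Even (f.1 + f.2) := hf
  rw [Int.even_iff] at h0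
  refine zmod_six_forall (P := fun i => faceVert f (i + 1) = nbr (faceDir i) (faceVert f i))
    ?_ ?_ ?_ ?_ ?_ ?_ i
  · rw [show (0 + 1 : ZMod 6) = 1 by decide]
    simp only [faceVert, faceDir, nbr, IsBlack, Int.even_iff]
    split_ifs
    rfl
  · rw [show (1 + 1 : ZMod 6) = 2 by decide]
    simp only [faceVert, faceDir, nbr, IsBlack, Int.even_iff]
    split_ifs <;> refine Prod.ext ?_ ?_ <;> dsimp only <;> omega
  · rw [show (2 + 1 : ZMod 6) = 3 by decide]
    simp only [faceVert, faceDir, nbr, IsBlack, Int.even_iff]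
    split_ifs <;> refine Prod.ext ?_ ?_ <;> dsimp only <;> omega
  · rw [show (3 + 1 : ZMod 6) = 4 by decide]
    simp only [faceVert, faceDir, nbr, IsBlack, Int.even_iff]
    split_ifs <;> refine Prod.ext ?_ ?_ <;> dsimp only <;> omega
  · rw [show (4 + 1 : ZMod 6) = 5 by decide]
    simp only [faceVert, faceDir, nbr, IsBlack, Int.even_iff]
    split_ifs <;> refine Prod.ext ?_ ?_ <;> dsimp only <;> omega
  · rw [show (5 + 1 : ZMod 6) = 0 by decide]
    simp only [faceVert, faceDir, nbr, IsBlack, Int.even_iff]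
    split_ifs <;> refine Prod.ext ?_ ?_ <;> dsimp only <;> omega

theorem faceEdge_eq {f : Vert} (hf : IsBlack f) (i : ZMod 6) :
    faceEdge f i = edgeAt (faceVert f i) (faceDir i) := by
  rw [faceEdge, faceVert_succ hf, edgeAt]

theorem faceEdge_pred_eq {f : Vert} (hf : IsBlack f) (i : ZMod 6) :
    faceEdge f (i - 1) = edgeAt (faceVert f i) (faceDir (i - 1)) := by
  rw [faceEdge_eq hf, ← edgeAt_nbr, ← faceVert_succ hf, sub_add_cancel]

theorem faceDir_facts (i : ZMod 6) :
    faceDir i ≠ outDir i ∧ faceDir (i - 1) ≠ outDir i ∧ faceDir i ≠ faceDir (i - 1) := by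
  fin_cases i <;> simp only [faceDir, outDir] <;> decide

theorem height_faceVert {o : Vert} {k n : ℕ} {D : Set (Sym2 Vert)}
    (hD : D ⊆ ↑(edges (box o k n)))
    (hreg : ∀ v, (∀ d, edgeAt v d ∉ D) ∨ ∃ d, edgeAt v d ∉ D ∧ ∀ d', d' ≠ d → edgeAt v d' ∈ D)
    {f : Vert} (hf : IsBlack f) (hh : height D o.2 f.1 f.2 = 1) (i : ZMod 6)
    (hi : ∀ d, edgeAt (faceVert f i) d ∉ D) :
    height D o.2 (faceVert f i).1 (faceVert f i).2 = 1 := by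
  classical
  have hDE : D ⊆ hexLattice.edgeSet := fun e he => (Finset.mem_filter.1 (hD he)).2
  obtain ⟨e1, e2, e3, e4⟩ := edgeAt_vert _ hi hDE
  have h5 : height D o.2 f.1 (f.2 + 1) = 1 := by
    rw [height_succ hD, if_neg, add_sub_cancel_right, hh, add_zero]
    intro h
    have h1 := (hor_mem_box hD h).1
    simp only [IsBlack, Int.even_iff] at hf h1
    omega
  fin_cases i
  · exact hh
  · have := height_zig hD hreg (f.1 + 1) f.2
    simp only [faceVert] at e1 ⊢
    rw [if_neg e1, add_sub_cancel_right, CharTwo.add_eq_zero, hh] at this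
    exact this
  · have := height_zig hD hreg (f.1 + 1) (f.2 + 1)
    simp only [faceVert] at e1 ⊢
    rw [if_neg e1, add_sub_cancel_right, CharTwo.add_eq_zero, h5] at this
    exact this
  · have := height_zig hD hreg (f.1 + 1) (f.2 + 2)
    simp only [faceVert] at e1 e4 ⊢
    rw [if_neg e1, add_sub_cancel_right, CharTwo.add_eq_zero] at this
    rw [add_sub_cancel_right] at e4
    rw [this, height_succ hD, if_neg e4, add_zero, show f.2 + 2 - 1 = f.2 + 1 by ring]
    exact h5
  · simp only [faceVert] at e3 ⊢
    rw [height_succ hD, if_neg e3, add_zero, show f.2 + 2 - 1 = f.2 + 1 by ring]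
    exact h5
  · exact h5

/-- Inside a 2-regular edge set there is a face with a vertex on this set. -/
theorem exists_inner_face {o : Vert} {k n : ℕ} {D : Set (Sym2 Vert)}
    (hD : D ⊆ ↑(edges (box o k n)))
    (hreg : ∀ v, (∀ d, edgeAt v d ∉ D) ∨ ∃ d, edgeAt v d ∉ D ∧ ∀ d', d' ≠ d → edgeAt v d' ∈ D)
    (hne : D.Nonempty) :
    ∃ f, IsBlack f ∧ height D o.2 f.1 f.2 = 1 ∧ ∃ i d, edgeAt (faceVert f i) d ∈ D := by
  classical
  have h01 : ∀ a : ZMod 2, a ≠ 0 → a = 1 := by decide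
  have hhor : ∃ p j, hor (p, j) ∈ D := by
    obtain ⟨e, he⟩ := hne
    have hsum : ∀ p q, height D o.2 p q ≠ 0 → ∃ p j, hor (p, j) ∈ D := by
      intro p q h
      unfold height at h
      obtain ⟨j, -, hj⟩ := Finset.exists_ne_zero_of_sum_ne_zero h
      refine ⟨p, j, ?_⟩
      by_contra hn
      simp [hn] at hj
    have hzig : ∀ v : Vert, zig v ∈ D → ∃ p j, hor (p, j) ∈ D := by
      intro v hv
      have h1 := height_zig hD hreg v.1 v.2
      rw [if_pos hv] at h1
      by_cases h2 : height D o.2 v.1 v.2 = 0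
      · refine hsum (v.1 - 1) v.2 fun h3 => ?_
        rw [h2, h3] at h1
        simp at h1
      · exact hsum _ _ h2
    obtain ⟨v, d, rfl⟩ := mem_edgeSet.1 (Finset.mem_filter.1 (hD he)).2
    cases d
    · rw [edgeAt_H] at he
      split_ifs at he
      · exact ⟨_, _, he⟩
      · exact ⟨_, _, he⟩
    · rw [edgeAt_NW] at he
      split_ifs at he <;> exact hzig _ he
    · rw [edgeAt_NE] at he
      split_ifs at he <;> exact hzig _ he
  obtain ⟨p, j, hj⟩ := hhor
  obtain ⟨hb, -⟩ := hor_mem_box hD hj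
  have h1 := height_succ hD p j
  rw [if_pos hj] at h1
  have hedge : edgeAt (p, j) Dir.H ∈ D := by
    rw [edgeAt_H, if_pos hb]
    exact hj
  -- The heights on the two sides of a horizontal edge of `D` differ, so one of the two faces has
  -- height 1. The face on the left has corner `(p, j - 2)`, and `(p, j)` is its vertex number 4.
  by_cases h2 : height D o.2 p j = 0
  · have h3 : height D o.2 p (j - 1) = 1 := by
      apply h01
      intro h3
      rw [h2, h3] at h1
      simp at h1
    have h4 := height_succ hD p (j - 1)
    rw [if_neg, add_zero, h3] at h4
    · refine ⟨(p, j - 2), ?_, ?_, 4, Dir.H, ?_⟩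
      · simp only [IsBlack, Int.even_iff] at hb ⊢
        omega
      · rw [h4]
        congr 1
        ring
      · simpa [faceVert] using hedge
    · intro h5
      have h6 := (hor_mem_box hD h5).1
      simp only [IsBlack, Int.even_iff] at hb h6
      omega
  · exact ⟨(p, j), hb, h01 _ h2, 0, Dir.H, by simpa [faceVert] using hedge⟩

end OneTwo

namespace OneTwo

/-! ### Irreducibility on a box -/

/-- Two edges of the difference at a vertex of degree 2 have different states. -/
theorem diff_states {ω ω' : Set (Sym2 Vert)} {v : Vert} (h : ∃ d, OddAt ω v d)
    (h' : ∃ d, OddAt ω' v d) {t : Dir} (ht : edgeAt v t ∉ symmDiff ω ω')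
    (hd : ∀ d, d ≠ t → edgeAt v d ∈ symmDiff ω ω') {d d' : Dir} (h1 : d ≠ t) (h2 : d' ≠ t)
    (h3 : d' ≠ d) : edgeAt v d ∈ ω ↔ edgeAt v d' ∉ ω := by
  rw [exists_oddAt_iff] at h h'
  have e1 := hd d h1
  have e2 := hd d' h2
  rw [mem_symmDiff_iff] at ht e1 e2
  have hall : ∀ x : Dir, x = d ∨ x = d' ∨ x = t := by
    intro x
    cases x <;> cases d <;> cases d' <;> cases t <;> simp_all
  obtain ⟨⟨a, ha⟩, b, hb⟩ := h
  obtain ⟨⟨a', ha'⟩, b', hb'⟩ := h'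
  rcases hall a with rfl | rfl | rfl <;> rcases hall b with rfl | rfl | rfl <;>
    rcases hall a' with rfl | rfl | rfl <;> rcases hall b' with rfl | rfl | rfl <;> tauto

/-- The two difference edges at `v` have opposite states, so the third edge agrees with exactly one
of them, and the other one is odd. -/
theorem oddAt_iff_third {ω ω' : Set (Sym2 Vert)} {v : Vert} (h : ∃ d, OddAt ω v d)
    (h' : ∃ d, OddAt ω' v d) {t : Dir} (ht : edgeAt v t ∉ symmDiff ω ω')
    (hd : ∀ d, d ≠ t → edgeAt v d ∈ symmDiff ω ω') {d : Dir} (h1 : d ≠ t) :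
    OddAt ω v d ↔ (edgeAt v t ∈ ω ↔ edgeAt v d ∉ ω) := by
  have h2 := diff_states h h' ht hd h1 (third_ne_left h1) (third_ne_right h1)
  constructor
  · intro h3
    exact h3 t (Ne.symm h1)
  · intro h3 d' hd'
    by_cases h4 : d' = t
    · rwa [h4]
    · rw [eq_third h1 h4 hd']
      tauto

theorem not_oddAt_third {ω ω' : Set (Sym2 Vert)} {v : Vert} (h : ∃ d, OddAt ω v d)
    (h' : ∃ d, OddAt ω' v d) {t : Dir} (ht : edgeAt v t ∉ symmDiff ω ω')
    (hd : ∀ d, d ≠ t → edgeAt v d ∈ symmDiff ω ω') : ¬ OddAt ω v t := by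
  intro h1
  obtain ⟨d, hdt⟩ : ∃ d, d ≠ t := by cases t <;> simp [Dir.exists_iff]
  have h2 := diff_states h h' ht hd hdt (third_ne_left hdt) (third_ne_right hdt)
  have h3 := h1 d hdt
  have h4 := h1 (third t d) (third_ne_left hdt)
  tauto

/-- In a locked difference the third edges alternate. -/
theorem third_states_ne {Λ : Finset Vert} {bd ω ω' : Set (Sym2 Vert)} (h : Compat Λ bd ω)
    (h' : Compat Λ bd ω')
    (hno : ∀ v d, edgeAt v d ∈ symmDiff ω ω' → OddAt ω v d ∨ OddAt ω (nbr d v) d)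
    {x : Vert} {d t s : Dir} (hd : edgeAt x d ∈ symmDiff ω ω') (ht : edgeAt x t ∉ symmDiff ω ω')
    (hs : edgeAt (nbr d x) s ∉ symmDiff ω ω') :
    edgeAt x t ∈ ω ↔ edgeAt (nbr d x) s ∉ ω := by
  obtain ⟨hone, hreg⟩ := locked_structure h h' hno
  have hfull : ∀ v r d, edgeAt v d ∈ symmDiff ω ω' → edgeAt v r ∉ symmDiff ω ω' →
      d ≠ r ∧ ∀ d', d' ≠ r → edgeAt v d' ∈ symmDiff ω ω' := by
    intro v r d hd hr
    rcases hreg v with h1 | ⟨t, ht, ht'⟩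
    · exact absurd hd (h1 d)
    · have : r = t := by
        by_contra hne
        exact hr (ht' r hne)
      subst this
      exact ⟨fun h => hr (h ▸ hd), ht'⟩
  have hd2 : edgeAt (nbr d x) d ∈ symmDiff ω ω' := by rwa [edgeAt_nbr]
  obtain ⟨h1, h2⟩ := hfull x t d hd ht
  obtain ⟨h3, h4⟩ := hfull (nbr d x) s d hd2 hs
  have o1 := oddAt_iff_third (h.1.exists_oddAt x) (h'.1.exists_oddAt x) ht h2 h1
  have o2 := oddAt_iff_third (h.1.exists_oddAt _) (h'.1.exists_oddAt _) hs h4 h3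
  -- The edge is odd at exactly one end, so its state differs from the third edge at exactly one
  -- end; hence the two third edges differ from each other.
  have h5 := hno x d hd
  have h6 := hone x d hd
  rw [o1, o2, edgeAt_nbr] at h5 h6
  tauto

section Connect

variable {o : Vert} {k n : ℕ} {bd : Set (Sym2 Vert)}

theorem edges_subset {Λ : Finset Vert} : (edges Λ : Set (Sym2 Vert)) ⊆ hexLattice.edgeSet := by
  classical
  intro e he
  exact (Finset.mem_filter.1 he).2

theorem finite_of_subset_edges {Λ : Finset Vert} {D : Set (Sym2 Vert)} (h : D ⊆ ↑(edges Λ)) :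
    D.Finite := (edges Λ).finite_toSet.subset h

/-- If `D'` contains at each vertex none or all of the difference edges, then `ω` changed along `D'`
looks at each vertex like `ω` or like `ω'`. It is an admissible intermediate configuration, strictly
closer to both. -/
theorem connected_of_split {Λ : Finset Vert} {ω ω' : Set (Sym2 Vert)} (h : Compat Λ bd ω)
    (h' : Compat Λ bd ω')
    (ih : ∀ η η', Compat Λ bd η → Compat Λ bd η' →
      (symmDiff η η').ncard < (symmDiff ω ω').ncard → Reach Λ bd η η')
    {D' : Set (Sym2 Vert)} (hsub : D' ⊆ symmDiff ω ω') (hne : D'.Nonempty)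
    (hne' : D' ≠ symmDiff ω ω')
    (hstar : ∀ v, (∀ d, edgeAt v d ∉ D') ∨
      ∀ d, edgeAt v d ∈ symmDiff ω ω' → edgeAt v d ∈ D') : Reach Λ bd ω ω' := by
  have hfin := finite_of_subset_edges (h.subset_edges h')
  have hc : Compat Λ bd (symmDiff ω D') := by
    refine h.of_sameAt h' ?_ fun v => ?_
    · intro e he
      rw [mem_symmDiff_iff] at he
      by_cases h1 : e ∈ ω
      · exact h.1.1 h1
      · exact (edges_subset (h.subset_edges h' (hsub (by tauto))))
    · rcases hstar v with h1 | h1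
      · left
        intro d
        have := h1 d
        rw [mem_symmDiff_iff]
        tauto
      · right
        intro d
        have h2 := h1 d
        have h3 := @hsub (edgeAt v d)
        rw [mem_symmDiff_iff] at *
        tauto
  have e1 : symmDiff ω (symmDiff ω D') = D' := symmDiff_symmDiff_cancel_left _ _
  have e2 : symmDiff (symmDiff ω D') ω' = symmDiff ω ω' \ D' := by
    ext e
    have h3 := @hsub e
    rw [Set.mem_sdiff, mem_symmDiff_iff, mem_symmDiff_iff, mem_symmDiff_iff] at *
    tauto
  refine (ih ω _ h hc ?_).trans (ih _ ω' hc h' ?_)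
  · rw [e1]
    exact Set.ncard_lt_ncard (hsub.ssubset_of_ne hne') hfin
  · rw [e2]
    refine Set.ncard_lt_ncard ⟨Set.sdiff_subset, fun h1 => ?_⟩ hfin
    obtain ⟨e, he⟩ := hne
    exact (h1 (hsub he)).2 he

theorem connected_of_flip {Λ : Finset Vert} {ω ω' : Set (Sym2 Vert)} (h : Compat Λ bd ω)
    (h' : Compat Λ bd ω') {m : ℕ} (hm : (symmDiff ω ω').ncard ≤ m)
    (ih : ∀ η η', Compat Λ bd η → Compat Λ bd η' → (symmDiff η η').ncard < m → Reach Λ bd η η')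
    {v : Vert} {d : Dir} (he : edgeAt v d ∈ symmDiff ω ω') (h1 : ¬ OddAt ω v d)
    (h2 : ¬ OddAt ω (nbr d v) d) : Reach Λ bd ω ω' := by
  have hst := flip_step h (h.subset_edges h' he) h1 h2
  refine Relation.ReflTransGen.head hst (ih _ _ hst.2.1 h' (lt_of_lt_of_le ?_ hm))
  have e2 : symmDiff (symmDiff ω {edgeAt v d}) ω' = symmDiff ω ω' \ {edgeAt v d} := by
    ext e
    by_cases h3 : e = edgeAt v d
    · subst h3
      simp only [Set.mem_sdiff, mem_symmDiff_iff, Set.mem_singleton_iff] at *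
      tauto
    · simp only [Set.mem_sdiff, mem_symmDiff_iff, Set.mem_singleton_iff] at *
      tauto
  rw [e2]
  exact Set.ncard_sdiff_singleton_lt_of_mem he (finite_of_subset_edges (h.subset_edges h'))

/-- A locked difference is unlocked by a push from one of its vertices. -/
theorem connected_of_push {Λ : Finset Vert} {ω ω' : Set (Sym2 Vert)} (h : Compat Λ bd ω)
    (h' : Compat Λ bd ω')
    (hno : ∀ v d, edgeAt v d ∈ symmDiff ω ω' → OddAt ω v d ∨ OddAt ω (nbr d v) d)
    (ih : ∀ η η', Compat Λ bd η → Compat Λ bd η' →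
      (symmDiff η η').ncard < (symmDiff ω ω').ncard → Reach Λ bd η η')
    (τ : Prop) (U : Finset Vert) (hUΛ : ∀ u ∈ U, u ∈ Λ ∧ ∀ d, nbr d u ∈ Λ)
    (hb : ∀ x ∉ U, ∀ d, nbr d x ∈ U → (edgeAt x d ∈ ω ↔ (IsBlack x ↔ τ)))
    (hU : ∀ u ∈ U, ∀ d, edgeAt u d ∉ symmDiff ω ω')
    {x : Vert} {d₀ t : Dir} (hx : edgeAt x d₀ ∈ symmDiff ω ω') (ht : nbr t x ∈ U) :
    Reach Λ bd ω ω' := by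
  obtain ⟨hone, hreg⟩ := locked_structure h h' hno
  have hxU : x ∉ U := fun h1 => hU x h1 d₀ hx
  have hfull : ∀ v d, edgeAt v d ∈ symmDiff ω ω' → ∃ r, edgeAt v r ∉ symmDiff ω ω' ∧
      ∀ d', d' ≠ r → edgeAt v d' ∈ symmDiff ω ω' := by
    intro v d hd
    rcases hreg v with h1 | h1
    · exact absurd hd (h1 d)
    · exact h1
  have htD : edgeAt x t ∉ symmDiff ω ω' := by
    rw [← edgeAt_nbr]
    exact hU _ ht t
  have hxfull : ∀ d', d' ≠ t → edgeAt x d' ∈ symmDiff ω ω' := by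
    obtain ⟨r, hr, hr'⟩ := hfull x d₀ hx
    have : t = r := by
      by_contra hne
      exact htD (hr' t hne)
    rwa [this]
  obtain ⟨F, hF1, hF2⟩ := push Λ bd τ U.card U rfl ω hUΛ hb x hxU t ht
  have hsw := symmDiff_comm ω ω'
  obtain ⟨c1, r1⟩ := hF2 ω h (fun _ _ => SameAt.refl _ _)
    (not_oddAt_third (h.1.exists_oddAt x) (h'.1.exists_oddAt x) htD hxfull)
  -- `ω'` agrees with `ω` on `U`, so the same edge set `F` can be pushed in both and their
  -- difference is unchanged.
  obtain ⟨c2, r2⟩ := hF2 ω' h' (fun u hu d => by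
      have := hU u hu d
      rw [mem_symmDiff_iff] at this
      tauto)
    (not_oddAt_third (h'.1.exists_oddAt x) (h.1.exists_oddAt x) (hsw ▸ htD) (hsw ▸ hxfull))
  refine r1.trans (Reach.trans ?_ r2.symm)
  have hD : symmDiff (symmDiff ω F) (symmDiff ω' F) = symmDiff ω ω' := by
    ext e
    simp only [mem_symmDiff_iff]
    tauto
  by_cases hlock : ∀ v d, edgeAt v d ∈ symmDiff (symmDiff ω F) (symmDiff ω' F) →
      OddAt (symmDiff ω F) v d ∨ OddAt (symmDiff ω F) (nbr d v) d
  -- The push flips the third edge at `x` but not the one at the neighbour along `D`. The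
  -- alternation of third edges cannot hold both before and after it.
  · exfalso
    have hyD : edgeAt (nbr d₀ x) d₀ ∈ symmDiff ω ω' := by rwa [edgeAt_nbr]
    obtain ⟨s, hs, hs'⟩ := hfull _ _ hyD
    have g1 := third_states_ne h h' hno hx htD hs
    have g2 := third_states_ne c1 c2 hlock (hD ▸ hx) (hD ▸ htD) (hD ▸ hs)
    have hyU : nbr d₀ x ∉ U := fun h1 => hU _ h1 d₀ hyD
    have hsF : edgeAt (nbr d₀ x) s ∉ F := by
      rw [hF1 _ hyU]
      intro h1
      obtain ⟨-, h2 | h2⟩ := edgeAt_eq_iff.1 h1.symm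
      · exact nbr_ne _ _ h2
      · exact hyU (h2 ▸ ht)
    have htF : edgeAt x t ∈ F := by rw [hF1 x hxU]
    simp only [mem_symmDiff_iff] at g2
    tauto
  · push Not at hlock
    obtain ⟨v, d, hv, h1, h2⟩ := hlock
    exact connected_of_flip c1 c2 (m := (symmDiff ω ω').ncard) (by rw [hD]) ih hv h1 h2

/-- Both alternations required of a face move are properties of a locked difference: along `D` for
the boundary edges, across it for the third edges, which here are the incident edges of the face. -/
theorem faceFlip_of_locked {Λ : Finset Vert} {ω ω' : Set (Sym2 Vert)} (h : Compat Λ bd ω)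
    (h' : Compat Λ bd ω')
    (hno : ∀ v d, edgeAt v d ∈ symmDiff ω ω' → OddAt ω v d ∨ OddAt ω (nbr d v) d)
    {f : Vert} (hf : IsBlack f) (hD : symmDiff ω ω' = Set.range (faceEdge f)) :
    FaceFlip ω ω' := by
  obtain ⟨hone, hreg⟩ := locked_structure h h' hno
  have hmem : ∀ i, edgeAt (faceVert f i) (faceDir i) ∈ symmDiff ω ω' := fun i => by
    rw [hD, ← faceEdge_eq hf]
    exact ⟨i, rfl⟩
  have hmem' : ∀ i, edgeAt (faceVert f i) (faceDir (i - 1)) ∈ symmDiff ω ω' := fun i => by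
    rw [hD, ← faceEdge_pred_eq hf]
    exact ⟨_, rfl⟩
  have hout : ∀ i, edgeAt (faceVert f i) (outDir i) ∉ symmDiff ω ω' ∧
      ∀ d, d ≠ outDir i → edgeAt (faceVert f i) d ∈ symmDiff ω ω' := by
    intro i
    rcases hreg (faceVert f i) with h1 | ⟨t, ht, ht'⟩
    · exact absurd (hmem i) (h1 _)
    · obtain ⟨a1, a2, a3⟩ := faceDir_facts i
      have b1 : faceDir i ≠ t := fun h1 => ht (h1 ▸ hmem i)
      have b2 : faceDir (i - 1) ≠ t := fun h1 => ht (h1 ▸ hmem' i)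
      have : t = outDir i := by
        rw [eq_third a3 (Ne.symm b2) (Ne.symm b1), eq_third a3 (Ne.symm a2) (Ne.symm a1)]
      subst this
      exact ⟨ht, ht'⟩
  have halt : ∀ i, faceEdge f i ∈ ω ↔ faceEdge f (i + 1) ∉ ω := by
    intro i
    obtain ⟨a1, a2, a3⟩ := faceDir_facts (i + 1)
    have := diff_states (h.1.exists_oddAt _) (h'.1.exists_oddAt _) (hout (i + 1)).1
      (hout (i + 1)).2 a2 a1 a3
    rw [← faceEdge_eq hf, ← faceEdge_pred_eq hf, add_sub_cancel_right] at this
    exact this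
  have houtalt : ∀ i, outEdge f i ∈ ω ↔ outEdge f (i + 1) ∉ ω := by
    intro i
    have h1 := hout (i + 1)
    rw [faceVert_succ hf] at h1
    have := third_states_ne h h' hno (hmem i) (hout i).1 h1.1
    rwa [← faceVert_succ hf] at this
  refine ⟨f, hf, hD, halt, fun i => ?_, houtalt, fun i => ?_⟩
  · have h1 : ∀ j, faceEdge f j ∈ symmDiff ω ω' := fun j => hD ▸ ⟨j, rfl⟩
    have h2 := h1 i
    have h3 := h1 (i + 1)
    have h4 := halt i
    rw [mem_symmDiff_iff] at h2 h3
    tauto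
  · have h2 := (hout i).1
    have h3 := (hout (i + 1)).1
    have h4 := houtalt i
    rw [mem_symmDiff_iff] at h2 h3
    unfold outEdge at *
    tauto

/-- Strong induction on the number of differing edges. Every case either decreases this number,
splits the difference into two smaller ones, or is a single face move. -/
theorem reach_box_aux (m : ℕ) : ∀ ω ω', Compat (box o k n) bd ω → Compat (box o k n) bd ω' →
    (symmDiff ω ω').ncard = m → Reach (box o k n) bd ω ω' := by
  classical
  induction m using Nat.strong_induction_on with
  | _ m ihm =>
    intro ω ω' h h' hcard
    have ih : ∀ η η', Compat (box o k n) bd η → Compat (box o k n) bd η' →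
        (symmDiff η η').ncard < (symmDiff ω ω').ncard → Reach (box o k n) bd η η' :=
      fun η η' c c' hlt => ihm _ (hcard ▸ hlt) η η' c c' rfl
    rcases Set.eq_empty_or_nonempty (symmDiff ω ω') with hemp | hne
    · rw [symmDiff_eq_bot.1 hemp]
      exact Relation.ReflTransGen.refl
    by_cases hno : ∀ v d, edgeAt v d ∈ symmDiff ω ω' → OddAt ω v d ∨ OddAt ω (nbr d v) d
    swap
    · push Not at hno
      obtain ⟨v, d, hv, h1, h2⟩ := hno
      exact connected_of_flip h h' le_rfl ih hv h1 h2
    obtain ⟨hone, hreg⟩ := locked_structure h h' hno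
    set D := symmDiff ω ω' with hDdef
    have hDsub : D ⊆ ↑(edges (box o k n)) := h.subset_edges h'
    have huniq : ∀ v d t r, edgeAt v d ∈ D → edgeAt v t ∉ D → edgeAt v r ∉ D → t = r := by
      intro v d t r hd ht hr
      rcases hreg v with h1 | ⟨s, hs, hs'⟩
      · exact absurd hd (h1 d)
      · rw [show t = s by by_contra hne; exact ht (hs' t hne),
          show r = s by by_contra hne; exact hr (hs' r hne)]
    have hthird : ∀ v d, edgeAt v d ∈ D → ∃ t, edgeAt v t ∉ D := by
      intro v d hd
      rcases hreg v with h1 | ⟨s, hs, hs'⟩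
      · exact absurd hd (h1 d)
      · exact ⟨s, hs⟩
    -- The type of a cycle compares the state of the third edge with the colour of the vertex. Both
    -- alternate along `D`, so the type is constant on each cycle.
    let T : Vert → Prop := fun x => ∃ t, edgeAt x t ∉ D ∧ (edgeAt x t ∈ ω ↔ IsBlack x)
    have hTiff : ∀ x d t, edgeAt x d ∈ D → edgeAt x t ∉ D →
        (T x ↔ (edgeAt x t ∈ ω ↔ IsBlack x)) := by
      intro x d t hd ht
      constructor
      · rintro ⟨r, hr, hr'⟩
        rwa [huniq x d t r hd ht hr]
      · exact fun h1 => ⟨t, ht, h1⟩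
    have hTedge : ∀ x d, edgeAt x d ∈ D → (T x ↔ T (nbr d x)) := by
      intro x d hd
      have hd2 : edgeAt (nbr d x) d ∈ D := by rwa [edgeAt_nbr]
      obtain ⟨t, ht⟩ := hthird x d hd
      obtain ⟨s, hs⟩ := hthird _ d hd2
      rw [hTiff x d t hd ht, hTiff _ d s hd2 hs, isBlack_nbr]
      have := third_states_ne h h' hno hd ht hs
      tauto
    let D' : Set (Sym2 Vert) := {e | ∃ x d, e = edgeAt x d ∧ e ∈ D ∧ T x}
    have hD'iff : ∀ v d, edgeAt v d ∈ D' ↔ edgeAt v d ∈ D ∧ T v := by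
      intro v d
      constructor
      · rintro ⟨x, d', he, hD, hT⟩
        refine ⟨hD, ?_⟩
        obtain ⟨rfl, h1 | h1⟩ := edgeAt_eq_iff.1 he
        · rwa [← h1]
        · rw [h1] at hT
          exact (hTedge v d hD).2 hT
      · exact fun h1 => ⟨v, d, rfl, h1.1, h1.2⟩
    have hD'sub : D' ⊆ D := by
      rintro e ⟨x, d, -, h1, -⟩
      exact h1
    -- Cycles of different types are separated first; afterwards all of them have one type `τ`,
    -- which is the hypothesis on entering edges in `push`.
    by_cases hsplit : D'.Nonempty ∧ D' ≠ D
    · refine connected_of_split h h' ih hD'sub hsplit.1 hsplit.2 fun v => ?_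
      by_cases hT : T v
      · exact Or.inr fun d hd => (hD'iff v d).2 ⟨hd, hT⟩
      · exact Or.inl fun d hd => hT ((hD'iff v d).1 hd).2
    obtain ⟨τ, hτ⟩ : ∃ τ : Prop, ∀ x d, edgeAt x d ∈ D → (T x ↔ τ) := by
      by_cases hn : D'.Nonempty
      · refine ⟨True, fun x d hd => ?_⟩
        have : D' = D := by
          by_contra hne
          exact hsplit ⟨hn, hne⟩
        rw [← this, hD'iff] at hd
        simp [hd.2]
      · refine ⟨False, fun x d hd => ?_⟩
        rw [iff_false]
        intro hT
        exact hn ⟨_, (hD'iff x d).2 ⟨hd, hT⟩⟩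
    have hstate : ∀ x d t, edgeAt x d ∈ D → edgeAt x t ∉ D →
        (edgeAt x t ∈ ω ↔ (IsBlack x ↔ τ)) := by
      intro x d t hd ht
      have h1 := hTiff x d t hd ht
      rw [← hτ x d hd, h1]
      by_cases e1 : edgeAt x t ∈ ω <;> by_cases e2 : IsBlack x <;> simp only [e1, e2, iff_true,
        iff_false, not_true]
    -- `U` consists of the enclosed vertices off `D`. Neighbours off `D` have the same height, so
    -- `U` can be left only through vertices of `D`.
    let U : Finset Vert := (box o k n).filter fun v =>
      height D o.2 v.1 v.2 = 1 ∧ ∀ d, edgeAt v d ∉ D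
    have hU : ∀ v, v ∈ U ↔ height D o.2 v.1 v.2 = 1 ∧ ∀ d, edgeAt v d ∉ D := by
      intro v
      simp only [U, Finset.mem_filter, and_iff_right_iff_imp]
      rintro ⟨h1, -⟩
      exact height_ne_zero hDsub hreg (by rw [h1]; exact one_ne_zero)
    have hnbrU : ∀ u ∈ U, ∀ d, nbr d u ∈ U ∨ ∃ d', edgeAt (nbr d u) d' ∈ D := by
      intro u hu d
      rw [hU] at hu
      by_cases h1 : ∃ d', edgeAt (nbr d u) d' ∈ D
      · exact Or.inr h1
      · push Not at h1
        left
        rw [hU, height_nbr hDsub hreg hu.2 h1]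
        exact ⟨hu.1, h1⟩
    by_cases hadj : ∃ x d₀ t, edgeAt x d₀ ∈ D ∧ nbr t x ∈ U
    · obtain ⟨x, d₀, t, hx, ht⟩ := hadj
      refine connected_of_push h h' hno ih τ U ?_ ?_ (fun u hu => ((hU u).1 hu).2) hx ht
      · intro u hu
        refine ⟨(Finset.mem_filter.1 hu).1, fun d => ?_⟩
        rcases hnbrU u hu d with h1 | ⟨d', h1⟩
        · exact (Finset.mem_filter.1 h1).1
        · exact (edgeAt_mem_edges.1 (hDsub h1)).1
      · intro y hy d hd
        have hyd : edgeAt y d ∉ D := by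
          rw [← edgeAt_nbr]
          exact ((hU _).1 hd).2 d
        have h1 := hnbrU _ hd d
        rw [nbr_nbr] at h1
        rcases h1 with h1 | ⟨d', h1⟩
        · exact absurd h1 hy
        · exact hstate y d' d h1 hyd
    · push Not at hadj
      obtain ⟨f, hf, hh, i₀, d₀, hi₀⟩ := exists_inner_face hDsub hreg hne
      -- Suppose the next boundary edge of the face is not in `D`. If its far end is on `D`, it is
      -- the third edge of two vertices of opposite colours, against the common type; otherwise its
      -- far end lies in `U`, which has been excluded.
      have hstep : ∀ i, (∃ d, edgeAt (faceVert f i) d ∈ D) → faceEdge f i ∈ D := by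
        rintro i ⟨d, hd⟩
        by_contra hn
        rw [faceEdge_eq hf] at hn
        by_cases hV : ∃ d, edgeAt (faceVert f (i + 1)) d ∈ D
        · obtain ⟨d', hd'⟩ := hV
          have h1 := hstate _ _ _ hd hn
          rw [faceVert_succ hf] at hd'
          have h2 := hstate _ _ (faceDir i) hd' (by rwa [edgeAt_nbr])
          rw [edgeAt_nbr, isBlack_nbr] at h2
          tauto
        · push Not at hV
          refine hadj (faceVert f i) d (faceDir i) hd ?_
          rw [← faceVert_succ hf, hU]
          exact ⟨height_faceVert hDsub hreg hf hh (i + 1) hV, hV⟩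
      have hall' : ∀ j : ℕ, ∃ d, edgeAt (faceVert f (i₀ + j)) d ∈ D := by
        intro j
        induction j with
        | zero => exact ⟨d₀, by simpa using hi₀⟩
        | succ j ihj =>
          have h1 := hstep _ ihj
          rw [faceEdge_eq hf, ← edgeAt_nbr, ← faceVert_succ hf] at h1
          push_cast
          rw [← add_assoc]
          exact ⟨_, h1⟩
      have hall : ∀ i, faceEdge f i ∈ D := by
        intro i
        apply hstep
        have := hall' (i - i₀).val
        rwa [ZMod.natCast_zmod_val, add_sub_cancel] at this
      by_cases hDf : Set.range (faceEdge f) = D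
      · exact Relation.ReflTransGen.single
          ⟨h, h', Or.inr (faceFlip_of_locked h h' hno hf hDf.symm)⟩
      · refine connected_of_split h h' ih (D' := Set.range (faceEdge f)) ?_ ⟨_, 0, rfl⟩ hDf ?_
        · rintro e ⟨i, rfl⟩
          exact hall i
        · intro v
          by_cases hv : ∃ i, v = faceVert f i
          · right
            obtain ⟨i, rfl⟩ := hv
            intro d hd
            obtain ⟨a1, a2, a3⟩ := faceDir_facts i
            have m1 := hall i
            have m2 := hall (i - 1)
            rw [faceEdge_eq hf] at m1
            rw [faceEdge_pred_eq hf] at m2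
            by_cases e1 : d = faceDir i
            · rw [e1, ← faceEdge_eq hf]
              exact ⟨_, rfl⟩
            by_cases e2 : d = faceDir (i - 1)
            · rw [e2, ← faceEdge_pred_eq hf]
              exact ⟨_, rfl⟩
            exfalso
            obtain ⟨t, ht⟩ := hthird _ _ hd
            have b1 : t ≠ faceDir i := fun h1 => ht (h1 ▸ m1)
            have b2 : t ≠ faceDir (i - 1) := fun h1 => ht (h1 ▸ m2)
            rw [eq_third a3 b2 b1, ← eq_third a3 e2 e1] at ht
            exact ht hd
          · left
            rintro d ⟨i, hi⟩
            rw [faceEdge_eq hf] at hi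
            obtain ⟨-, h1 | h1⟩ := edgeAt_eq_iff.1 hi
            · exact hv ⟨i, h1⟩
            · rw [← faceVert_succ hf] at h1
              exact hv ⟨_, h1⟩

/-- Any two configurations of a box with the same boundary condition are connected by moves. -/
theorem reach_box {ω ω' : Set (Sym2 Vert)} (h : Compat (box o k n) bd ω)
    (h' : Compat (box o k n) bd ω') : Reach (box o k n) bd ω ω' :=
  reach_box_aux _ ω ω' h h' rfl

end Connect

end OneTwo

namespace OneTwo

/-! ### Classification of moves, detailed balance and laziness -/

section Moves

variable {ω₁ ω₂ : Set (Sym2 Vert)}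

theorem mem_of_symmDiff_singleton {v u : Vert} {d x : Dir}
    (hs : symmDiff ω₁ ω₂ = {edgeAt v d}) :
    (edgeAt u x ∈ ω₁ ↔ edgeAt u x ∈ ω₂) ↔ edgeAt u x ≠ edgeAt v d := by
  have h : edgeAt u x ∈ symmDiff ω₁ ω₂ ↔ edgeAt u x = edgeAt v d := by rw [hs]; rfl
  rw [mem_symmDiff_iff] at h
  tauto

/-- At an endpoint of a flipped edge exactly one of the two other edges is present. -/
theorem exists_present (h₁ : ∃ d, OddAt ω₁ v d) (h₂ : ∃ d, OddAt ω₂ v d) {d : Dir}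
    (hs : symmDiff ω₁ ω₂ = {edgeAt v d}) :
    ∃ x, x ≠ d ∧ edgeAt v x ∈ ω₁ ∧ edgeAt v x ∈ ω₂ ∧ edgeAt v (third d x) ∉ ω₁ ∧
      edgeAt v (third d x) ∉ ω₂ := by
  rw [exists_oddAt_iff] at h₁ h₂
  have e : ∀ x, (edgeAt v x ∈ ω₁ ↔ edgeAt v x ∈ ω₂) ↔ x ≠ d := fun x => by
    rw [mem_of_symmDiff_singleton hs, Ne, edgeAt_inj]
  have e1 := e Dir.H
  have e2 := e Dir.NW
  have e3 := e Dir.NE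
  simp only [Dir.exists_iff] at *
  by_cases m1 : edgeAt v Dir.H ∈ ω₂ <;> by_cases m2 : edgeAt v Dir.NW ∈ ω₂ <;>
    by_cases m3 : edgeAt v Dir.NE ∈ ω₂ <;> cases d <;> simp_all [third]

theorem DiffEdge.symm {v : Vert} {d x y : Dir} (h : DiffEdge ω₁ ω₂ v d x y) :
    DiffEdge ω₂ ω₁ v d x y := by
  obtain ⟨h1, h2, h3, h4, h5, h6, h7⟩ := h
  exact ⟨by rwa [symmDiff_comm], h2, h3, h5, h4, h7, h6⟩

theorem DiffEdge.swap {v : Vert} {d x y : Dir} (h : DiffEdge ω₁ ω₂ v d x y) :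
    DiffEdge ω₁ ω₂ (nbr d v) d y x := by
  obtain ⟨h1, h2, h3, h4, h5, h6, h7⟩ := h
  refine ⟨by rw [edgeAt_nbr, h1], h3, h2, h6, h7, ?_, ?_⟩ <;> rwa [nbr_nbr]

theorem exists_diffEdge (h₁ : IsConfig ω₁) (h₂ : IsConfig ω₂) {v : Vert} {d : Dir}
    (hs : symmDiff ω₁ ω₂ = {edgeAt v d}) : ∃ x y, DiffEdge ω₁ ω₂ v d x y := by
  obtain ⟨x, a1, a2, a3, -⟩ := exists_present (h₁.exists_oddAt v) (h₂.exists_oddAt v) hs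
  obtain ⟨y, b1, b2, b3, -⟩ := exists_present (h₁.exists_oddAt (nbr d v))
    (h₂.exists_oddAt (nbr d v)) (by rw [edgeAt_nbr]; exact hs)
  exact ⟨x, y, hs, a1, b1, a2, a3, b2, b3⟩

theorem DiffEdge.absent (h₁ : IsConfig ω₁) (h₂ : IsConfig ω₂) {v : Vert} {d x y : Dir}
    (h : DiffEdge ω₁ ω₂ v d x y) :
    edgeAt v (third d x) ∉ ω₁ ∧ edgeAt v (third d x) ∉ ω₂ := by
  obtain ⟨x', a1, a2, a3, a4, a5⟩ := exists_present (h₁.exists_oddAt v) (h₂.exists_oddAt v) h.1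
  obtain ⟨-, h2, -, h4, -⟩ := h
  have : x = x' := by
    by_contra hne
    rw [eq_third a1 h2 hne] at h4
    exact a4 h4
  subst this
  exact ⟨a4, a5⟩

theorem DiffEdge.unique_left (h₁ : IsConfig ω₁) (h₂ : IsConfig ω₂) {v : Vert}
    {d x y x' y' : Dir} (h : DiffEdge ω₁ ω₂ v d x y) (h' : DiffEdge ω₁ ω₂ v d x' y') :
    x' = x := by
  by_contra hne
  have := eq_third h.2.1 h'.2.1 hne
  exact (h.absent h₁ h₂).1 (this ▸ h'.2.2.2.1)

theorem DiffEdge.unique (h₁ : IsConfig ω₁) (h₂ : IsConfig ω₂) {v v' : Vert}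
    {d d' x y x' y' : Dir} (h : DiffEdge ω₁ ω₂ v d x y) (h' : DiffEdge ω₁ ω₂ v' d' x' y') :
    d' = d ∧ ((x' = x ∧ y' = y) ∨ (x' = y ∧ y' = x)) := by
  have he : edgeAt v d = edgeAt v' d' := by
    have := h.1.symm.trans h'.1
    simpa using this
  obtain ⟨rfl, rfl | rfl⟩ := edgeAt_eq_iff.1 he
  · exact ⟨rfl, Or.inl ⟨h.unique_left h₁ h₂ h', h.swap.unique_left h₁ h₂ h'.swap⟩⟩
  · refine ⟨rfl, Or.inr ⟨h.swap.unique_left h₁ h₂ h', ?_⟩⟩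
    have := h'.swap
    rw [nbr_nbr] at this
    exact h.unique_left h₁ h₂ this

theorem DiffEdge.oddAt (h₁ : IsConfig ω₁) (h₂ : IsConfig ω₂) {v : Vert} {d x y : Dir}
    (h : DiffEdge ω₁ ω₂ v d x y) (he : edgeAt v d ∈ ω₁) :
    OddAt ω₁ v (third d x) ∧ OddAt ω₂ v x := by
  obtain ⟨n1, n2⟩ := h.absent h₁ h₂
  have he2 : edgeAt v d ∉ ω₂ := by
    have := mem_of_symmDiff_singleton (u := v) (x := d) h.1
    tauto
  obtain ⟨-, hx, -, h4, h5, -⟩ := h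
  have hall : ∀ z, z = d ∨ z = x ∨ z = third d x := by
    intro z
    by_cases z1 : z = d
    · exact Or.inl z1
    by_cases z2 : z = x
    · exact Or.inr (Or.inl z2)
    exact Or.inr (Or.inr (eq_third hx z1 z2))
  constructor
  · intro z hz
    rcases hall z with rfl | rfl | rfl
    · tauto
    · tauto
    · exact absurd rfl hz
  · intro z hz
    rcases hall z with rfl | rfl | rfl
    · tauto
    · exact absurd rfl hz
    · tauto

theorem faceEdge_ne {f : Vert} (hf : IsBlack f) (i : ZMod 6) :
    faceEdge f i ≠ faceEdge f (i - 1) := by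
  rw [faceEdge_eq hf, faceEdge_pred_eq hf, Ne, edgeAt_inj]
  exact (faceDir_facts i).2.2

theorem FaceFlip.not_singleton (h : FaceFlip ω₁ ω₂) (e : Sym2 Vert) : symmDiff ω₁ ω₂ ≠ {e} := by
  obtain ⟨f, hf, h1, -⟩ := h
  intro h2
  rw [h1] at h2
  have h3 : ∀ i, faceEdge f i = e := fun i => by
    have : faceEdge f i ∈ ({e} : Set _) := h2 ▸ ⟨i, rfl⟩
    exact this
  exact faceEdge_ne hf 0 ((h3 _).trans (h3 _).symm)

/-- The directions and the sense of a parallel flip are determined by the two configurations, so at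
most one branch in the definition of `rate` applies. -/
theorem removes_iff (h₁ : IsConfig ω₁) (h₂ : IsConfig ω₂) {d x : Dir} (h : Removes ω₁ ω₂ d x) :
    x ≠ d ∧ ¬ FaceFlip ω₁ ω₂ ∧ ¬ FaceFlip ω₂ ω₁ ∧ ¬ NonParallel ω₁ ω₂ ∧ ¬ NonParallel ω₂ ω₁ ∧
      (∀ d' x', Removes ω₁ ω₂ d' x' ↔ d' = d ∧ x' = x) ∧ ∀ d' x', ¬ Removes ω₂ ω₁ d' x' := by
  have hh := h
  obtain ⟨v, hd, he1, he2⟩ := h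
  refine ⟨hd.2.1, fun hf => hf.not_singleton _ hd.1, fun hf => hf.symm.not_singleton _ hd.1,
    ?_, ?_, ?_, ?_⟩
  · rintro ⟨v', d', x', y', h', hne⟩
    rcases (hd.unique h₁ h₂ h').2 with ⟨rfl, rfl⟩ | ⟨rfl, rfl⟩ <;> exact hne rfl
  · rintro ⟨v', d', x', y', h', hne⟩
    rcases (hd.unique h₁ h₂ h'.symm).2 with ⟨rfl, rfl⟩ | ⟨rfl, rfl⟩ <;> exact hne rfl
  · intro d' x'
    constructor
    · rintro ⟨v', h', -⟩
      obtain ⟨rfl, ⟨rfl, -⟩ | ⟨rfl, -⟩⟩ := hd.unique h₁ h₂ h' <;> exact ⟨rfl, rfl⟩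
    · rintro ⟨rfl, rfl⟩
      exact hh
  · rintro d' x' ⟨v', h', h3, h4⟩
    have hee : edgeAt v d = edgeAt v' d' := by
      have := hd.1.symm.trans h'.symm.1
      simpa using this
    rw [← hee] at h4
    exact h4 he1

theorem rate_of_equal {Λ : Finset Vert} (a b c : ℝ) (h : FaceFlip ω₁ ω₂ ∨ NonParallel ω₁ ω₂) :
    rate Λ a b c ω₁ ω₂ = rateConst Λ a b c := if_pos h

theorem rate_of_removes {Λ : Finset Vert} (a b c : ℝ) (h₁ : IsConfig ω₁) (h₂ : IsConfig ω₂)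
    {d x : Dir} (h : Removes ω₁ ω₂ d x) :
    rate Λ a b c ω₁ ω₂ = rateConst Λ a b c * dirWeight a b c x / dirWeight a b c (third d x) ∧
    rate Λ a b c ω₂ ω₁ = rateConst Λ a b c * dirWeight a b c (third d x) / dirWeight a b c x := by
  obtain ⟨h1, h2, h3, h4, h5, h6, h7⟩ := removes_iff h₁ h₂ h
  unfold rate
  simp only [h2, h3, h4, h5, h6, h7]
  cases d <;> cases x <;> simp_all [dirWeight, third]

theorem rate_cases {Λ : Finset Vert} (a b c : ℝ) (h : rate Λ a b c ω₁ ω₂ ≠ 0) :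
    (∃ v d, symmDiff ω₁ ω₂ = {edgeAt v d}) ∨ FaceFlip ω₁ ω₂ := by
  have hr : ∀ d x, Removes ω₁ ω₂ d x → ∃ v d, symmDiff ω₁ ω₂ = {edgeAt v d} :=
    fun d x ⟨v, h, _⟩ => ⟨v, d, h.1⟩
  have hr' : ∀ d x, Removes ω₂ ω₁ d x → ∃ v d, symmDiff ω₁ ω₂ = {edgeAt v d} :=
    fun d x ⟨v, h, _⟩ => ⟨v, d, h.symm.1⟩
  unfold rate at h
  split_ifs at h with g1 g2 g3 g4 g5 g6 g7
  · rcases g1 with g1 | ⟨v, d, x, y, g1, -⟩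
    · exact Or.inr g1
    · exact Or.inl ⟨v, d, g1.1⟩
  · exact Or.inl (g2.elim (hr _ _) (hr' _ _))
  · exact Or.inl (g3.elim (hr' _ _) (hr _ _))
  · exact Or.inl (g4.elim (hr _ _) (hr' _ _))
  · exact Or.inl (g5.elim (hr' _ _) (hr _ _))
  · exact Or.inl (g6.elim (hr _ _) (hr' _ _))
  · exact Or.inl (g7.elim (hr' _ _) (hr _ _))
  · exact absurd rfl h

/-- A single edge flip is non-parallel, or it removes or adds an edge between parallel ones. -/
theorem flip_cases (h₁ : IsConfig ω₁) (h₂ : IsConfig ω₂) {v : Vert} {d : Dir}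
    (hs : symmDiff ω₁ ω₂ = {edgeAt v d}) :
    NonParallel ω₁ ω₂ ∨ (∃ x, Removes ω₁ ω₂ d x) ∨ ∃ x, Removes ω₂ ω₁ d x := by
  obtain ⟨x, y, h⟩ := exists_diffEdge h₁ h₂ hs
  by_cases hxy : x = y
  · subst hxy
    have := mem_of_symmDiff_singleton (u := v) (x := d) hs
    by_cases he : edgeAt v d ∈ ω₁
    · exact Or.inr (Or.inl ⟨x, v, h, he, by tauto⟩)
    · exact Or.inr (Or.inr ⟨x, v, h.symm, by tauto, he⟩)
  · exact Or.inl ⟨v, d, x, y, h, hxy⟩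

end Moves

section Weights

variable {a b c : ℝ}

theorem dirWeight_pos (ha : 0 < a) (hb : 0 < b) (hc : 0 < c) (d : Dir) :
    0 < dirWeight a b c d := by cases d <;> assumption

theorem min_le_dirWeight (a b c : ℝ) (d : Dir) : min (min a b) c ≤ dirWeight a b c d := by
  cases d <;> simp [dirWeight]

theorem dirWeight_le_max (a b c : ℝ) (d : Dir) : dirWeight a b c d ≤ max (max a b) c := by
  cases d <;> simp [dirWeight]

theorem localWeight_bounds {ω : Set (Sym2 Vert)} (h : IsConfig ω) (v : Vert) :
    min (min a b) c ≤ localWeight a b c ω v ∧ localWeight a b c ω v ≤ max (max a b) c := by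
  obtain ⟨d, hd⟩ := h.exists_oddAt v
  rw [localWeight_eq a b c hd]
  exact ⟨min_le_dirWeight a b c d, dirWeight_le_max a b c d⟩

theorem localWeight_pos (ha : 0 < a) (hb : 0 < b) (hc : 0 < c) {ω : Set (Sym2 Vert)}
    (h : IsConfig ω) (v : Vert) : 0 < localWeight a b c ω v :=
  lt_of_lt_of_le (lt_min (lt_min ha hb) hc) (localWeight_bounds h v).1

theorem weight_pos (ha : 0 < a) (hb : 0 < b) (hc : 0 < c) {ω : Set (Sym2 Vert)}
    (h : IsConfig ω) (Λ : Finset Vert) : 0 < weight Λ a b c ω :=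
  Finset.prod_pos fun v _ => localWeight_pos ha hb hc h v

/-- Only the two endpoints change their local weight. With the edge present the odd direction is
that of the absent edge, and without it that of the remaining present edge. For `x ≠ y` the factors
cancel; for `x = y` the weight ratio is a square, which the two reciprocal rates compensate. -/
theorem weight_diffEdge {Λ : Finset Vert} {ω₁ ω₂ : Set (Sym2 Vert)} (h₁ : IsConfig ω₁)
    (h₂ : IsConfig ω₂) {v : Vert} {d x y : Dir} (h : DiffEdge ω₁ ω₂ v d x y)
    (he : edgeAt v d ∈ ω₁) (hΛ : edgeAt v d ∈ edges Λ) :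
    weight Λ a b c ω₁ * (dirWeight a b c x * dirWeight a b c y) =
      weight Λ a b c ω₂ * (dirWeight a b c (third d x) * dirWeight a b c (third d y)) := by
  classical
  obtain ⟨hv, hv'⟩ := edgeAt_mem_edges.1 hΛ
  obtain ⟨o1, o2⟩ := h.oddAt h₁ h₂ he
  obtain ⟨o3, o4⟩ := h.swap.oddAt h₁ h₂ (by rwa [edgeAt_nbr])
  have hne : nbr d v ∈ Λ.erase v := Finset.mem_erase.2 ⟨nbr_ne d v, hv'⟩
  have hrest : ∏ u ∈ (Λ.erase v).erase (nbr d v), localWeight a b c ω₁ u =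
      ∏ u ∈ (Λ.erase v).erase (nbr d v), localWeight a b c ω₂ u := by
    refine Finset.prod_congr rfl fun u hu => ?_
    have hu1 := Finset.ne_of_mem_erase hu
    have hu2 := Finset.ne_of_mem_erase (Finset.mem_of_mem_erase hu)
    refine SameAt.localWeight_eq (fun z => ?_) a b c
    rw [mem_of_symmDiff_singleton h.1]
    intro hz
    obtain ⟨-, h3 | h3⟩ := edgeAt_eq_iff.1 hz.symm
    · exact hu2 h3
    · exact hu1 h3
  unfold weight
  rw [← Finset.mul_prod_erase Λ _ hv, ← Finset.mul_prod_erase Λ _ hv,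
    ← Finset.mul_prod_erase _ _ hne, ← Finset.mul_prod_erase _ _ hne, hrest,
    localWeight_eq a b c o1, localWeight_eq a b c o2, localWeight_eq a b c o3,
    localWeight_eq a b c o4]
  ring

theorem faceVert_injective (f : Vert) : Function.Injective (faceVert f) := by
  obtain ⟨p, q⟩ := f
  intro i j h
  fin_cases i <;> fin_cases j <;> first | rfl | simp [faceVert] at h

theorem FaceFlip.exists_face {Λ : Finset Vert} {bd ω₁ ω₂ : Set (Sym2 Vert)}
    (h₁ : Compat Λ bd ω₁) (h₂ : Compat Λ bd ω₂) (h : FaceFlip ω₁ ω₂) :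
    ∃ f ∈ faces Λ, symmDiff ω₁ ω₂ = Set.range (faceEdge f) := by
  classical
  obtain ⟨f, hf, h1, -⟩ := h
  refine ⟨f, ?_, h1⟩
  have hmem : ∀ i, faceVert f i ∈ Λ := by
    intro i
    have : faceEdge f i ∈ edges Λ := h₁.subset_edges h₂ (h1 ▸ ⟨i, rfl⟩)
    rw [faceEdge_eq hf, edgeAt_mem_edges] at this
    exact this.1
  exact Finset.mem_filter.2 ⟨hmem 0, hf, hmem⟩

/-- When incident and boundary edges alternate in phase, each incident edge has the state of the
boundary edge that follows it, so the preceding one is odd. The flip exchanges the roles of the two.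
-/
theorem FaceFlip.exists_oddAt {ω₁ ω₂ : Set (Sym2 Vert)} {f : Vert} (hf : IsBlack f)
    (h1 : symmDiff ω₁ ω₂ = Set.range (faceEdge f))
    (h2 : ∀ i, faceEdge f i ∈ ω₁ ↔ faceEdge f (i + 1) ∉ ω₁)
    (h3 : ∀ i, outEdge f i ∈ ω₁ ↔ outEdge f (i + 1) ∉ ω₁)
    (h4 : outEdge f 0 ∈ ω₁ ↔ faceEdge f 0 ∈ ω₁) (h5 : ∀ i, outEdge f i ∉ Set.range (faceEdge f))
    (i : ZMod 6) :
    OddAt ω₁ (faceVert f i) (faceDir (i - 1)) ∧ OddAt ω₂ (faceVert f i) (faceDir i) := by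
  have hpar : ∀ j : ℕ, outEdge f j ∈ ω₁ ↔ faceEdge f j ∈ ω₁ := by
    intro j
    induction j with
    | zero => simpa using h4
    | succ j ih =>
      have e1 := h2 j
      have e2 := h3 j
      push_cast
      tauto
  have hi := hpar i.val
  rw [ZMod.natCast_zmod_val] at hi
  have hprev := h2 (i - 1)
  rw [sub_add_cancel] at hprev
  obtain ⟨a1, a2, a3⟩ := faceDir_facts i
  have hall : ∀ z, z = faceDir i ∨ z = faceDir (i - 1) ∨ z = outDir i := by
    intro z
    by_cases z1 : z = faceDir i
    · exact Or.inl z1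
    by_cases z2 : z = faceDir (i - 1)
    · exact Or.inr (Or.inl z2)
    exact Or.inr (Or.inr ((eq_third a3 z2 z1).trans (eq_third a3 a2.symm a1.symm).symm))
  have m1 : edgeAt (faceVert f i) (faceDir i) ∈ symmDiff ω₁ ω₂ := by
    rw [← faceEdge_eq hf, h1]; exact ⟨_, rfl⟩
  have m2 : edgeAt (faceVert f i) (faceDir (i - 1)) ∈ symmDiff ω₁ ω₂ := by
    rw [← faceEdge_pred_eq hf, h1]; exact ⟨_, rfl⟩
  have m3 : edgeAt (faceVert f i) (outDir i) ∉ symmDiff ω₁ ω₂ := by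
    rw [h1]; exact h5 i
  rw [faceEdge_pred_eq hf, faceEdge_eq hf] at hprev
  rw [faceEdge_eq hf, outEdge] at hi
  rw [mem_symmDiff_iff] at m1 m2 m3
  constructor
  · intro z hz
    rcases hall z with rfl | rfl | rfl
    · tauto
    · exact absurd rfl hz
    · tauto
  · intro z hz
    rcases hall z with rfl | rfl | rfl
    · exact absurd rfl hz
    · tauto
    · tauto

theorem outEdge_notMem {f : Vert} (hf : IsBlack f) (i : ZMod 6) :
    outEdge f i ∉ Set.range (faceEdge f) := by
  rintro ⟨j, hj⟩
  obtain ⟨a1, a2, a3⟩ := faceDir_facts i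
  rw [faceEdge_eq hf, outEdge] at hj
  obtain ⟨hd, h | h⟩ := edgeAt_eq_iff.1 hj
  · obtain rfl := faceVert_injective f h
    exact a1 hd
  · rw [← faceVert_succ hf] at h
    rw [faceVert_injective f h, add_sub_cancel_right] at a2
    rw [faceVert_injective f h] at hd
    exact a2 hd

/-- A flip rotates the list of odd directions around the face by one position, so the product of the
six local weights is unchanged. The opposite phase is the same statement with `ω₁` and `ω₂`
exchanged. -/
theorem FaceFlip.weight_eq {Λ : Finset Vert} {bd ω₁ ω₂ : Set (Sym2 Vert)}
    (h₁ : Compat Λ bd ω₁) (h₂ : Compat Λ bd ω₂) (h : FaceFlip ω₁ ω₂) :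
    weight Λ a b c ω₁ = weight Λ a b c ω₂ := by
  classical
  obtain ⟨f, hf, h1, h2, h2', h3, h3'⟩ := h
  have hmem : ∀ i, faceVert f i ∈ Λ := by
    intro i
    have : faceEdge f i ∈ edges Λ := h₁.subset_edges h₂ (h1 ▸ ⟨i, rfl⟩)
    rw [faceEdge_eq hf, edgeAt_mem_edges] at this
    exact this.1
  have hsub : Finset.univ.image (faceVert f) ⊆ Λ := by
    intro v hv
    obtain ⟨i, -, rfl⟩ := Finset.mem_image.1 hv
    exact hmem i
  have hrest : ∏ u ∈ Λ \ Finset.univ.image (faceVert f), localWeight a b c ω₁ u =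
      ∏ u ∈ Λ \ Finset.univ.image (faceVert f), localWeight a b c ω₂ u := by
    refine Finset.prod_congr rfl fun u hu => ?_
    have hu' : ∀ i, faceVert f i ≠ u := fun i hi =>
      (Finset.mem_sdiff.1 hu).2 (Finset.mem_image.2 ⟨i, Finset.mem_univ _, hi⟩)
    refine SameAt.localWeight_eq (fun z => ?_) a b c
    have : edgeAt u z ∉ symmDiff ω₁ ω₂ := by
      rw [h1]
      rintro ⟨i, hi⟩
      rw [faceEdge_eq hf] at hi
      obtain ⟨-, h | h⟩ := edgeAt_eq_iff.1 hi
      · exact hu' i h.symm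
      · rw [← faceVert_succ hf] at h
        exact hu' _ h.symm
    rw [mem_symmDiff_iff] at this
    tauto
  have hshift : ∏ i : ZMod 6, dirWeight a b c (faceDir (i - 1)) =
      ∏ i : ZMod 6, dirWeight a b c (faceDir i) :=
    Fintype.prod_equiv (Equiv.subRight 1) _ _ fun _ => rfl
  have hface : ∏ u ∈ Finset.univ.image (faceVert f), localWeight a b c ω₁ u =
      ∏ u ∈ Finset.univ.image (faceVert f), localWeight a b c ω₂ u := by
    rw [Finset.prod_image fun _ _ _ _ h => faceVert_injective f h,
      Finset.prod_image fun _ _ _ _ h => faceVert_injective f h]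
    by_cases h4 : outEdge f 0 ∈ ω₁ ↔ faceEdge f 0 ∈ ω₁
    · have hodd := FaceFlip.exists_oddAt hf h1 h2 h3 h4 (outEdge_notMem hf)
      rw [Finset.prod_congr rfl fun i _ => localWeight_eq a b c (hodd i).1,
        Finset.prod_congr rfl fun i _ => localWeight_eq a b c (hodd i).2, hshift]
    · have h5 : outEdge f 0 ∈ ω₂ ↔ faceEdge f 0 ∈ ω₂ := by
        have m1 : faceEdge f 0 ∈ symmDiff ω₁ ω₂ := h1 ▸ ⟨_, rfl⟩
        have m2 : outEdge f 0 ∉ symmDiff ω₁ ω₂ := h1 ▸ outEdge_notMem hf 0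
        rw [mem_symmDiff_iff] at m1 m2
        tauto
      have hodd := FaceFlip.exists_oddAt hf (by rw [symmDiff_comm, h1]) h2' h3' h5
        (outEdge_notMem hf)
      rw [Finset.prod_congr rfl fun i _ => localWeight_eq a b c (hodd i).1,
        Finset.prod_congr rfl fun i _ => localWeight_eq a b c (hodd i).2, hshift]
  unfold weight
  rw [← Finset.prod_sdiff hsub, ← Finset.prod_sdiff hsub, hrest, hface]

/-- Detailed balance. -/
theorem weight_mul_rate (ha : 0 < a) (hb : 0 < b) (hc : 0 < c) {Λ : Finset Vert}
    {bd ω₁ ω₂ : Set (Sym2 Vert)} (h₁ : Compat Λ bd ω₁) (h₂ : Compat Λ bd ω₂) :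
    weight Λ a b c ω₁ * rate Λ a b c ω₁ ω₂ = weight Λ a b c ω₂ * rate Λ a b c ω₂ ω₁ := by
  have hremove : ∀ {η₁ η₂ : Set (Sym2 Vert)}, Compat Λ bd η₁ → Compat Λ bd η₂ → ∀ {d x},
      Removes η₁ η₂ d x →
      weight Λ a b c η₁ * rate Λ a b c η₁ η₂ = weight Λ a b c η₂ * rate Λ a b c η₂ η₁ := by
    intro η₁ η₂ g₁ g₂ d x hr
    obtain ⟨r1, r2⟩ := rate_of_removes (Λ := Λ) a b c g₁.1 g₂.1 hr
    obtain ⟨v, hd, he, -⟩ := hr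
    have hw := weight_diffEdge (a := a) (b := b) (c := c) g₁.1 g₂.1 hd he
      (g₁.subset_edges g₂ (by rw [hd.1]; rfl))
    have p1 := dirWeight_pos ha hb hc x
    have p2 := dirWeight_pos ha hb hc (third d x)
    rw [r1, r2]
    field_simp
    linear_combination rateConst Λ a b c * hw
  have hzero : ∀ {η₁ η₂ : Set (Sym2 Vert)}, Compat Λ bd η₁ → Compat Λ bd η₂ →
      rate Λ a b c η₁ η₂ ≠ 0 →
      weight Λ a b c η₁ * rate Λ a b c η₁ η₂ = weight Λ a b c η₂ * rate Λ a b c η₂ η₁ := by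
    intro η₁ η₂ g₁ g₂ hne
    rcases rate_cases a b c hne with ⟨v, d, hs⟩ | hf
    · rcases flip_cases g₁.1 g₂.1 hs with hn | ⟨x, hx⟩ | ⟨x, hx⟩
      · have hn' : NonParallel η₂ η₁ := by
          obtain ⟨v, d, x, y, h, hxy⟩ := hn
          exact ⟨v, d, x, y, h.symm, hxy⟩
        rw [rate_of_equal a b c (Or.inr hn), rate_of_equal a b c (Or.inr hn')]
        obtain ⟨v, d, x, y, h, hxy⟩ := hn
        have key : ∀ {ξ₁ ξ₂ : Set (Sym2 Vert)}, Compat Λ bd ξ₁ → Compat Λ bd ξ₂ →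
            DiffEdge ξ₁ ξ₂ v d x y → edgeAt v d ∈ ξ₁ →
            weight Λ a b c ξ₁ = weight Λ a b c ξ₂ := by
          intro ξ₁ ξ₂ c₁ c₂ hd he
          have hw := weight_diffEdge (a := a) (b := b) (c := c) c₁.1 c₂.1 hd he
            (c₁.subset_edges c₂ (by rw [hd.1]; rfl))
          have e1 : y = third d x := eq_third hd.2.1 hd.2.2.1 (Ne.symm hxy)
          have e2 : x = third d y := eq_third hd.2.2.1 hd.2.1 hxy
          rw [← e1, ← e2, mul_comm (dirWeight a b c y)] at hw
          exact mul_right_cancel₀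
            (mul_pos (dirWeight_pos ha hb hc x) (dirWeight_pos ha hb hc y)).ne' hw
        congr 1
        by_cases he : edgeAt v d ∈ η₁
        · exact key g₁ g₂ h he
        · have := mem_of_symmDiff_singleton (u := v) (x := d) h.1
          exact (key g₂ g₁ h.symm (by tauto)).symm
      · exact hremove g₁ g₂ hx
      · exact (hremove g₂ g₁ hx).symm
    · rw [rate_of_equal a b c (Or.inl hf), rate_of_equal a b c (Or.inl hf.symm),
        hf.weight_eq g₁ g₂]
  by_cases hz : rate Λ a b c ω₁ ω₂ = 0
  · by_cases hz' : rate Λ a b c ω₂ ω₁ = 0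
    · rw [hz, hz', mul_zero, mul_zero]
    · exact (hzero h₂ h₁ hz').symm
  · exact hzero h₁ h₂ hz

theorem rateConst_nonneg (ha : 0 < a) (hb : 0 < b) (hc : 0 < c) (Λ : Finset Vert) :
    0 ≤ rateConst Λ a b c := by
  have : 0 < min (min a b) c := lt_min (lt_min ha hb) hc
  have : 0 < max (max a b) c := lt_of_lt_of_le hc (le_max_right _ _)
  unfold rateConst
  positivity

theorem ratio_bounds (ha : 0 < a) (hb : 0 < b) (hc : 0 < c) (x y : Dir) :
    min (min a b) c / max (max a b) c ≤ dirWeight a b c x / dirWeight a b c y ∧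
      dirWeight a b c x / dirWeight a b c y ≤ max (max a b) c / min (min a b) c := by
  have h1 : 0 < min (min a b) c := lt_min (lt_min ha hb) hc
  have h2 : 0 < max (max a b) c := lt_of_lt_of_le hc (le_max_right _ _)
  exact ⟨div_le_div₀ (dirWeight_pos ha hb hc x).le (min_le_dirWeight a b c x)
    (dirWeight_pos ha hb hc y) (dirWeight_le_max a b c y),
    div_le_div₀ h2.le (dirWeight_le_max a b c x) h1 (min_le_dirWeight a b c y)⟩

theorem rate_upper (ha : 0 < a) (hb : 0 < b) (hc : 0 < c) (Λ : Finset Vert)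
    (ω₁ ω₂ : Set (Sym2 Vert)) :
    0 ≤ rate Λ a b c ω₁ ω₂ ∧
      rate Λ a b c ω₁ ω₂ ≤ rateConst Λ a b c * (max (max a b) c / min (min a b) c) := by
  have hC := rateConst_nonneg ha hb hc Λ
  have h1 : 0 < min (min a b) c := lt_min (lt_min ha hb) hc
  have h2 : 0 < max (max a b) c := lt_of_lt_of_le hc (le_max_right _ _)
  have hone : 1 ≤ max (max a b) c / min (min a b) c :=
    (one_le_div h1).2 ((min_le_right _ _).trans (le_max_right _ _))
  have hr : ∀ x y : Dir, 0 ≤ rateConst Λ a b c * dirWeight a b c x / dirWeight a b c y ∧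
      rateConst Λ a b c * dirWeight a b c x / dirWeight a b c y ≤
        rateConst Λ a b c * (max (max a b) c / min (min a b) c) := by
    intro x y
    have := ratio_bounds ha hb hc x y
    have p1 := dirWeight_pos ha hb hc x
    have p2 := dirWeight_pos ha hb hc y
    refine ⟨by positivity, ?_⟩
    rw [mul_div_assoc]
    exact mul_le_mul_of_nonneg_left this.2 hC
  unfold rate
  split_ifs
  · exact ⟨hC, le_mul_of_one_le_right hC hone⟩
  · exact hr Dir.NW Dir.NE
  · exact hr Dir.NE Dir.NW
  · exact hr Dir.H Dir.NE
  · exact hr Dir.NE Dir.H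
  · exact hr Dir.NW Dir.H
  · exact hr Dir.H Dir.NW
  · exact ⟨le_rfl, by positivity⟩

theorem rate_lower (ha : 0 < a) (hb : 0 < b) (hc : 0 < c) {Λ : Finset Vert}
    {bd ω₁ ω₂ : Set (Sym2 Vert)} (h : Step Λ bd ω₁ ω₂) :
    rateConst Λ a b c * (min (min a b) c / max (max a b) c) ≤ rate Λ a b c ω₁ ω₂ := by
  have hC := rateConst_nonneg ha hb hc Λ
  have h2 : 0 < max (max a b) c := lt_of_lt_of_le hc (le_max_right _ _)
  have hone : min (min a b) c / max (max a b) c ≤ 1 :=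
    (div_le_one h2).2 ((min_le_right _ _).trans (le_max_right _ _))
  obtain ⟨h₁, h₂, h⟩ := h
  rcases h with ⟨v, d, hs⟩ | hf
  · rcases flip_cases h₁.1 h₂.1 hs with hn | ⟨x, hx⟩ | ⟨x, hx⟩
    · rw [rate_of_equal a b c (Or.inr hn)]
      exact mul_le_of_le_one_right hC hone
    · rw [(rate_of_removes (Λ := Λ) a b c h₁.1 h₂.1 hx).1, mul_div_assoc]
      exact mul_le_mul_of_nonneg_left (ratio_bounds ha hb hc _ _).1 hC
    · rw [(rate_of_removes (Λ := Λ) a b c h₂.1 h₁.1 hx).2, mul_div_assoc]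
      exact mul_le_mul_of_nonneg_left (ratio_bounds ha hb hc _ _).1 hC
  · rw [rate_of_equal a b c (Or.inl hf)]
    exact mul_le_of_le_one_right hC hone

/-- The total rate of leaving a configuration is at most `1/2`. -/
theorem sum_rate_le (ha : 0 < a) (hb : 0 < b) (hc : 0 < c) (Λ : Finset Vert)
    (bd : Set (Sym2 Vert)) (ω : State Λ bd) (s : Finset (State Λ bd)) :
    ∑ ω' ∈ s, rate Λ a b c ω.1 ω'.1 ≤ 1 / 2 := by
  classical
  have h1 : 0 < min (min a b) c := lt_min (lt_min ha hb) hc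
  have h2 : 0 < max (max a b) c := lt_of_lt_of_le hc (le_max_right _ _)
  set M := rateConst Λ a b c * (max (max a b) c / min (min a b) c) with hM
  let t := s.filter fun ω' => rate Λ a b c ω.1 ω'.1 ≠ 0
  -- A target is determined by the set of edges changed, which is a single edge or the boundary of a
  -- face.
  have hcard : t.card ≤ (edges Λ).card + (faces Λ).card := by
    have : t.card ≤ ((edges Λ).image (fun e => ({e} : Set (Sym2 Vert))) ∪
        (faces Λ).image fun f => Set.range (faceEdge f)).card := by
      refine Finset.card_le_card_of_injOn (fun ω' => symmDiff ω.1 ω'.1) ?_ ?_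
      · intro ω' hω'
        have hω' := (Finset.mem_filter.1 hω').2
        rw [Finset.mem_coe, Finset.mem_union, Finset.mem_image, Finset.mem_image]
        rcases rate_cases a b c hω' with ⟨v, d, hs⟩ | hf
        · exact Or.inl ⟨_, Compat.subset_edges ω.2 ω'.2 (by rw [hs]; rfl), hs.symm⟩
        · obtain ⟨f, hf1, hf2⟩ := FaceFlip.exists_face ω.2 ω'.2 hf
          exact Or.inr ⟨f, hf1, hf2.symm⟩
      · intro x _ y _ hxy
        exact Subtype.ext (symmDiff_right_injective _ hxy)
    exact this.trans ((Finset.card_union_le _ _).trans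
      (add_le_add Finset.card_image_le Finset.card_image_le))
  have hsum : ∑ ω' ∈ s, rate Λ a b c ω.1 ω'.1 = ∑ ω' ∈ t, rate Λ a b c ω.1 ω'.1 :=
    (Finset.sum_filter_ne_zero s).symm
  rw [hsum]
  calc ∑ ω' ∈ t, rate Λ a b c ω.1 ω'.1 ≤ t.card • M :=
        Finset.sum_le_card_nsmul _ _ _ fun ω' _ => (rate_upper ha hb hc Λ ω.1 ω'.1).2
    _ ≤ ((edges Λ).card + (faces Λ).card) * M := by
        rw [nsmul_eq_mul]
        refine mul_le_mul_of_nonneg_right ?_ (by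
          have := rateConst_nonneg ha hb hc Λ
          positivity)
        exact_mod_cast hcard
    _ ≤ 1 / 2 := by
        rw [hM, rateConst]
        set N : ℝ := ((edges Λ).card : ℝ) + ((faces Λ).card : ℝ) with hN
        have hN0 : 0 ≤ N := by positivity
        -- Without edges and faces `rateConst` is a division by zero, hence 0; otherwise the bound
        -- is exactly 1/2.
        rcases hN0.eq_or_lt with h0 | h0
        · rw [← h0]
          norm_num
        · apply le_of_eq
          field_simp

end Weights

end OneTwo

namespace OneTwo

/-! ### Lazy reversible chains: Poincaré inequality and convergence -/

section ReversibleChain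

variable {S : Type} [Fintype S]

/-- The standing hypotheses on a reversible lazy chain. -/
structure IsLazyReversible (P : Matrix S S ℝ) (π : S → ℝ) : Prop where
  pos : ∀ x, 0 < π x
  sum_eq_one : ∑ x, π x = 1
  nonneg : ∀ x y, 0 ≤ P x y
  row_sum : ∀ x, ∑ y, P x y = 1
  reversible : ∀ x y, π x * P x y = π y * P y x
  half_le : ∀ x, 1 / 2 ≤ P x x

/-- The Poincaré inequality with constant `l`. -/
def Poincare (P : Matrix S S ℝ) (π : S → ℝ) (l : ℝ) : Prop :=
  ∀ f : S → ℝ, ∑ x, π x * f x = 0 →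
    l * ∑ x, π x * f x ^ 2 ≤ (∑ x, ∑ y, π x * P x y * (f x - f y) ^ 2) / 2

variable {P : Matrix S S ℝ} {π : S → ℝ}

theorem IsLazyReversible.sum_mul_apply (h : IsLazyReversible P π) (f : S → ℝ) :
    ∑ x, π x * ∑ y, P x y * f y = ∑ x, π x * f x := by
  simp only [Finset.mul_sum]
  rw [Finset.sum_comm]
  refine Finset.sum_congr rfl fun y _ => ?_
  calc ∑ x, π x * (P x y * f y) = ∑ x, π y * f y * P y x := by
        refine Finset.sum_congr rfl fun x _ => ?_
        linear_combination f y * h.reversible x y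
    _ = π y * f y := by rw [← Finset.mul_sum, h.row_sum, mul_one]

theorem IsLazyReversible.dirichlet_eq (h : IsLazyReversible P π) (f : S → ℝ) :
    (∑ x, ∑ y, π x * P x y * (f x - f y) ^ 2) / 2 =
      ∑ x, π x * f x ^ 2 - ∑ x, π x * f x * ∑ y, P x y * f y := by
  have h1 : ∑ x, ∑ y, π x * P x y * f x ^ 2 = ∑ x, π x * f x ^ 2 := by
    refine Finset.sum_congr rfl fun x _ => ?_
    calc ∑ y, π x * P x y * f x ^ 2 = ∑ y, π x * f x ^ 2 * P x y :=
          Finset.sum_congr rfl fun y _ => by ring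
      _ = π x * f x ^ 2 := by rw [← Finset.mul_sum, h.row_sum, mul_one]
  have h2 : ∑ x, ∑ y, π x * P x y * f y ^ 2 = ∑ x, π x * f x ^ 2 := by
    rw [← h1, Finset.sum_comm]
    refine Finset.sum_congr rfl fun x _ => Finset.sum_congr rfl fun y _ => ?_
    rw [h.reversible]
  have h3 : ∑ x, ∑ y, π x * P x y * (f x * f y) = ∑ x, π x * f x * ∑ y, P x y * f y := by
    refine Finset.sum_congr rfl fun x _ => ?_
    rw [Finset.mul_sum]
    exact Finset.sum_congr rfl fun y _ => by ring
  have h4 : ∑ x, ∑ y, π x * P x y * (f x - f y) ^ 2 =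
      ∑ x, ∑ y, π x * P x y * f x ^ 2 + ∑ x, ∑ y, π x * P x y * f y ^ 2 -
        2 * ∑ x, ∑ y, π x * P x y * (f x * f y) := by
    simp only [Finset.mul_sum, ← Finset.sum_add_distrib, ← Finset.sum_sub_distrib]
    exact Finset.sum_congr rfl fun x _ => Finset.sum_congr rfl fun y _ => by ring
  rw [h4, h1, h2, h3]
  ring

/-- A lazy reversible chain satisfies `P ^ 2 ≤ P` as quadratic forms. -/
theorem IsLazyReversible.sq_le (h : IsLazyReversible P π) (f : S → ℝ) :
    ∑ x, π x * (∑ y, P x y * f y) ^ 2 ≤ ∑ x, π x * f x * ∑ y, P x y * f y := by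
  classical
  have key : ∀ x, (2 * (∑ y, P x y * f y) - f x) ^ 2 ≤ 2 * (∑ y, P x y * f y ^ 2) - f x ^ 2 := by
    intro x
    -- By laziness `2P - I` is a stochastic matrix, so Cauchy–Schwarz applies to it row by row.
    -- Integrating and expanding the square gives the claim.
    set Q : S → ℝ := fun y => 2 * P x y - if y = x then 1 else 0 with hQ
    have hQ0 : ∀ y, 0 ≤ Q y := by
      intro y
      simp only [hQ]
      split_ifs with hy
      · have := h.half_le x
        rw [hy]
        linarith
      · have := h.nonneg x y
        linarith
    have hsum : ∀ g : S → ℝ, ∑ y, Q y * g y = 2 * (∑ y, P x y * g y) - g x := by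
      intro g
      simp only [hQ, sub_mul, Finset.sum_sub_distrib, ite_mul, one_mul, zero_mul,
        Finset.sum_ite_eq', Finset.mem_univ, if_true, Finset.mul_sum, mul_assoc]
    have h1 := hsum fun _ => 1
    simp only [mul_one, h.row_sum] at h1
    have h2 := Finset.sum_sq_le_sum_mul_sum_of_sq_le_mul Finset.univ (r := fun y => Q y * f y)
      (f := Q) (g := fun y => Q y * f y ^ 2) (fun y _ => hQ0 y)
      (fun y _ => mul_nonneg (hQ0 y) (sq_nonneg _)) (fun y _ => le_of_eq (by ring))
    rw [h1] at h2
    have h3 := hsum f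
    have h4 := hsum fun y => f y ^ 2
    rw [h3, h4] at h2
    linarith
  have h1 : ∑ x, π x * (2 * (∑ y, P x y * f y) - f x) ^ 2 ≤
      ∑ x, π x * (2 * (∑ y, P x y * f y ^ 2) - f x ^ 2) :=
    Finset.sum_le_sum fun x _ => mul_le_mul_of_nonneg_left (key x) (h.pos x).le
  have h2 : ∑ x, π x * (2 * (∑ y, P x y * f y ^ 2) - f x ^ 2) = ∑ x, π x * f x ^ 2 := by
    have := h.sum_mul_apply fun y => f y ^ 2
    have h3 : ∑ x, π x * (2 * (∑ y, P x y * f y ^ 2) - f x ^ 2) =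
        2 * (∑ x, π x * ∑ y, P x y * f y ^ 2) - ∑ x, π x * f x ^ 2 := by
      rw [Finset.mul_sum, ← Finset.sum_sub_distrib]
      exact Finset.sum_congr rfl fun x _ => by ring
    rw [h3, this]
    ring
  have h4 : ∑ x, π x * (2 * (∑ y, P x y * f y) - f x) ^ 2 =
      4 * ∑ x, π x * (∑ y, P x y * f y) ^ 2 - 4 * ∑ x, π x * f x * ∑ y, P x y * f y +
        ∑ x, π x * f x ^ 2 := by
    rw [Finset.mul_sum, Finset.mul_sum, ← Finset.sum_sub_distrib, ← Finset.sum_add_distrib]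
    exact Finset.sum_congr rfl fun x _ => by ring
  rw [h4, h2] at h1
  linarith

/-- The norm of `P f` is bounded by the inner product of `f` and `P f`, which is the norm of `f`
minus the Dirichlet form. This needs no information on negative eigenvalues. -/
theorem IsLazyReversible.contraction (h : IsLazyReversible P π) {l : ℝ} (hl : Poincare P π l)
    {f : S → ℝ} (hf : ∑ x, π x * f x = 0) :
    ∑ x, π x * (∑ y, P x y * f y) ^ 2 ≤ (1 - l) * ∑ x, π x * f x ^ 2 := by
  have h1 := hl f hf
  rw [h.dirichlet_eq] at h1
  have h2 := h.sq_le f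
  linarith

/-- The Poincaré inequality gives uniqueness of the stationary distribution. -/
theorem IsLazyReversible.isStationary_iff (h : IsLazyReversible P π) {l : ℝ}
    (hl : Poincare P π l) (hl0 : 0 < l) (ν : S → ℝ) : IsStationary P ν ↔ ν = π := by
  constructor
  · rintro ⟨-, h1, h2⟩
    -- The density of `ν` relative to `π`, centred, is fixed by `P` because of reversibility; the
    -- contraction then forces it to be 0.
    set g : S → ℝ := fun x => ν x / π x - 1 with hg
    have hπg : ∀ x, π x * g x = ν x - π x := by
      intro x
      have := (h.pos x).ne'
      simp only [hg]
      field_simp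
    have hmean : ∑ x, π x * g x = 0 := by
      simp only [hπg, Finset.sum_sub_distrib, h1, h.sum_eq_one, sub_self]
    have hPg : ∀ x, ∑ y, P x y * g y = g x := by
      intro x
      have hx := (h.pos x).ne'
      apply mul_left_cancel₀ hx
      calc π x * ∑ y, P x y * g y = ∑ y, (ν y * P y x - π x * P x y) := by
            rw [Finset.mul_sum]
            refine Finset.sum_congr rfl fun y _ => ?_
            rw [h.reversible, ← mul_assoc, h.reversible]
            have := hπg y
            linear_combination P y x * this
        _ = π x * g x := by
            rw [Finset.sum_sub_distrib, h2, ← Finset.mul_sum, h.row_sum, mul_one, hπg]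
    have h3 := h.contraction hl hmean
    simp only [hPg] at h3
    have h4 : ∑ x, π x * g x ^ 2 = 0 := by
      have : 0 ≤ ∑ x, π x * g x ^ 2 :=
        Finset.sum_nonneg fun x _ => mul_nonneg (h.pos x).le (sq_nonneg _)
      nlinarith
    have h5 := (Finset.sum_eq_zero_iff_of_nonneg
      fun x _ => mul_nonneg (h.pos x).le (sq_nonneg (g x))).1 h4
    funext x
    have h6 := h5 x (Finset.mem_univ x)
    have h7 : g x = 0 := by
      rcases mul_eq_zero.1 h6 with h8 | h8
      · exact absurd h8 (h.pos x).ne'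
      · exact pow_eq_zero_iff two_ne_zero |>.1 h8
    have := hπg x
    rw [h7] at this
    linarith
  · rintro rfl
    refine ⟨fun x => (h.pos x).le, h.sum_eq_one, fun y => ?_⟩
    simp only [h.reversible _ y, ← Finset.mul_sum, h.row_sum, mul_one]

variable [DecidableEq S]

theorem IsLazyReversible.contraction_pow (h : IsLazyReversible P π) {l : ℝ} (hl : Poincare P π l)
    (hl1 : l ≤ 1) {f : S → ℝ} (hf : ∑ x, π x * f x = 0) (t : ℕ) :
    ∑ x, π x * (∑ y, (P ^ t) x y * f y) = 0 ∧
    ∑ x, π x * (∑ y, (P ^ t) x y * f y) ^ 2 ≤ (1 - l) ^ t * ∑ x, π x * f x ^ 2 := by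
  induction t with
  | zero => simp [Matrix.one_apply, hf]
  | succ t ih =>
    have h1 : ∀ x, ∑ y, (P ^ (t + 1)) x y * f y = ∑ z, P x z * ∑ y, (P ^ t) z y * f y := by
      intro x
      simp only [pow_succ', Matrix.mul_apply, Finset.sum_mul, Finset.mul_sum]
      rw [Finset.sum_comm]
      exact Finset.sum_congr rfl fun _ _ => Finset.sum_congr rfl fun _ _ => by ring
    simp only [h1]
    rw [h.sum_mul_apply fun z => ∑ y, (P ^ t) z y * f y]
    refine ⟨ih.1, (h.contraction hl ih.1).trans ?_⟩
    rw [pow_succ', mul_assoc]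
    exact mul_le_mul_of_nonneg_left ih.2 (by linarith)

theorem IsLazyReversible.pow_row_sum (h : IsLazyReversible P π) (t : ℕ) (x : S) :
    ∑ y, (P ^ t) x y = 1 := by
  induction t generalizing x with
  | zero => simp [Matrix.one_apply]
  | succ t ih =>
    simp only [pow_succ', Matrix.mul_apply]
    rw [Finset.sum_comm]
    simp only [← Finset.mul_sum, ih, mul_one, h.row_sum]

/-- The decay is applied to the centred indicator of `A`, whose norm is at most 1, and a single
point is estimated by the whole sum at the cost of the factor `π x`. -/
theorem IsLazyReversible.abs_sub_le (h : IsLazyReversible P π) {l : ℝ} (hl : Poincare P π l)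
    (hl1 : l ≤ 1) (t : ℕ) (x : S) (A : Finset S) :
    π x * |∑ y ∈ A, (P ^ t) x y - ∑ y ∈ A, π y| ^ 2 ≤ (1 - l) ^ t := by
  set f : S → ℝ := fun y => (if y ∈ A then 1 else 0) - ∑ y ∈ A, π y with hfdef
  have hA0 : 0 ≤ ∑ y ∈ A, π y := Finset.sum_nonneg fun y _ => (h.pos y).le
  have hA1 : ∑ y ∈ A, π y ≤ 1 := by
    rw [← h.sum_eq_one]
    exact Finset.sum_le_univ_sum_of_nonneg fun y => (h.pos y).le
  have hf : ∑ y, π y * f y = 0 := by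
    simp only [hfdef, mul_sub, Finset.sum_sub_distrib, ← Finset.sum_mul, h.sum_eq_one]
    simp
  have hPf : ∑ y, (P ^ t) x y * f y = ∑ y ∈ A, (P ^ t) x y - ∑ y ∈ A, π y := by
    simp only [hfdef, mul_sub, Finset.sum_sub_distrib, ← Finset.sum_mul, h.pow_row_sum]
    simp
  have hN : ∑ y, π y * f y ^ 2 ≤ 1 := by
    rw [← h.sum_eq_one]
    refine Finset.sum_le_sum fun y _ => mul_le_of_le_one_right (h.pos y).le ?_
    simp only [hfdef]
    split_ifs <;> nlinarith
  have h1 := (h.contraction_pow hl hl1 hf t).2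
  have h2 : π x * (∑ y, (P ^ t) x y * f y) ^ 2 ≤ ∑ x, π x * (∑ y, (P ^ t) x y * f y) ^ 2 :=
    Finset.single_le_sum (f := fun x => π x * (∑ y, (P ^ t) x y * f y) ^ 2)
      (fun y _ => mul_nonneg (h.pos y).le (sq_nonneg _)) (Finset.mem_univ x)
  rw [sq_abs, ← hPf]
  have h3 : 0 ≤ (1 - l) ^ t := pow_nonneg (by linarith) t
  calc _ ≤ (1 - l) ^ t * ∑ x, π x * f x ^ 2 := h2.trans h1
    _ ≤ (1 - l) ^ t := mul_le_of_le_one_right h3 hN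

end ReversibleChain

section Distance

variable {S : Type} [Fintype S]

theorem tvDist_le {μ ν : S → ℝ} {ε : ℝ} (h : ∀ A : Finset S, |∑ x ∈ A, μ x - ∑ x ∈ A, ν x| ≤ ε) :
    tvDist μ ν ≤ ε := ciSup_le h

theorem le_tvDist (μ ν : S → ℝ) (A : Finset S) :
    |∑ x ∈ A, μ x - ∑ x ∈ A, ν x| ≤ tvDist μ ν :=
  le_ciSup (f := fun A : Finset S => |∑ x ∈ A, μ x - ∑ x ∈ A, ν x|)
    (Set.finite_range _).bddAbove A

open Classical in
theorem distAt_le [Nonempty S] {P : Matrix S S ℝ} {π : S → ℝ} {t : ℕ} {ε : ℝ}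
    (h : ∀ x, ∀ A : Finset S, |∑ y ∈ A, (P ^ t) x y - ∑ y ∈ A, π y| ≤ ε) :
    distAt P π t ≤ ε := ciSup_le fun x => tvDist_le (h x)

open Classical in
theorem le_distAt (P : Matrix S S ℝ) (π : S → ℝ) (t : ℕ) (x : S) (A : Finset S) :
    |∑ y ∈ A, (P ^ t) x y - ∑ y ∈ A, π y| ≤ distAt P π t :=
  (le_tvDist _ _ A).trans
    (le_ciSup (f := fun x => tvDist ((P ^ t) x) π) (Set.finite_range _).bddAbove x)

open Classical in
/-- If `t` steps from two states lead to disjoint sets of states, then `t` is too small. -/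
theorem quarter_lt_distAt {P : Matrix S S ℝ} {π : S → ℝ} (h : IsLazyReversible P π) {t : ℕ}
    {x y : S} (hd : ∀ z, (P ^ t) x z = 0 ∨ (P ^ t) y z = 0) : 1 / 4 < distAt P π t := by
  by_contra hn
  rw [not_lt] at hn
  -- On the support of the first distribution the two have masses 1 and 0, so `π A` would lie both
  -- above 3/4 and below 1/4.
  set A : Finset S := Finset.univ.filter fun z => (P ^ t) x z ≠ 0 with hA
  have h1 := (le_distAt P π t x A).trans hn
  have h2 := (le_distAt P π t y A).trans hn
  have e1 : ∑ z ∈ A, (P ^ t) x z = 1 := by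
    rw [hA, Finset.sum_filter_ne_zero, h.pow_row_sum]
  have e2 : ∑ z ∈ A, (P ^ t) y z = 0 := by
    refine Finset.sum_eq_zero fun z hz => ?_
    exact (hd z).resolve_left (Finset.mem_filter.1 hz).2
  rw [e1, abs_le] at h1
  rw [e2, abs_le] at h2
  linarith [h1.1, h1.2, h2.1, h2.2]

open Classical in
theorem exists_isMixingTime {P : Matrix S S ℝ} {π : S → ℝ} {ε : ℝ} {s : ℕ} (hs : 1 ≤ s)
    (h : distAt P π s ≤ ε) : ∃ t, IsMixingTime P π ε t ∧ t ≤ s := by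
  have hex : ∃ t, 1 ≤ t ∧ distAt P π t ≤ ε := ⟨s, hs, h⟩
  exact ⟨Nat.find hex, ⟨Nat.find_spec hex, fun t ht => Nat.find_min' hex ht⟩,
    Nat.find_min' hex ⟨hs, h⟩⟩

end Distance

end OneTwo

namespace OneTwo

/-! ### From Lipschitz contraction of averages to a variance bound -/

section Contraction

variable {S : Type} [Fintype S]

open Classical in
/-- The average of `f` with weights `w` over the class of `x`. -/
noncomputable def classAvg (w : S → ℝ) (r : S → S → Prop) (f : S → ℝ) (x : S) : ℝ :=
  (∑ y with r x y, w y * f y) / ∑ y with r x y, w y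

variable {w : S → ℝ} {r : S → S → Prop}

open Classical in
theorem classSum_pos (hw : ∀ x, 0 < w x) (hr : Equivalence r) (x : S) :
    0 < ∑ y with r x y, w y :=
  Finset.sum_pos (fun y _ => hw y) ⟨x, Finset.mem_filter.2 ⟨Finset.mem_univ x, hr.refl x⟩⟩

open Classical in
theorem classSum_congr (hr : Equivalence r) {x y : S} (h : r x y) (g : S → ℝ) :
    ∑ z with r x z, g z = ∑ z with r y z, g z := by
  congr 1
  ext z
  simp only [Finset.mem_filter, Finset.mem_univ, true_and]
  exact ⟨fun h1 => hr.trans (hr.symm h) h1, fun h1 => hr.trans h h1⟩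

open Classical in
theorem sum_mul_classAvg (f g : S → ℝ) :
    ∑ x, w x * f x * classAvg w r g x =
      ∑ x, ∑ y, if r x y then w x * w y / (∑ z with r x z, w z) * (f x * g y) else 0 := by
  refine Finset.sum_congr rfl fun x _ => ?_
  rw [classAvg, ← Finset.sum_filter, Finset.sum_div, Finset.mul_sum]
  exact Finset.sum_congr rfl fun y _ => by ring

theorem classAvg_selfAdjoint (hr : Equivalence r) (f g : S → ℝ) :
    ∑ x, w x * f x * classAvg w r g x = ∑ x, w x * classAvg w r f x * g x := by
  classical
  have h1 : ∑ x, w x * classAvg w r f x * g x = ∑ x, w x * g x * classAvg w r f x :=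
    Finset.sum_congr rfl fun x _ => by ring
  rw [h1, sum_mul_classAvg, sum_mul_classAvg, Finset.sum_comm]
  refine Finset.sum_congr rfl fun x _ => Finset.sum_congr rfl fun y _ => ?_
  by_cases hxy : r x y
  · rw [if_pos hxy, if_pos (hr.symm hxy), classSum_congr hr hxy]
    ring
  · rw [if_neg hxy, if_neg fun h => hxy (hr.symm h)]

theorem classAvg_const (hw : ∀ x, 0 < w x) (hr : Equivalence r) (c : ℝ) (x : S) :
    classAvg w r (fun _ => c) x = c := by
  classical
  rw [classAvg, ← Finset.sum_mul]
  have := (classSum_pos hw hr x).ne'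
  field_simp

open Classical in
/-- The expected conditional variance as a double sum. -/
theorem sum_sub_classAvg (hw : ∀ x, 0 < w x) (hr : Equivalence r) (f : S → ℝ) :
    ∑ x, w x * f x * (f x - classAvg w r f x) =
      (∑ x, ∑ y with r x y, w x * w y / (∑ z with r x z, w z) * (f x - f y) ^ 2) / 2 := by
  have e1 : ∑ x, w x * f x * (f x - classAvg w r f x) =
      ∑ x, w x * f x ^ 2 - ∑ x, w x * f x * classAvg w r f x := by
    rw [← Finset.sum_sub_distrib]
    exact Finset.sum_congr rfl fun x _ => by ring
  have e2 : ∑ x, ∑ y with r x y, w x * w y / (∑ z with r x z, w z) * f x ^ 2 =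
      ∑ x, w x * f x ^ 2 := by
    refine Finset.sum_congr rfl fun x _ => ?_
    have := (classSum_pos hw hr x).ne'
    rw [← Finset.sum_mul, ← Finset.sum_div, ← Finset.mul_sum]
    field_simp
  have e3 : ∑ x, ∑ y with r x y, w x * w y / (∑ z with r x z, w z) * f y ^ 2 =
      ∑ x, w x * f x ^ 2 := by
    rw [← e2]
    simp only [Finset.sum_filter]
    rw [Finset.sum_comm]
    refine Finset.sum_congr rfl fun x _ => Finset.sum_congr rfl fun y _ => ?_
    by_cases hxy : r x y
    · have h1 := classSum_congr hr hxy w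
      simp only [Finset.sum_filter] at h1
      rw [if_pos hxy, if_pos (hr.symm hxy), h1]
      ring
    · rw [if_neg hxy, if_neg fun h => hxy (hr.symm h)]
  have e4 : ∑ x, ∑ y with r x y, w x * w y / (∑ z with r x z, w z) * (f x - f y) ^ 2 =
      ∑ x, ∑ y with r x y, w x * w y / (∑ z with r x z, w z) * f x ^ 2 +
      ∑ x, ∑ y with r x y, w x * w y / (∑ z with r x z, w z) * f y ^ 2 -
      2 * ∑ x, w x * f x * classAvg w r f x := by
    rw [sum_mul_classAvg]
    simp only [← Finset.sum_filter, Finset.mul_sum, ← Finset.sum_add_distrib,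
      ← Finset.sum_sub_distrib]
    exact Finset.sum_congr rfl fun x _ => Finset.sum_congr rfl fun y _ => by ring
  rw [e1, e4, e2, e3]
  ring

/-- A positive sequence which is log-convex and decays like `ρ ^ t` starts with a drop by `ρ`. -/
theorem drop_of_logConvex {b : ℕ → ℝ} (hb : ∀ t, 0 ≤ b t) (hlog : ∀ t, b (t + 1) ^ 2 ≤ b t * b (t + 2))
    {ρ C : ℝ} (hρ : 0 < ρ) (hdec : ∀ t, b t ≤ C * ρ ^ t) : b 1 ≤ ρ * b 0 := by
  by_contra hn
  rw [not_le] at hn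
  have hb0 : 0 < b 0 := by
    rcases (hb 0).eq_or_lt with h0 | h0
    · have h1 := hlog 0
      rw [← h0] at hn h1
      nlinarith [hb 1]
    · exact h0
  -- Log-convexity makes the successive ratios nondecreasing. A first ratio `s > ρ` would force
  -- growth like `s ^ t`, against the assumed decay.
  set s := b 1 / b 0 with hs
  have hsρ : ρ < s := (lt_div_iff₀ hb0).2 hn
  have hs0 : 0 < s := hρ.trans hsρ
  have hstep : ∀ t, 0 < b t ∧ s * b t ≤ b (t + 1) := by
    intro t
    induction t with
    | zero =>
      refine ⟨hb0, le_of_eq ?_⟩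
      rw [hs]
      field_simp
    | succ t ih =>
      have h1 : 0 < b (t + 1) := (mul_pos hs0 ih.1).trans_le ih.2
      refine ⟨h1, ?_⟩
      have h2 := hlog t
      have h3 : b t * (s * b (t + 1)) ≤ b t * b (t + 2) := by nlinarith
      exact le_of_mul_le_mul_left h3 ih.1
  have hgrow : ∀ t, s ^ t * b 0 ≤ b t := by
    intro t
    induction t with
    | zero => simp
    | succ t ih =>
      calc s ^ (t + 1) * b 0 = s * (s ^ t * b 0) := by ring
        _ ≤ s * b t := mul_le_mul_of_nonneg_left ih hs0.le
        _ ≤ b (t + 1) := (hstep t).2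
  obtain ⟨t, ht⟩ := pow_unbounded_of_one_lt (C / b 0) ((one_lt_div hρ).2 hsρ)
  have h1 := (hgrow t).trans (hdec t)
  rw [div_pow, div_lt_div_iff₀ hb0 (by positivity)] at ht
  linarith

/-- A self-adjoint operator that contracts a Lipschitz seminorm by `ρ` contracts the variance. -/
theorem inner_le_of_lipschitz (hw : ∀ x, 0 < w x) (K : (S → ℝ) → S → ℝ)
    (hK : ∀ f g, ∑ x, w x * f x * K g x = ∑ x, w x * K f x * g x)
    (hmean : ∀ f, ∑ x, w x * f x = 0 → ∑ x, w x * K f x = 0)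
    (R : S → S → Prop) (hR : ∀ x y, Relation.ReflTransGen R x y) {ρ : ℝ} (hρ : 0 < ρ)
    (hlip : ∀ f D, (∀ x y, R x y → |f x - f y| ≤ D) → ∀ x y, R x y → |K f x - K f y| ≤ ρ * D)
    {f : S → ℝ} (hf : ∑ x, w x * f x = 0) :
    ∑ x, w x * f x * K f x ≤ ρ * ∑ x, w x * f x ^ 2 := by
  classical
  -- Path lengths are chosen independently of the function; their total `ℓ` is a crude bound for the
  -- diameter, and only its finiteness matters.
  have hlen : ∀ x y, ∃ l : ℕ, ∀ (g : S → ℝ) (D : ℝ), (∀ x y, R x y → |g x - g y| ≤ D) →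
      |g x - g y| ≤ l * D := by
    intro x y
    induction hR x y with
    | refl => exact ⟨0, fun g D _ => by simp⟩
    | @tail y z _ hyz ih =>
      obtain ⟨l, hl⟩ := ih
      refine ⟨l + 1, fun g D hg => ?_⟩
      have h1 := hl g D hg
      have h2 := hg y z hyz
      have h3 := abs_sub_le (g x) (g y) (g z)
      push_cast
      linarith
  choose l hl using hlen
  set ℓ : ℝ := ∑ x, ∑ y, (l x y : ℝ) with hℓ
  have hℓ' : ∀ x y, (l x y : ℝ) ≤ ℓ := by
    intro x y
    calc (l x y : ℝ) ≤ ∑ y, (l x y : ℝ) :=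
          Finset.single_le_sum (f := fun y => (l x y : ℝ)) (fun _ _ => by positivity)
            (Finset.mem_univ y)
      _ ≤ ℓ := Finset.single_le_sum (f := fun x => ∑ y, (l x y : ℝ)) (fun _ _ => by positivity)
            (Finset.mem_univ x)
  set W := ∑ x, w x with hW
  have hW0 : 0 ≤ W := Finset.sum_nonneg fun x _ => (hw x).le
  have hsup : ∀ (g : S → ℝ) (D : ℝ), 0 ≤ D → (∀ x y, R x y → |g x - g y| ≤ D) →
      ∑ x, w x * g x = 0 → ∑ x, w x * g x ^ 2 ≤ W * (ℓ * D) ^ 2 := by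
    intro g D hD hg hm
    rw [hW, Finset.sum_mul]
    refine Finset.sum_le_sum fun x _ => mul_le_mul_of_nonneg_left ?_ (hw x).le
    have hWpos : 0 < W := Finset.sum_pos (fun x _ => hw x) ⟨x, Finset.mem_univ x⟩
    have h1 : W * g x = ∑ y, w y * (g x - g y) := by
      simp only [mul_sub, Finset.sum_sub_distrib, hm, ← Finset.sum_mul, sub_zero, hW]
    have h2 : |W * g x| ≤ W * (ℓ * D) := by
      rw [h1]
      refine (Finset.abs_sum_le_sum_abs _ _).trans ?_
      rw [hW, Finset.sum_mul]
      refine Finset.sum_le_sum fun y _ => ?_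
      rw [abs_mul, abs_of_pos (hw y)]
      refine mul_le_mul_of_nonneg_left ((hl x y g D hg).trans ?_) (hw y).le
      exact mul_le_mul_of_nonneg_right (hℓ' x y) hD
    rw [abs_mul, abs_of_pos hWpos] at h2
    exact sq_le_sq' (by linarith [neg_abs_le (g x), le_of_mul_le_mul_left h2 hWpos])
      ((le_abs_self _).trans (le_of_mul_le_mul_left h2 hWpos))
  obtain ⟨D, hD0, hD⟩ : ∃ D, 0 ≤ D ∧ ∀ x y, R x y → |f x - f y| ≤ D := by
    refine ⟨∑ x, ∑ y, |f x - f y|, by positivity, fun x y _ => ?_⟩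
    calc |f x - f y| ≤ ∑ y, |f x - f y| :=
          Finset.single_le_sum (f := fun y => |f x - f y|) (fun _ _ => by positivity)
            (Finset.mem_univ y)
      _ ≤ _ := Finset.single_le_sum (f := fun x => ∑ y, |f x - f y|) (fun _ _ => by positivity)
            (Finset.mem_univ x)
  have hiter : ∀ t : ℕ, (∀ x y, R x y → |(K^[t]) f x - (K^[t]) f y| ≤ ρ ^ t * D) ∧
      ∑ x, w x * (K^[t]) f x = 0 := by
    intro t
    induction t with
    | zero => simpa using ⟨hD, hf⟩
    | succ t ih =>
      rw [Function.iterate_succ_apply']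
      refine ⟨fun x y hxy => ?_, hmean _ ih.2⟩
      rw [pow_succ', mul_assoc]
      exact hlip _ _ ih.1 x y hxy
  set b : ℕ → ℝ := fun t => ∑ x, w x * (K^[t]) f x ^ 2 with hb
  have hbn : ∀ t, 0 ≤ b t := fun t =>
    Finset.sum_nonneg fun x _ => mul_nonneg (hw x).le (sq_nonneg _)
  have hcs : ∀ g h : S → ℝ, (∑ x, w x * g x * h x) ^ 2 ≤
      (∑ x, w x * g x ^ 2) * ∑ x, w x * h x ^ 2 := fun g h =>
    Finset.sum_sq_le_sum_mul_sum_of_sq_le_mul _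
      (fun x _ => mul_nonneg (hw x).le (sq_nonneg _))
      (fun x _ => mul_nonneg (hw x).le (sq_nonneg _)) fun x _ => le_of_eq (by ring)
  -- Since `K` is self-adjoint, the square norm of the iterate `t + 1` is the inner product of the
  -- iterates `t` and `t + 2`.
  have hlog : ∀ t, b (t + 1) ^ 2 ≤ b t * b (t + 2) := by
    intro t
    have h1 := hcs ((K^[t]) f) ((K^[t + 2]) f)
    have h2 : ∑ x, w x * (K^[t]) f x * (K^[t + 2]) f x = b (t + 1) := by
      have h3 := hK ((K^[t]) f) ((K^[t + 1]) f)
      rw [Function.iterate_succ_apply' K (t + 1), h3, hb]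
      refine Finset.sum_congr rfl fun x _ => ?_
      rw [← Function.iterate_succ_apply' K t]
      ring
    rw [h2] at h1
    exact h1
  have hdec : ∀ t, b t ≤ (W * (ℓ * D) ^ 2) * (ρ ^ 2) ^ t := by
    intro t
    refine (hsup _ _ (by positivity) (hiter t).1 (hiter t).2).trans (le_of_eq ?_)
    rw [← pow_mul, mul_comm 2 t, pow_mul]
    ring
  have hdrop := drop_of_logConvex hbn hlog (by positivity) hdec
  have hfin := hcs f (K f)
  have e0 : b 0 = ∑ x, w x * f x ^ 2 := rfl
  have e1 : b 1 = ∑ x, w x * K f x ^ 2 := rfl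
  rw [← e0, ← e1] at hfin
  rw [← e0]
  -- By Cauchy–Schwarz the square of the inner product is at most `b 0 * b 1`, and `hdrop` bounds `b
  -- 1` by `ρ ^ 2 * b 0`.
  refine le_of_sq_le_sq ?_ (mul_nonneg hρ.le (hbn 0))
  nlinarith [hbn 0]

/-- Variance is bounded by the sum of the expected conditional variances. -/
theorem variance_le_of_contraction {ι : Type} [Fintype ι] [Nonempty ι] (hw : ∀ x, 0 < w x)
    (r : ι → S → S → Prop) (hr : ∀ i, Equivalence (r i))
    (hconn : ∀ x y, Relation.ReflTransGen (fun x y => ∃ i, r i x y) x y)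
    (hcontr : ∀ (f : S → ℝ) (D : ℝ), 0 ≤ D → (∀ i x y, r i x y → |f x - f y| ≤ D) →
      ∀ j x y, r j x y →
        ∑ i, |classAvg w (r i) f x - classAvg w (r i) f y| ≤ (Fintype.card ι - 1 / 2) * D)
    {f : S → ℝ} (hf : ∑ x, w x * f x = 0) :
    (∑ x, w x * f x ^ 2) / 2 ≤ ∑ i, ∑ x, w x * f x * (f x - classAvg w (r i) f x) := by
  classical
  set N : ℝ := (Fintype.card ι : ℝ) with hN
  have hN1 : 1 ≤ N := by
    rw [hN]
    exact_mod_cast Fintype.card_pos (α := ι)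
  have hN0 : 0 < N := by linarith
  -- `K` averages over a uniformly chosen block. Its Lipschitz contraction by `1 - 1 / (2N)`
  -- becomes, after multiplication by `N`, the factor 1/2 in the conclusion.
  set K : (S → ℝ) → S → ℝ := fun f x => (∑ i, classAvg w (r i) f x) / N with hKdef
  have hKsum : ∀ f g : S → ℝ, ∑ x, w x * f x * K g x =
      (∑ i, ∑ x, w x * f x * classAvg w (r i) g x) / N := by
    intro f g
    simp only [hKdef]
    rw [Finset.sum_comm, Finset.sum_div]
    refine Finset.sum_congr rfl fun x _ => ?_
    rw [← Finset.mul_sum, mul_div_assoc]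
  have hKself : ∀ f g, ∑ x, w x * f x * K g x = ∑ x, w x * K f x * g x := by
    intro f g
    have h1 : ∑ x, w x * K f x * g x = ∑ x, w x * g x * K f x :=
      Finset.sum_congr rfl fun x _ => by ring
    rw [h1, hKsum, hKsum]
    congr 1
    refine Finset.sum_congr rfl fun i _ => ?_
    rw [classAvg_selfAdjoint (hr i)]
    exact Finset.sum_congr rfl fun x _ => by ring
  have hK1 : K (fun _ => 1) = fun _ => 1 := by
    funext x
    simp only [hKdef]
    rw [Finset.sum_congr rfl fun i _ => classAvg_const hw (hr i) 1 x]
    simp only [Finset.sum_const, Finset.card_univ, nsmul_eq_mul, mul_one, ← hN]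
    field_simp
  have hmean : ∀ f, ∑ x, w x * f x = 0 → ∑ x, w x * K f x = 0 := by
    intro f hf
    have h1 := hKself f fun _ => 1
    rw [hK1] at h1
    simp only [mul_one] at h1
    rw [← h1, hf]
  set ρ : ℝ := (N - 1 / 2) / N with hρ
  have hlip : ∀ f D, (∀ x y, (∃ i, r i x y) → |f x - f y| ≤ D) →
      ∀ x y, (∃ i, r i x y) → |K f x - K f y| ≤ ρ * D := by
    rintro f D hD x y ⟨j, hj⟩
    have hD0 : 0 ≤ D := (abs_nonneg _).trans (hD x y ⟨j, hj⟩)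
    have h1 := hcontr f D hD0 (fun i x y h => hD x y ⟨i, h⟩) j x y hj
    simp only [hKdef]
    rw [← sub_div, ← Finset.sum_sub_distrib, abs_div, abs_of_pos hN0, hρ, div_mul_eq_mul_div]
    exact div_le_div_of_nonneg_right ((Finset.abs_sum_le_sum_abs _ _).trans h1) hN0.le
  have hmain := inner_le_of_lipschitz hw K hKself hmean (fun x y => ∃ i, r i x y) hconn
    (by rw [hρ]; exact div_pos (by linarith) hN0) hlip hf
  rw [hKsum, hρ, div_mul_eq_mul_div, div_le_div_iff_of_pos_right hN0] at hmain
  have hsum : ∑ i, ∑ x, w x * f x * (f x - classAvg w (r i) f x) =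
      N * ∑ x, w x * f x ^ 2 - ∑ i, ∑ x, w x * f x * classAvg w (r i) f x := by
    rw [hN, ← nsmul_eq_mul, ← Finset.card_univ, ← Finset.sum_const, ← Finset.sum_sub_distrib]
    refine Finset.sum_congr rfl fun i _ => ?_
    rw [← Finset.sum_sub_distrib]
    exact Finset.sum_congr rfl fun x _ => by ring
  rw [hsum]
  linarith

end Contraction

end OneTwo

namespace OneTwo

/-! ### Gluing configurations along a cut -/

/-- `η` and `ξ` agree on the edges that leave the vertex set `A`. -/
def Agree (A : Set Vert) (η ξ : Set (Sym2 Vert)) : Prop :=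
  ∀ v ∈ A, ∀ d, nbr d v ∉ A → (edgeAt v d ∈ η ↔ edgeAt v d ∈ ξ)

theorem Agree.symm {A : Set Vert} {η ξ : Set (Sym2 Vert)} (h : Agree A η ξ) : Agree A ξ η :=
  fun v hv d hd => (h v hv d hd).symm

theorem Agree.refl (A : Set Vert) (η : Set (Sym2 Vert)) : Agree A η η :=
  fun _ _ _ _ => Iff.rfl

theorem Agree.trans {A : Set Vert} {η ξ ζ : Set (Sym2 Vert)} (h : Agree A η ξ)
    (h' : Agree A ξ ζ) : Agree A η ζ :=
  fun v hv d hd => (h v hv d hd).trans (h' v hv d hd)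

theorem agree_of_sameAt {A : Set Vert} {η ξ : Set (Sym2 Vert)} (h : ∀ v ∈ A, SameAt v η ξ) :
    Agree A η ξ := fun v hv d _ => h v hv d

theorem agree_of_sameAt_compl {A : Set Vert} {η ξ : Set (Sym2 Vert)}
    (h : ∀ v ∉ A, SameAt v η ξ) : Agree A η ξ := fun v _ d hd => by
  have := h _ hd d
  rwa [edgeAt_nbr] at this

/-- `η` on the edges that touch `A`, and `ξ` on the others. -/
def glueSet (A : Set Vert) (η ξ : Set (Sym2 Vert)) : Set (Sym2 Vert) :=
  {e | (e ∈ η ∧ ∃ v ∈ A, v ∈ e) ∨ (e ∈ ξ ∧ ¬ ∃ v ∈ A, v ∈ e)}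

theorem glueSet_sameAt {A : Set Vert} (η ξ : Set (Sym2 Vert)) {v : Vert} (hv : v ∈ A) :
    SameAt v (glueSet A η ξ) η := by
  intro d
  have : ∃ u ∈ A, u ∈ edgeAt v d := ⟨v, hv, Sym2.mem_mk_left _ _⟩
  exact ⟨fun h => h.elim And.left fun h => absurd this h.2, fun h => Or.inl ⟨h, this⟩⟩

theorem glueSet_sameAt_compl {A : Set Vert} {η ξ : Set (Sym2 Vert)} (h : Agree A η ξ) {v : Vert}
    (hv : v ∉ A) : SameAt v (glueSet A η ξ) ξ := by
  intro d
  by_cases hd : nbr d v ∈ A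
  · have h1 := glueSet_sameAt η ξ hd d
    have h2 := h _ hd d (by rwa [nbr_nbr])
    rw [edgeAt_nbr] at h1 h2
    exact h1.trans h2
  · have : ¬ ∃ u ∈ A, u ∈ edgeAt v d := by
      rintro ⟨u, hu, hue⟩
      rcases Sym2.mem_iff.1 hue with rfl | rfl
      · exact hv hu
      · exact hd hu
    exact ⟨fun h => h.elim (fun h => absurd h.2 this) And.left, fun h => Or.inr ⟨h, this⟩⟩

section Glue

variable {Λ : Finset Vert} {bd : Set (Sym2 Vert)}

theorem State.eq_of_sameAt {η ξ : State Λ bd} (h : ∀ v, SameAt v η.1 ξ.1) : η = ξ := by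
  apply Subtype.ext
  ext e
  by_cases he : e ∈ hexLattice.edgeSet
  · obtain ⟨v, d, rfl⟩ := mem_edgeSet.1 he
    exact h v d
  · exact ⟨fun h' => absurd (η.2.1.1 h') he, fun h' => absurd (ξ.2.1.1 h') he⟩

theorem State.sameAt_of_notMem (η ξ : State Λ bd) {v : Vert} (hv : v ∉ Λ) :
    SameAt v η.1 ξ.1 := by
  intro d
  have h1 : edgeAt v d ∉ edges Λ := fun h => hv (edgeAt_mem_edges.1 h).1
  exact (η.2.2 _ (edgeAt_mem_edgeSet v d) h1).trans (ξ.2.2 _ (edgeAt_mem_edgeSet v d) h1).symm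

theorem glueSet_compat {A : Set Vert} (η ξ : State Λ bd) (h : Agree A η.1 ξ.1) :
    Compat Λ bd (glueSet A η.1 ξ.1) := by
  refine Compat.of_sameAt η.2 ξ.2 ?_ fun v => ?_
  · rintro e (⟨he, -⟩ | ⟨he, -⟩)
    · exact η.2.1.1 he
    · exact ξ.2.1.1 he
  · by_cases hv : v ∈ A
    · exact Or.inl (glueSet_sameAt _ _ hv)
    · exact Or.inr (glueSet_sameAt_compl h hv)

open Classical in
/-- The state which is `η` on the edges that touch `A` and `ξ` on the others (if they agree
on the boundary of `A`). -/
noncomputable def glue (A : Set Vert) (η ξ : State Λ bd) : State Λ bd :=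
  if h : Agree A η.1 ξ.1 then ⟨glueSet A η.1 ξ.1, glueSet_compat η ξ h⟩ else η

variable {A : Set Vert} {η ξ : State Λ bd}

theorem glue_val (h : Agree A η.1 ξ.1) : (glue A η ξ).1 = glueSet A η.1 ξ.1 :=
  congrArg Subtype.val (dif_pos h)

theorem glue_sameAt (h : Agree A η.1 ξ.1) {v : Vert} (hv : v ∈ A) :
    SameAt v (glue A η ξ).1 η.1 := by
  rw [glue_val h]
  exact glueSet_sameAt _ _ hv

theorem glue_sameAt_compl (h : Agree A η.1 ξ.1) {v : Vert} (hv : v ∉ A) :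
    SameAt v (glue A η ξ).1 ξ.1 := by
  rw [glue_val h]
  exact glueSet_sameAt_compl h hv

theorem glue_agree (h : Agree A η.1 ξ.1) : Agree A (glue A η ξ).1 η.1 :=
  agree_of_sameAt fun _ hv => glue_sameAt h hv

theorem glue_glue (h : Agree A η.1 ξ.1) : glue A (glue A η ξ) (glue A ξ η) = η := by
  have h1 : Agree A (glue A η ξ).1 (glue A ξ η).1 :=
    (glue_agree h).trans (h.trans (glue_agree h.symm).symm)
  refine State.eq_of_sameAt fun v => ?_
  by_cases hv : v ∈ A
  · exact (glue_sameAt h1 hv).trans (glue_sameAt h hv)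
  · exact (glue_sameAt_compl h1 hv).trans (glue_sameAt_compl h.symm hv)

/-- Each vertex sees in the two glued states the same pair of local configurations as in the two
original ones. -/
theorem weight_glue (a b c : ℝ) (h : Agree A η.1 ξ.1) :
    weight Λ a b c (glue A ξ η).1 * weight Λ a b c (glue A η ξ).1 =
      weight Λ a b c η.1 * weight Λ a b c ξ.1 := by
  unfold weight
  rw [← Finset.prod_mul_distrib, ← Finset.prod_mul_distrib]
  refine Finset.prod_congr rfl fun v _ => ?_
  by_cases hv : v ∈ A
  · rw [(glue_sameAt h hv).localWeight_eq, (glue_sameAt h.symm hv).localWeight_eq, mul_comm]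
  · rw [(glue_sameAt_compl h hv).localWeight_eq, (glue_sameAt_compl h.symm hv).localWeight_eq]

/-- Exchanging the outer parts of a pair is an involution that preserves the product of the weights,
so it may be applied to the integrand. -/
theorem sum_swap (a b c : ℝ) (X : Finset (State Λ bd × State Λ bd))
    (hX : ∀ p ∈ X, Agree A p.1.1 p.2.1 ∧ (glue A p.2 p.1, glue A p.1 p.2) ∈ X)
    (G : State Λ bd → State Λ bd → ℝ) :
    ∑ p ∈ X, weight Λ a b c p.1.1 * weight Λ a b c p.2.1 * G p.1 p.2 =
      ∑ p ∈ X, weight Λ a b c p.1.1 * weight Λ a b c p.2.1 *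
        G (glue A p.2 p.1) (glue A p.1 p.2) := by
  refine Finset.sum_nbij' (fun p => (glue A p.2 p.1, glue A p.1 p.2))
    (fun p => (glue A p.2 p.1, glue A p.1 p.2)) (fun p hp => (hX p hp).2)
    (fun p hp => (hX p hp).2) ?_ ?_ ?_
  · intro p hp
    have h := (hX p hp).1
    simp only [glue_glue h, glue_glue h.symm]
  · intro p hp
    have h := (hX p hp).1
    simp only [glue_glue h, glue_glue h.symm]
  · intro p hp
    have h := (hX p hp).1
    simp only [glue_glue h, glue_glue h.symm, weight_glue a b c h]

end Glue

/-! ### Comparing averages over two classes of states -/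

section Transfer

variable {Λ : Finset Vert} {bd : Set (Sym2 Vert)} {a b c : ℝ}

open Classical in
/-- The weight of the states of `Q` that agree with `ξ` on the boundary of `A`. -/
noncomputable def fiberWeight (a b c : ℝ) (Q : Finset (State Λ bd)) (A : Set Vert)
    (ξ : State Λ bd) : ℝ :=
  ∑ η ∈ Q with Agree A η.1 ξ.1, weight Λ a b c η.1

theorem fiberWeight_congr (Q : Finset (State Λ bd)) {A : Set Vert} {ξ ζ : State Λ bd}
    (h : Agree A ξ.1 ζ.1) : fiberWeight a b c Q A ξ = fiberWeight a b c Q A ζ := by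
  classical
  unfold fiberWeight
  congr 1
  ext η
  simp only [Finset.mem_filter, and_congr_right_iff]
  exact fun _ => ⟨fun h' => h'.trans h, fun h' => h'.trans h.symm⟩

theorem fiberWeight_pos (ha : 0 < a) (hb : 0 < b) (hc : 0 < c) {Q : Finset (State Λ bd)}
    {A : Set Vert} {ξ : State Λ bd} (h : ∃ η ∈ Q, Agree A η.1 ξ.1) :
    0 < fiberWeight a b c Q A ξ := by
  classical
  obtain ⟨η, h1, h2⟩ := h
  exact Finset.sum_pos (fun η _ => weight_pos ha hb hc η.2.1 Λ)
    ⟨η, Finset.mem_filter.2 ⟨h1, h2⟩⟩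

open Classical in
/-- Disintegration of a sum over `Q'` over the boundary values on `A` of the states of `Q`. -/
theorem sum_transfer (ha : 0 < a) (hb : 0 < b) (hc : 0 < c) {Q Q' : Finset (State Λ bd)}
    {A : Set Vert}
    (hglue : ∀ ξ ∈ Q, ∀ ζ ∈ Q', Agree A ξ.1 ζ.1 → glue A ζ ξ ∈ Q ∧ glue A ξ ζ ∈ Q')
    (hex : ∀ ζ ∈ Q', ∃ ξ ∈ Q, Agree A ξ.1 ζ.1) (G : State Λ bd → ℝ) :
    ∑ ζ ∈ Q', weight Λ a b c ζ.1 * G ζ =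
      ∑ ξ ∈ Q, weight Λ a b c ξ.1 / fiberWeight a b c Q A ξ *
        ∑ ζ ∈ Q' with Agree A ξ.1 ζ.1, weight Λ a b c ζ.1 * G (glue A ξ ζ) := by
  set X : Finset (State Λ bd × State Λ bd) :=
    (Q ×ˢ Q').filter fun p => Agree A p.1.1 p.2.1 with hX
  have hsum : ∀ H : State Λ bd → State Λ bd → ℝ, ∑ p ∈ X, H p.1 p.2 =
      ∑ ξ ∈ Q, ∑ ζ ∈ Q' with Agree A ξ.1 ζ.1, H ξ ζ := by
    intro H
    rw [hX, Finset.sum_filter, Finset.sum_product]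
    exact Finset.sum_congr rfl fun ξ _ => (Finset.sum_filter _ _).symm
  -- The right-hand side samples `ξ` from `Q` and `ζ` with the same boundary values from `Q'`. After
  -- the swap the integrand depends on `ζ` only, and the sum over `ξ` cancels `fiberWeight`.
  have hswap := sum_swap (A := A) a b c X (by
    intro p hp
    obtain ⟨h1, h2⟩ := Finset.mem_filter.1 hp
    obtain ⟨h3, h4⟩ := Finset.mem_product.1 h1
    obtain ⟨h5, h6⟩ := hglue _ h3 _ h4 h2
    refine ⟨h2, Finset.mem_filter.2 ⟨Finset.mem_product.2 ⟨h5, h6⟩, ?_⟩⟩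
    exact (glue_agree h2.symm).trans (h2.symm.trans (glue_agree h2).symm))
    (fun ξ ζ => G ζ / fiberWeight a b c Q A ξ)
  have hR : ∑ ξ ∈ Q, weight Λ a b c ξ.1 / fiberWeight a b c Q A ξ *
        ∑ ζ ∈ Q' with Agree A ξ.1 ζ.1, weight Λ a b c ζ.1 * G (glue A ξ ζ) =
      ∑ p ∈ X, weight Λ a b c p.1.1 * weight Λ a b c p.2.1 *
        (G (glue A p.1 p.2) / fiberWeight a b c Q A (glue A p.2 p.1)) := by
    rw [hsum fun ξ ζ => weight Λ a b c ξ.1 * weight Λ a b c ζ.1 *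
        (G (glue A ξ ζ) / fiberWeight a b c Q A (glue A ζ ξ))]
    refine Finset.sum_congr rfl fun ξ _ => ?_
    rw [Finset.mul_sum]
    refine Finset.sum_congr rfl fun ζ hζ => ?_
    have h2 := (Finset.mem_filter.1 hζ).2
    rw [fiberWeight_congr Q ((glue_agree h2.symm).trans h2.symm)]
    ring
  rw [hR, ← hswap, hsum fun ξ ζ => weight Λ a b c ξ.1 * weight Λ a b c ζ.1 *
    (G ζ / fiberWeight a b c Q A ξ)]
  simp only [Finset.sum_filter]
  rw [Finset.sum_comm]
  refine Finset.sum_congr rfl fun ζ hζ => ?_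
  have hpos := fiberWeight_pos ha hb hc (hex ζ hζ)
  rw [← Finset.sum_filter]
  have : ∑ ξ ∈ Q with Agree A ξ.1 ζ.1, weight Λ a b c ξ.1 * weight Λ a b c ζ.1 *
      (G ζ / fiberWeight a b c Q A ξ) =
      ∑ ξ ∈ Q with Agree A ξ.1 ζ.1, weight Λ a b c ξ.1 * (weight Λ a b c ζ.1 *
      (G ζ / fiberWeight a b c Q A ζ)) := by
    refine Finset.sum_congr rfl fun ξ hξ => ?_
    rw [fiberWeight_congr Q (Finset.mem_filter.1 hξ).2]
    ring
  rw [this, ← Finset.sum_mul]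
  change _ = fiberWeight a b c Q A ζ * _
  field_simp

/-- Comparison of the averages over two classes that are coupled by gluing along `A`. -/
theorem average_sub_average_le (ha : 0 < a) (hb : 0 < b) (hc : 0 < c)
    {Q Q' : Finset (State Λ bd)} (hQ : Q.Nonempty) (hQ' : Q'.Nonempty)
    {A : Set Vert} {f : State Λ bd → ℝ} {D ε : ℝ} (hε : 0 ≤ ε)
    (hglue : ∀ ξ ∈ Q, ∀ ζ ∈ Q', Agree A ξ.1 ζ.1 → glue A ζ ξ ∈ Q ∧ glue A ξ ζ ∈ Q')
    (hf : ∀ ξ ∈ Q, ∀ ζ ∈ Q', Agree A ξ.1 ζ.1 → |f ξ - f (glue A ξ ζ)| ≤ D)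
    (hex : ∀ ζ ∈ Q', ∃ ξ ∈ Q, Agree A ξ.1 ζ.1) (hex' : ∀ ξ ∈ Q, ∃ ζ ∈ Q', Agree A ζ.1 ξ.1)
    (hratio : ∀ ξ ∈ Q, ∀ ξ' ∈ Q, fiberWeight a b c Q' A ξ * fiberWeight a b c Q A ξ' ≤
      (1 + ε) * (fiberWeight a b c Q' A ξ' * fiberWeight a b c Q A ξ))
    (hosc : ∀ ζ ∈ Q', ∀ ζ' ∈ Q', |f ζ - f ζ'| ≤ D) :
    (∑ ξ ∈ Q, weight Λ a b c ξ.1 * f ξ) / ∑ ξ ∈ Q, weight Λ a b c ξ.1 -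
      (∑ ξ ∈ Q', weight Λ a b c ξ.1 * f ξ) / ∑ ξ ∈ Q', weight Λ a b c ξ.1 ≤ (1 + ε) * D := by
  classical
  set w : State Λ bd → ℝ := fun ξ => weight Λ a b c ξ.1 with hwdef
  have hw : ∀ ξ, 0 < w ξ := fun ξ => weight_pos ha hb hc ξ.2.1 Λ
  set Z := ∑ ξ ∈ Q, w ξ with hZ
  set Z' := ∑ ξ ∈ Q', w ξ with hZ'
  have hZpos : 0 < Z := Finset.sum_pos (fun ξ _ => hw ξ) hQ
  have hZ'pos : 0 < Z' := Finset.sum_pos (fun ξ _ => hw ξ) hQ'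
  set N := fiberWeight a b c Q A with hN
  set N' := fiberWeight a b c Q' A with hN'
  have hNpos : ∀ ξ ∈ Q, 0 < N ξ := fun ξ hξ => fiberWeight_pos ha hb hc ⟨ξ, hξ, Agree.refl _ _⟩
  have hN'pos : ∀ ξ ∈ Q, 0 < N' ξ := fun ξ hξ => fiberWeight_pos ha hb hc (hex' ξ hξ)
  have hN'eq : ∀ ξ, ∑ ζ ∈ Q' with Agree A ξ.1 ζ.1, w ζ = N' ξ := by
    intro ξ
    rw [hN', fiberWeight]
    congr 1
    ext ζ
    simp only [Finset.mem_filter, and_congr_right_iff]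
    exact fun _ => ⟨Agree.symm, Agree.symm⟩
  -- Subtracting the minimum over `Q'` makes `g` take values in `[0, D]` on `Q'`; the uncoupled part
  -- of the mass then costs at most `ε * D`.
  obtain ⟨ζ₀, hζ₀, hmin⟩ := Finset.exists_min_image Q' f hQ'
  set g : State Λ bd → ℝ := fun ξ => f ξ - f ζ₀ with hg
  have hg0 : ∀ ζ ∈ Q', 0 ≤ g ζ ∧ g ζ ≤ D := fun ζ hζ =>
    ⟨sub_nonneg.2 (hmin ζ hζ), (le_abs_self _).trans (hosc ζ hζ ζ₀ hζ₀)⟩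
  have hshift : ∀ X : Finset (State Λ bd), 0 < ∑ ξ ∈ X, w ξ →
      (∑ ξ ∈ X, w ξ * f ξ) / ∑ ξ ∈ X, w ξ = (∑ ξ ∈ X, w ξ * g ξ) / ∑ ξ ∈ X, w ξ + f ζ₀ := by
    intro X hX
    simp only [hg, mul_sub, Finset.sum_sub_distrib, ← Finset.sum_mul]
    field_simp
    ring
  rw [hshift Q hZpos, hshift Q' hZ'pos, add_sub_add_right_eq_sub]
  have hone : Z' = ∑ ξ ∈ Q, w ξ / N ξ * N' ξ := by
    have := sum_transfer ha hb hc hglue hex fun _ => 1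
    simp only [mul_one] at this
    rw [hZ', this]
    exact Finset.sum_congr rfl fun ξ _ => by rw [hN'eq]
  have htr := sum_transfer ha hb hc hglue hex g
  change ∑ ζ ∈ Q', w ζ * g ζ = ∑ ξ ∈ Q, w ξ / N ξ *
    ∑ ζ ∈ Q' with Agree A ξ.1 ζ.1, w ζ * g (glue A ξ ζ) at htr
  -- This is `hratio` averaged over `Q`: the law of the boundary values under `Q'` is, up to the
  -- factor `1 + ε`, at least the one under `Q`.
  have hlow : ∀ ξ ∈ Q, Z' * N ξ ≤ (1 + ε) * (Z * N' ξ) := by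
    intro ξ hξ
    rw [hone, hZ, Finset.sum_mul, Finset.sum_mul, Finset.mul_sum]
    refine Finset.sum_le_sum fun ξ' hξ' => ?_
    have h1 := hratio ξ' hξ' ξ hξ
    have h2 := hNpos ξ' hξ'
    calc w ξ' / N ξ' * N' ξ' * N ξ = w ξ' / N ξ' * (N' ξ' * N ξ) := by ring
      _ ≤ w ξ' / N ξ' * ((1 + ε) * (N' ξ * N ξ')) :=
          mul_le_mul_of_nonneg_left h1 (div_pos (hw ξ') h2).le
      _ = (1 + ε) * (w ξ' * N' ξ) := by field_simp
  have hpoint : ∀ ξ ∈ Q, w ξ * g ξ * Z' ≤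
      Z * (w ξ / N ξ * ∑ ζ ∈ Q' with Agree A ξ.1 ζ.1, w ζ * g (glue A ξ ζ)) +
        (1 + ε) * D * (w ξ * Z') := by
    intro ξ hξ
    set s := ∑ ζ ∈ Q' with Agree A ξ.1 ζ.1, w ζ * g (glue A ξ ζ) with hs
    have p1 := hNpos ξ hξ
    have p2 := hN'pos ξ hξ
    have hs0 : 0 ≤ s := Finset.sum_nonneg fun ζ hζ => by
      obtain ⟨h1, h2⟩ := Finset.mem_filter.1 hζ
      exact mul_nonneg (hw ζ).le (hg0 _ (hglue ξ hξ ζ h1 h2).2).1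
    have hsD : s ≤ N' ξ * D := by
      rw [← hN'eq, Finset.sum_mul]
      refine Finset.sum_le_sum fun ζ hζ => ?_
      obtain ⟨h1, h2⟩ := Finset.mem_filter.1 hζ
      exact mul_le_mul_of_nonneg_left (hg0 _ (hglue ξ hξ ζ h1 h2).2).2 (hw ζ).le
    have hgs : N' ξ * g ξ ≤ s + N' ξ * D := by
      rw [← hN'eq, hs, Finset.sum_mul, Finset.sum_mul, ← Finset.sum_add_distrib]
      refine Finset.sum_le_sum fun ζ hζ => ?_
      obtain ⟨h1, h2⟩ := Finset.mem_filter.1 hζ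
      have h3 := (le_abs_self _).trans (hf ξ hξ ζ h1 h2)
      have h4 : g ξ ≤ g (glue A ξ ζ) + D := by
        simp only [hg]
        linarith
      rw [← mul_add]
      exact mul_le_mul_of_nonneg_left h4 (hw ζ).le
    have hl := hlow ξ hξ
    -- Replacing `ξ` by a glued state costs `D`. The transferred mass `β` falls short of `Z'` by at
    -- most `ε * Z'`, and `g` averages to `α ≤ D` there; this produces the factor `1 + ε`.
    have h5 : g ξ * Z' ≤ Z * (s / N ξ) + (1 + ε) * D * Z' := by
      set α := s / N' ξ with hα
      have e1 : s = α * N' ξ := by rw [hα]; field_simp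
      have hα0 : 0 ≤ α := by positivity
      have hαD : α ≤ D := by
        rw [hα, div_le_iff₀ p2]
        linarith
      have hgα : g ξ ≤ α + D := by
        have : N' ξ * g ξ ≤ N' ξ * (α + D) := by
          rw [mul_add, mul_comm (N' ξ) α, ← e1]
          exact hgs
        exact le_of_mul_le_mul_left this p2
      have h6 : Z' ≤ (1 + ε) * (Z * (N' ξ / N ξ)) := by
        rw [← mul_div_assoc, ← mul_div_assoc, le_div_iff₀ p1]
        exact hl
      have h7 : Z * (s / N ξ) = α * (Z * (N' ξ / N ξ)) := by
        rw [e1]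
        ring
      rw [h7]
      set β := Z * (N' ξ / N ξ) with hβ
      have h8 : g ξ * Z' ≤ (α + D) * Z' := mul_le_mul_of_nonneg_right hgα hZ'pos.le
      have hβ0 : 0 ≤ β := by positivity
      have h9 : α * (Z' - β) ≤ α * (ε * Z') := by
        refine mul_le_mul_of_nonneg_left ?_ hα0
        by_cases hc : Z' ≤ β
        · nlinarith
        · rw [not_le] at hc
          nlinarith
      have h10 : α * (ε * Z') ≤ D * (ε * Z') :=
        mul_le_mul_of_nonneg_right hαD (by positivity)
      nlinarith
    calc w ξ * g ξ * Z' = w ξ * (g ξ * Z') := by ring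
      _ ≤ w ξ * (Z * (s / N ξ) + (1 + ε) * D * Z') := mul_le_mul_of_nonneg_left h5 (hw ξ).le
      _ = _ := by ring
  have htotal := Finset.sum_le_sum hpoint
  rw [← Finset.sum_mul, Finset.sum_add_distrib, ← Finset.mul_sum, ← htr, ← Finset.mul_sum,
    ← Finset.sum_mul, ← hZ] at htotal
  rw [div_sub_div _ _ hZpos.ne' hZ'pos.ne', div_le_iff₀ (by positivity)]
  linarith

end Transfer

end OneTwo

namespace OneTwo

/-! ### Decay of correlations along a sequence of cuts -/

theorem card_edges_le (Λ : Finset Vert) : (edges Λ).card ≤ 3 * Λ.card := by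
  classical
  have h : edges Λ ⊆ (Λ ×ˢ (Finset.univ : Finset Dir)).image fun p => edgeAt p.1 p.2 := by
    intro e he
    obtain ⟨v, d, rfl⟩ := mem_edgeSet.1 (edges_subset he)
    exact Finset.mem_image.2 ⟨(v, d), Finset.mem_product.2
      ⟨(edgeAt_mem_edges.1 he).1, Finset.mem_univ _⟩, rfl⟩
  refine (Finset.card_le_card h).trans (Finset.card_image_le.trans ?_)
  rw [Finset.card_product, mul_comm]
  exact le_of_eq rfl

/-- The largest ratio of two local weights. -/
noncomputable def weightRatio (a b c : ℝ) : ℝ := max (max a b) c / min (min a b) c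

theorem one_le_weightRatio {a b c : ℝ} (ha : 0 < a) (hb : 0 < b) (hc : 0 < c) :
    1 ≤ weightRatio a b c := by
  rw [weightRatio, one_le_div (lt_min (lt_min ha hb) hc)]
  exact (min_le_right _ _).trans (le_max_right _ _)

theorem weight_le_of_sameAt {a b c : ℝ} (ha : 0 < a) (hb : 0 < b) (hc : 0 < c)
    {Λ S : Finset Vert} {η ζ : Set (Sym2 Vert)} (hη : IsConfig η) (hζ : IsConfig ζ)
    (h : ∀ v ∈ Λ, v ∉ S → SameAt v η ζ) :
    weight Λ a b c η ≤ weightRatio a b c ^ S.card * weight Λ a b c ζ := by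
  classical
  have h1 := one_le_weightRatio ha hb hc
  have hmin : 0 < min (min a b) c := lt_min (lt_min ha hb) hc
  have hle : weight Λ a b c η ≤
      ∏ v ∈ Λ, (if v ∈ S then weightRatio a b c else 1) * localWeight a b c ζ v := by
    refine Finset.prod_le_prod (fun v _ => (localWeight_pos ha hb hc hη v).le) fun v hv => ?_
    split_ifs with hS
    · have h2 := (localWeight_bounds (a := a) (b := b) (c := c) hη v).2
      have h3 := (localWeight_bounds (a := a) (b := b) (c := c) hζ v).1
      calc localWeight a b c η v ≤ max (max a b) c := h2
        _ = weightRatio a b c * min (min a b) c := by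
          rw [weightRatio]
          field_simp
        _ ≤ _ := mul_le_mul_of_nonneg_left h3 (zero_le_one.trans h1)
    · rw [one_mul, (h v hv hS).localWeight_eq]
  refine hle.trans ?_
  rw [Finset.prod_mul_distrib]
  refine mul_le_mul_of_nonneg_right ?_ (weight_pos ha hb hc hζ Λ).le
  rw [Finset.prod_ite, Finset.prod_const, Finset.prod_const_one, mul_one]
  refine pow_le_pow_right₀ h1 (Finset.card_le_card ?_)
  intro v hv
  exact (Finset.mem_filter.1 hv).2

theorem sum_le_of_card_fiber_le {X Y : Type*} [DecidableEq Y] {s : Finset X} {t : Finset Y}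
    {φ : X → Y} {f : X → ℝ} {g : Y → ℝ} {m : ℝ} {K : ℕ} (hφ : ∀ x ∈ s, φ x ∈ t) (hm : 0 ≤ m)
    (hg : ∀ y ∈ t, 0 ≤ g y) (hfg : ∀ x ∈ s, f x ≤ m * g (φ x))
    (hK : ∀ y ∈ t, (s.filter fun x => φ x = y).card ≤ K) :
    ∑ x ∈ s, f x ≤ K * m * ∑ y ∈ t, g y := by
  rw [← Finset.sum_fiberwise_of_maps_to hφ, Finset.mul_sum]
  refine Finset.sum_le_sum fun y hy => ?_
  calc ∑ x ∈ s with φ x = y, f x ≤ ∑ x ∈ s with φ x = y, m * g y := by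
        refine Finset.sum_le_sum fun x hx => ?_
        obtain ⟨h1, rfl⟩ := Finset.mem_filter.1 hx
        exact hfg x h1
    _ = (s.filter fun x => φ x = y).card * (m * g y) := by
        rw [Finset.sum_const, nsmul_eq_mul]
    _ ≤ K * (m * g y) := by
        refine mul_le_mul_of_nonneg_right (by exact_mod_cast hK y hy) (mul_nonneg hm (hg y hy))
    _ = K * m * g y := by ring

section Chain

variable {Λ : Finset Vert} {bd : Set (Sym2 Vert)} {a b c : ℝ}

open Classical in
/-- Every state `η` can be modified in `B \ C` so that it agrees with a given state on the
boundary of `A`. -/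
structure Linked (Λ : Finset Vert) (bd : Set (Sym2 Vert)) (m : ℕ) (B A C : Set Vert) : Prop where
  inner_subset : C ⊆ A
  subset_outer : A ⊆ B
  card_le : (Λ.filter fun v => v ∈ B ∧ v ∉ C).card ≤ m
  exists_state : ∀ η ξ : State Λ bd, ∃ ζ : State Λ bd,
    (∀ v ∉ B, SameAt v ζ.1 η.1) ∧ (∀ v ∈ C, SameAt v ζ.1 η.1) ∧ Agree A ξ.1 ζ.1

open Classical in
/-- The total weight of the pairs that disagree on the boundaries of the first `t` sets. -/
noncomputable def sepWeight (a b c : ℝ) (A : ℕ → Set Vert) (t : ℕ) (P P' : Finset (State Λ bd)) :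
    ℝ :=
  ∑ p ∈ P ×ˢ P' with ∀ s < t, ¬ Agree (A s) p.1.1 p.2.1,
    weight Λ a b c p.1.1 * weight Λ a b c p.2.1

open Classical in
/-- The total weight of the pairs for which the first boundary of agreement is the one of `A t`. -/
noncomputable def meetWeight (a b c : ℝ) (A : ℕ → Set Vert) (t : ℕ) (P P' : Finset (State Λ bd)) :
    ℝ :=
  ∑ p ∈ P ×ˢ P' with (∀ s < t, ¬ Agree (A s) p.1.1 p.2.1) ∧ Agree (A t) p.1.1 p.2.1,
    weight Λ a b c p.1.1 * weight Λ a b c p.2.1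

theorem sepWeight_succ (A : ℕ → Set Vert) (t : ℕ) (P P' : Finset (State Λ bd)) :
    sepWeight a b c A t P P' = meetWeight a b c A t P P' + sepWeight a b c A (t + 1) P P' := by
  classical
  unfold sepWeight meetWeight
  rw [← Finset.sum_filter_add_sum_filter_not _ fun p => Agree (A t) p.1.1 p.2.1,
    Finset.filter_filter, Finset.filter_filter]
  congr 2
  ext p
  simp only [Finset.mem_filter, and_congr_right_iff, Nat.lt_succ_iff_lt_or_eq]
  intro _
  constructor
  · rintro ⟨h1, h2⟩ s (hs | rfl)
    · exact h1 s hs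
    · exact h2
  · exact fun h => ⟨fun s hs => h s (Or.inl hs), h t (Or.inr rfl)⟩

theorem sepWeight_zero (A : ℕ → Set Vert) (P P' : Finset (State Λ bd)) :
    sepWeight a b c A 0 P P' = (∑ η ∈ P, weight Λ a b c η.1) * ∑ η ∈ P', weight Λ a b c η.1 := by
  unfold sepWeight
  rw [Finset.sum_mul_sum, ← Finset.sum_product']
  simp

theorem card_fiber_le {m : ℕ} {B A C : Set Vert} (hl : Linked Λ bd m B A C) (ζ : State Λ bd)
    (X : Finset (State Λ bd))
    (hX : ∀ η ∈ X, (∀ v ∉ B, SameAt v ζ.1 η.1) ∧ (∀ v ∈ C, SameAt v ζ.1 η.1)) :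
    X.card ≤ 8 ^ m := by
  classical
  set S := Λ.filter fun v => v ∈ B ∧ v ∉ C with hS
  have hcard : (edges S).powerset.card ≤ 8 ^ m := by
    rw [Finset.card_powerset]
    calc 2 ^ (edges S).card ≤ 2 ^ (3 * m) := by
          refine Nat.pow_le_pow_right two_pos ((card_edges_le S).trans ?_)
          exact Nat.mul_le_mul_left 3 hl.card_le
      _ = 8 ^ m := by rw [pow_mul]; norm_num
  refine le_trans (Finset.card_le_card_of_injOn (fun η => (edges S).filter fun e => e ∈ η.1)
    (fun η _ => Finset.mem_powerset.2 (Finset.filter_subset _ _)) ?_) hcard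
  intro η hη ξ hξ h
  have hX1 := hX η hη
  have hX2 := hX ξ hξ
  have hsame : ∀ v, v ∉ B ∨ v ∈ C ∨ v ∉ Λ → SameAt v η.1 ξ.1 := by
    rintro v (hv | hv | hv)
    · exact (hX1.1 v hv).symm.trans (hX2.1 v hv)
    · exact (hX1.2 v hv).symm.trans (hX2.2 v hv)
    · exact State.sameAt_of_notMem _ _ hv
  refine State.eq_of_sameAt fun v d => ?_
  by_cases hv : v ∈ S
  · by_cases hu : nbr d v ∈ S
    · have h1 := Finset.ext_iff.1 h (edgeAt v d)
      simpa [edgeAt_mem_edges.2 ⟨hv, hu⟩] using h1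
    · have h2 := hsame (nbr d v) (by
        simp only [hS, Finset.mem_filter] at hu
        tauto) d
      rwa [edgeAt_nbr] at h2
  · exact hsame v (by
      simp only [hS, Finset.mem_filter] at hv
      tauto) d

/-- The second state of a separated pair is modified in `B \ C` so that it agrees with the first on
the boundary of `A t`; earlier boundaries lie outside the change. The weight loses at most
`weightRatio ^ m`, and a modified state has at most `8 ^ m` preimages. -/
theorem sepWeight_le_meetWeight (ha : 0 < a) (hb : 0 < b) (hc : 0 < c) {m t : ℕ}
    {B C : Set Vert} {A : ℕ → Set Vert} {P P' : Finset (State Λ bd)}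
    (hl : Linked Λ bd m B (A t) C) (hBA : ∀ s < t, B ⊆ A s)
    (hP' : ∀ η ∈ P', ∀ ζ : State Λ bd, (∀ v ∉ B, SameAt v ζ.1 η.1) →
      (∀ v ∈ C, SameAt v ζ.1 η.1) → ζ ∈ P') :
    sepWeight a b c A t P P' ≤ (8 * weightRatio a b c) ^ m * meetWeight a b c A t P P' := by
  classical
  choose br hB hC hA using hl.exists_state
  have h1 := one_le_weightRatio ha hb hc
  have key : sepWeight a b c A t P P' ≤
      ((8 ^ m : ℕ) : ℝ) * weightRatio a b c ^ m * meetWeight a b c A t P P' := by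
    refine sum_le_of_card_fiber_le (φ := fun p => (p.1, br p.2 p.1)) ?_ (by positivity) ?_ ?_ ?_
    · intro p hp
      obtain ⟨h2, h3⟩ := Finset.mem_filter.1 hp
      obtain ⟨h4, h5⟩ := Finset.mem_product.1 h2
      refine Finset.mem_filter.2 ⟨Finset.mem_product.2 ⟨h4, hP' _ h5 _ (hB _ _) (hC _ _)⟩,
        fun s hs hag => h3 s hs (hag.trans ?_), hA _ _⟩
      exact agree_of_sameAt_compl fun v hv => hB _ _ v fun hv' => hv (hBA s hs hv')
    · intro p _
      exact (mul_pos (weight_pos ha hb hc p.1.2.1 Λ) (weight_pos ha hb hc p.2.2.1 Λ)).le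
    · intro p _
      have h2 := weight_le_of_sameAt ha hb hc (Λ := Λ)
        (S := Λ.filter fun v => v ∈ B ∧ v ∉ C) p.2.2.1 (br p.2 p.1).2.1 (by
          intro v hv hvS
          by_cases hvB : v ∈ B
          · by_cases hvC : v ∈ C
            · exact (hC _ _ v hvC).symm
            · exact absurd (Finset.mem_filter.2 ⟨hv, hvB, hvC⟩) hvS
          · exact (hB _ _ v hvB).symm)
      have h3 : weight Λ a b c p.2.1 ≤ weightRatio a b c ^ m * weight Λ a b c (br p.2 p.1).1 :=
        h2.trans (mul_le_mul_of_nonneg_right (pow_le_pow_right₀ h1 hl.card_le)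
          (weight_pos ha hb hc (br p.2 p.1).2.1 Λ).le)
      have h4 := mul_le_mul_of_nonneg_left h3 (weight_pos ha hb hc p.1.2.1 Λ).le
      refine h4.trans (le_of_eq ?_)
      ring
    · intro y _
      refine le_trans (Finset.card_le_card_of_injOn Prod.snd (t := Finset.univ.filter fun η =>
        br η y.1 = y.2) ?_ ?_) (card_fiber_le hl y.2 _ ?_)
      · intro p hp
        have := (Finset.mem_filter.1 hp).2
        refine Finset.mem_filter.2 ⟨Finset.mem_univ _, ?_⟩
        rw [← this]
      · intro p hp p' hp' h
        have h2 := (Finset.mem_filter.1 hp).2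
        have h3 := (Finset.mem_filter.1 hp').2
        exact Prod.ext ((congrArg Prod.fst h2).trans (congrArg Prod.fst h3).symm) h
      · intro η hη
        have h2 := (Finset.mem_filter.1 hη).2
        rw [← h2]
        exact ⟨hB _ _, hC _ _⟩
  refine key.trans (le_of_eq ?_)
  push_cast
  rw [mul_pow]

/-- Exchanging the inner parts at the first boundary of agreement leaves all earlier boundaries as
they were, so it is a weight-preserving bijection of the pairs. -/
theorem meetWeight_swap {t : ℕ} {A : ℕ → Set Vert} {P₁ P₁' P₂ P₂' : Finset (State Λ bd)}
    (hA : ∀ s < t, A t ⊆ A s)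
    (h₁ : ∀ η ∈ P₁, ∀ ξ ∈ P₁', Agree (A t) η.1 ξ.1 → glue (A t) ξ η ∈ P₂ ∧ glue (A t) η ξ ∈ P₂')
    (h₂ : ∀ η ∈ P₂, ∀ ξ ∈ P₂', Agree (A t) η.1 ξ.1 →
      glue (A t) ξ η ∈ P₁ ∧ glue (A t) η ξ ∈ P₁') :
    meetWeight a b c A t P₁ P₁' = meetWeight a b c A t P₂ P₂' := by
  classical
  have hmap : ∀ {P P' R R' : Finset (State Λ bd)}, (∀ η ∈ P, ∀ ξ ∈ P', Agree (A t) η.1 ξ.1 →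
      glue (A t) ξ η ∈ R ∧ glue (A t) η ξ ∈ R') → ∀ p ∈ (P ×ˢ P').filter (fun p =>
      (∀ s < t, ¬ Agree (A s) p.1.1 p.2.1) ∧ Agree (A t) p.1.1 p.2.1),
      (glue (A t) p.2 p.1, glue (A t) p.1 p.2) ∈ (R ×ˢ R').filter (fun p =>
      (∀ s < t, ¬ Agree (A s) p.1.1 p.2.1) ∧ Agree (A t) p.1.1 p.2.1) := by
    intro P P' R R' h p hp
    obtain ⟨h1, h2, h3⟩ := Finset.mem_filter.1 hp
    obtain ⟨h4, h5⟩ := Finset.mem_product.1 h1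
    refine Finset.mem_filter.2 ⟨Finset.mem_product.2 (h _ h4 _ h5 h3), fun s hs hag => ?_, ?_⟩
    · refine h2 s hs (Agree.trans ?_ (hag.trans ?_))
      · exact agree_of_sameAt_compl fun v hv =>
          (glue_sameAt_compl h3.symm fun hv' => hv (hA s hs hv')).symm
      · exact agree_of_sameAt_compl fun v hv =>
          glue_sameAt_compl h3 fun hv' => hv (hA s hs hv')
    · exact (glue_agree h3.symm).trans (h3.symm.trans (glue_agree h3).symm)
  refine Finset.sum_nbij' (fun p => (glue (A t) p.2 p.1, glue (A t) p.1 p.2))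
    (fun p => (glue (A t) p.2 p.1, glue (A t) p.1 p.2)) (hmap h₁) (hmap h₂) ?_ ?_ ?_
  · intro p hp
    have h := (Finset.mem_filter.1 hp).2.2
    simp only [glue_glue h, glue_glue h.symm]
  · intro p hp
    have h := (Finset.mem_filter.1 hp).2.2
    simp only [glue_glue h, glue_glue h.symm]
  · intro p hp
    exact (weight_glue a b c (Finset.mem_filter.1 hp).2.2).symm

/-- Decay of correlations: along a chain of linked cuts the influence of the boundary class on the
distribution of the boundary values on `E` becomes small. -/
theorem fiberWeight_ratio_le (ha : 0 < a) (hb : 0 < b) (hc : 0 < c) {m T : ℕ}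
    {A B C : ℕ → Set Vert} {S E : Set Vert} {Q Q' : Finset (State Λ bd)}
    (hl : ∀ s < T, Linked Λ bd m (B s) (A s) (C s)) (hBA : ∀ s < T, ∀ s' < s, B s ⊆ A s')
    (hE : ∀ s < T, E ⊆ C s) (hS : ∀ s < T, B s ⊆ S)
    (hQ : ∀ η ∈ Q, ∀ ξ, ξ ∈ Q ∨ ξ ∈ Q' → ∀ ζ : State Λ bd, (∀ v ∉ S, SameAt v ζ.1 η.1) →
      (∀ v ∈ E, SameAt v ζ.1 ξ.1) → ζ ∈ Q)
    (hQ' : ∀ η ∈ Q', ∀ ξ, ξ ∈ Q ∨ ξ ∈ Q' → ∀ ζ : State Λ bd, (∀ v ∉ S, SameAt v ζ.1 η.1) →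
      (∀ v ∈ E, SameAt v ζ.1 ξ.1) → ζ ∈ Q')
    (hT : (1 - ((8 * weightRatio a b c) ^ m)⁻¹) ^ T ≤ 1 / 5) (ξ ξ' : State Λ bd) :
    fiberWeight a b c Q' E ξ * fiberWeight a b c Q E ξ' ≤
      (1 + 1 / 4) * (fiberWeight a b c Q' E ξ' * fiberWeight a b c Q E ξ) := by
  classical
  have h1 := one_le_weightRatio ha hb hc
  set M := (8 * weightRatio a b c) ^ m with hM
  have hMpos : 1 ≤ M := one_le_pow₀ (by linarith)
  set R : Finset (State Λ bd) → State Λ bd → Finset (State Λ bd) :=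
    fun P χ => P.filter fun η => Agree E η.1 χ.1 with hR
  have hEA : ∀ s < T, E ⊆ A s := fun s hs => (hE s hs).trans (hl s hs).inner_subset
  have hAS : ∀ s < T, A s ⊆ S := fun s hs => (hl s hs).subset_outer.trans (hS s hs)
  have hswap : ∀ t < T, ∀ χ χ' : State Λ bd, ∀ η ∈ R Q' χ, ∀ ζ ∈ R Q χ', Agree (A t) η.1 ζ.1 →
      glue (A t) ζ η ∈ R Q' χ' ∧ glue (A t) η ζ ∈ R Q χ := by
    intro t ht χ χ' η hη ζ hζ hag
    obtain ⟨h2, h3⟩ := Finset.mem_filter.1 hη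
    obtain ⟨h4, h5⟩ := Finset.mem_filter.1 hζ
    have e1 : ∀ v ∈ E, SameAt v (glue (A t) ζ η).1 ζ.1 := fun v hv =>
      glue_sameAt hag.symm (hEA t ht hv)
    have e2 : ∀ v ∈ E, SameAt v (glue (A t) η ζ).1 η.1 := fun v hv =>
      glue_sameAt hag (hEA t ht hv)
    refine ⟨Finset.mem_filter.2 ⟨hQ' η h2 ζ (Or.inl h4) _ ?_ e1,
      (agree_of_sameAt e1).trans h5⟩, Finset.mem_filter.2
      ⟨hQ ζ h4 η (Or.inr h2) _ ?_ e2, (agree_of_sameAt e2).trans h3⟩⟩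
    · exact fun v hv => glue_sameAt_compl hag.symm fun hv' => hv (hAS t ht hv')
    · exact fun v hv => glue_sameAt_compl hag fun hv' => hv (hAS t ht hv')
  -- The pairs `(ξ, ξ')` and `(ξ', ξ)` of inner boundary values lose the same weight at every cut,
  -- so the difference of the separated weights is constant, while these weights decay by `1 - M⁻¹`
  -- per cut.
  have hmain : ∀ t ≤ T,
      sepWeight a b c A t (R Q' ξ) (R Q ξ') - sepWeight a b c A t (R Q' ξ') (R Q ξ) =
        sepWeight a b c A 0 (R Q' ξ) (R Q ξ') - sepWeight a b c A 0 (R Q' ξ') (R Q ξ) ∧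
      sepWeight a b c A t (R Q' ξ) (R Q ξ') ≤
        (1 - M⁻¹) ^ t * sepWeight a b c A 0 (R Q' ξ) (R Q ξ') := by
    intro t
    induction t with
    | zero => simp
    | succ t ih =>
      intro ht
      obtain ⟨ih1, ih2⟩ := ih (by omega)
      have e1 := sepWeight_succ (a := a) (b := b) (c := c) A t (R Q' ξ) (R Q ξ')
      have e2 := sepWeight_succ (a := a) (b := b) (c := c) A t (R Q' ξ') (R Q ξ)
      have e3 : meetWeight a b c A t (R Q' ξ) (R Q ξ') = meetWeight a b c A t (R Q' ξ') (R Q ξ) :=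
        meetWeight_swap (fun s hs => (hl t ht).subset_outer.trans (hBA t ht s hs))
          (hswap t ht _ _) (hswap t ht _ _)
      refine ⟨by linarith, ?_⟩
      have e4 := sepWeight_le_meetWeight ha hb hc (P := R Q' ξ) (P' := R Q ξ') (hl t ht)
        (hBA t ht) (by
          intro η hη ζ h2 h3
          obtain ⟨h4, h5⟩ := Finset.mem_filter.1 hη
          have h6 : ∀ v ∈ E, SameAt v ζ.1 η.1 := fun v hv => h3 v (hE t ht hv)
          exact Finset.mem_filter.2 ⟨hQ η h4 η (Or.inl h4) ζ
            (fun v hv => h2 v fun hv' => hv (hS t ht hv')) h6,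
            (agree_of_sameAt h6).trans h5⟩)
      rw [← hM] at e4
      have e5 : M⁻¹ * sepWeight a b c A t (R Q' ξ) (R Q ξ') ≤
          meetWeight a b c A t (R Q' ξ) (R Q ξ') := by
        rw [inv_mul_le_iff₀ (by linarith)]
        exact e4
      have e6 : (0 : ℝ) ≤ 1 - M⁻¹ := sub_nonneg.2 (inv_le_one_of_one_le₀ hMpos)
      calc sepWeight a b c A (t + 1) (R Q' ξ) (R Q ξ')
          ≤ (1 - M⁻¹) * sepWeight a b c A t (R Q' ξ) (R Q ξ') := by linarith
        _ ≤ (1 - M⁻¹) * ((1 - M⁻¹) ^ t * sepWeight a b c A 0 (R Q' ξ) (R Q ξ')) :=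
          mul_le_mul_of_nonneg_left ih2 e6
        _ = _ := by rw [pow_succ]; ring
  -- With at most 1/5 of the first product still separated, the second is at least 4/5 of it; hence
  -- the factor `1 + 1 / 4`.
  obtain ⟨h2, h3⟩ := hmain T le_rfl
  have hnn : 0 ≤ sepWeight a b c A T (R Q' ξ') (R Q ξ) := Finset.sum_nonneg fun p _ =>
    (mul_pos (weight_pos ha hb hc p.1.2.1 Λ) (weight_pos ha hb hc p.2.2.1 Λ)).le
  have h0 : 0 ≤ sepWeight a b c A 0 (R Q' ξ) (R Q ξ') := Finset.sum_nonneg fun p _ =>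
    (mul_pos (weight_pos ha hb hc p.1.2.1 Λ) (weight_pos ha hb hc p.2.2.1 Λ)).le
  have h4 := mul_le_mul_of_nonneg_right hT h0
  rw [sepWeight_zero] at h2 h3 h4
  rw [sepWeight_zero] at h2
  change _ = fiberWeight a b c Q' E ξ * fiberWeight a b c Q E ξ' -
    fiberWeight a b c Q' E ξ' * fiberWeight a b c Q E ξ at h2
  change _ * (fiberWeight a b c Q' E ξ * fiberWeight a b c Q E ξ') ≤
    1 / 5 * (fiberWeight a b c Q' E ξ * fiberWeight a b c Q E ξ') at h4
  change _ ≤ _ * (fiberWeight a b c Q' E ξ * fiberWeight a b c Q E ξ') at h3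
  linarith

end Chain

end OneTwo

namespace OneTwo

/-! ### Bridges: interpolation in four columns -/

theorem zig_inj {u v : Vert} : zig u = zig v ↔ u = v := by
  constructor
  · intro h
    simp only [zig, Sym2.eq_iff, Prod.ext_iff] at h
    ext <;> omega
  · rintro rfl
    rfl

theorem hor_inj {u v : Vert} : hor u = hor v ↔ u = v := by
  constructor
  · intro h
    simp only [hor, Sym2.eq_iff, Prod.ext_iff] at h
    ext <;> omega
  · rintro rfl
    rfl

theorem zig_ne_hor (u v : Vert) : zig u ≠ hor v := by
  intro h
  simp only [zig, hor, Sym2.eq_iff, Prod.ext_iff] at h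
  omega

/-- The set of edges given by its zigzag edges and its horizontal edges. -/
def ofZigHor (Z H : ℤ → ℤ → Prop) : Set (Sym2 Vert) :=
  {e | (∃ p q, e = zig (p, q) ∧ Z p q) ∨ ∃ p q, IsBlack (p, q) ∧ e = hor (p, q) ∧ H p q}

theorem zig_mem_ofZigHor {Z H : ℤ → ℤ → Prop} {p q : ℤ} : zig (p, q) ∈ ofZigHor Z H ↔ Z p q := by
  constructor
  · rintro (⟨p', q', h, h'⟩ | ⟨p', q', -, h, -⟩)
    · obtain ⟨rfl, rfl⟩ := Prod.ext_iff.1 (zig_inj.1 h)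
      exact h'
    · exact absurd h (zig_ne_hor _ _)
  · exact fun h => Or.inl ⟨p, q, rfl, h⟩

theorem hor_mem_ofZigHor {Z H : ℤ → ℤ → Prop} {p q : ℤ} (hb : IsBlack (p, q)) :
    hor (p, q) ∈ ofZigHor Z H ↔ H p q := by
  constructor
  · rintro (⟨p', q', h, -⟩ | ⟨p', q', -, h, h'⟩)
    · exact absurd h.symm (zig_ne_hor _ _)
    · obtain ⟨rfl, rfl⟩ := Prod.ext_iff.1 (hor_inj.1 h)
      exact h'
  · exact fun h => Or.inr ⟨p, q, hb, rfl, h⟩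

theorem ofZigHor_subset (Z H : ℤ → ℤ → Prop) : ofZigHor Z H ⊆ hexLattice.edgeSet := by
  rintro e (⟨p, q, rfl, -⟩ | ⟨p, q, hb, rfl, -⟩)
  · obtain ⟨d, hd⟩ := zig_eq_edgeAt (p, q)
    rw [hd]
    exact edgeAt_mem_edgeSet _ _
  · exact hor_mem_edgeSet.2 hb

theorem forall_edgeAt {P : Sym2 Vert → Prop} {p q : ℤ} :
    (∀ d, P (edgeAt (p, q) d)) ↔
      P (zig (p, q - 1)) ∧ P (zig (p, q)) ∧ P (edgeAt (p, q) Dir.H) := by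
  classical
  rw [Dir.forall_iff, edgeAt_NW, edgeAt_NE]
  by_cases h : IsBlack (p, q) <;> simp only [h, if_true, if_false] <;> tauto

theorem edgeAt_H_mem_ofZigHor {Z H : ℤ → ℤ → Prop} {p q : ℤ} :
    edgeAt (p, q) Dir.H ∈ ofZigHor Z H ↔
      (IsBlack (p, q) ∧ H p q) ∨ (¬ IsBlack (p, q) ∧ H (p - 1) q) := by
  classical
  rw [edgeAt_H]
  by_cases h : IsBlack (p, q)
  · simp only [h, if_true, hor_mem_ofZigHor h]
    tauto
  · simp only [h, if_false, hor_mem_ofZigHor (isBlack_pred.2 h)]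
    tauto

theorem exists_oddAt_iff_zig {ω : Set (Sym2 Vert)} {p q : ℤ} :
    (∃ d, OddAt ω (p, q) d) ↔ ¬ ((zig (p, q - 1) ∈ ω ↔ zig (p, q) ∈ ω) ∧
      (zig (p, q) ∈ ω ↔ edgeAt (p, q) Dir.H ∈ ω)) := by
  rw [exists_oddAt_iff, ← not_forall_not, ← not_forall_not,
    forall_edgeAt (P := fun e => e ∉ ω), forall_edgeAt (P := fun e => ¬ e ∉ ω)]
  tauto

section Bridge

variable {o : Vert} {k n : ℕ} {bd : Set (Sym2 Vert)}

theorem AgreesOutside.sameAt {Λ : Finset Vert} {bd η ξ : Set (Sym2 Vert)}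
    (h : AgreesOutside Λ bd η) (h' : AgreesOutside Λ bd ξ) {v : Vert} (hv : v ∉ Λ) :
    SameAt v η ξ := by
  intro d
  have h1 : edgeAt v d ∉ edges Λ := fun h => hv (edgeAt_mem_edges.1 h).1
  exact (h _ (edgeAt_mem_edgeSet v d) h1).trans (h' _ (edgeAt_mem_edgeSet v d) h1).symm

/-- Four columns suffice to join an arbitrary set of edges on the left to an arbitrary one on
the right, with all the vertices of the four columns having an odd edge. -/
theorem exists_bridge (hk : 2 ≤ k) {ω η ξ : Set (Sym2 Vert)} (hω : Compat (box o k n) bd ω)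
    (hη : AgreesOutside (box o k n) bd η) (hξ : AgreesOutside (box o k n) bd ξ) {c : ℤ}
    (hc : o.2 ≤ c) (hc' : c + 4 ≤ o.2 + n) (hval : ∀ v : Vert, v.2 < c → ∃ d, OddAt η v d) :
    ∃ ζ : Set (Sym2 Vert), ζ ⊆ hexLattice.edgeSet ∧ AgreesOutside (box o k n) bd ζ ∧
      (∀ v : Vert, v.2 < c → SameAt v ζ η) ∧ (∀ v : Vert, c + 4 ≤ v.2 → SameAt v ζ ξ) ∧
      ∀ v : Vert, v.2 < c + 4 → ∃ d, OddAt ζ v d := by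
  classical
  -- Each row follows an alternating pattern in phase with the left, and from column `s p` on in
  -- phase with the right. Only the vertex at `s p` can see equal zigzag states, and its horizontal
  -- edge must repair this. The last row uses the edge to the row below, in the last two columns;
  -- all other rows use the edge to the row above, in the first two, so no edge serves two defects.
  have hs : ∀ p : ℤ, ∃ s : ℤ, c ≤ s ∧ s < c + 4 ∧
      ((p + 1 < o.1 + k ∧ s < c + 2 ∧ (p + s) % 2 = 0) ∨
        (o.1 + k ≤ p + 1 ∧ c + 2 ≤ s ∧ (p + s) % 2 = 1)) := by
    intro p
    by_cases hp : p + 1 < o.1 + k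
    · by_cases h : (p + c) % 2 = 0
      · exact ⟨c, by omega⟩
      · exact ⟨c + 1, by omega⟩
    · by_cases h : (p + c) % 2 = 1
      · exact ⟨c + 2, by omega⟩
      · exact ⟨c + 3, by omega⟩
  choose s hs1 hs2 hs3 using hs
  set Z : ℤ → ℤ → Prop := fun p q =>
    if q < c ∨ ¬ (o.1 ≤ p ∧ p < o.1 + k) then zig (p, q) ∈ η
    else if q < s p then (zig (p, c - 1) ∈ η ↔ (q - c) % 2 = 1)
    else if q < c + 3 then (zig (p, c + 3) ∈ ξ ↔ (c + 3 - q) % 2 = 0)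
    else zig (p, q) ∈ ξ with hZ
  -- A horizontal edge serves its black end in the first two columns and its white end in the last
  -- two, by taking the state opposite to the zigzag edge on the left of that end.
  set H : ℤ → ℤ → Prop := fun p q =>
    if q < c then hor (p, q) ∈ η
    else if c + 4 ≤ q then hor (p, q) ∈ ξ
    else if o.1 ≤ p ∧ p + 1 < o.1 + k then (if q < c + 2 then ¬ Z p (q - 1) else ¬ Z (p + 1) (q - 1))
    else hor (p, q) ∈ η with hH
  have hZη : ∀ p q, (q < c ∨ ¬ (o.1 ≤ p ∧ p < o.1 + k)) → (Z p q ↔ zig (p, q) ∈ η) := by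
    intro p q h
    simp only [hZ, if_pos h]
  have hout : ∀ p q, ¬ (o.1 ≤ p ∧ p < o.1 + k) → SameAt (p, q) η ξ := by
    intro p q h
    exact hη.sameAt hξ fun h' => h (mem_box.1 h').1
  have hZξ : ∀ p q, c + 3 ≤ q → (Z p q ↔ zig (p, q) ∈ ξ) := by
    intro p q h
    by_cases hp : o.1 ≤ p ∧ p < o.1 + k
    · have := hs2 p
      simp only [hZ]
      rw [if_neg (by omega), if_neg (by omega), if_neg (by omega)]
    · rw [hZη p q (Or.inr hp)]
      obtain ⟨d, hd⟩ := zig_eq_edgeAt (p, q)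
      rw [hd]
      exact hout p q hp d
  have hZl : ∀ p q, o.1 ≤ p ∧ p < o.1 + k → c - 1 ≤ q → q < s p →
      (Z p q ↔ (zig (p, c - 1) ∈ η ↔ (q - c) % 2 = 1)) := by
    intro p q hp h1 h2
    rcases h1.eq_or_lt with rfl | h1
    · rw [hZη _ _ (Or.inl (by omega))]
      have : (c - 1 - c) % 2 = 1 := by omega
      tauto
    · simp only [hZ]
      rw [if_neg (by omega), if_pos h2]
  have hZr : ∀ p q, o.1 ≤ p ∧ p < o.1 + k → s p ≤ q → q ≤ c + 3 →
      (Z p q ↔ (zig (p, c + 3) ∈ ξ ↔ (c + 3 - q) % 2 = 0)) := by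
    intro p q hp h1 h2
    have := hs1 p
    rcases h2.eq_or_lt with rfl | h2
    · rw [hZξ _ _ le_rfl]
      have : (c + 3 - (c + 3)) % 2 = 0 := by omega
      tauto
    · simp only [hZ]
      rw [if_neg (by omega), if_neg (by omega), if_pos h2]
  have hblack : ∀ p q : ℤ, IsBlack (p, q) ↔ (p + q) % 2 = 0 := fun p q => Int.even_iff
  have hsameη : ∀ p q, (q < c ∨ (q < c + 4 ∧ ¬ (o.1 ≤ p ∧ p < o.1 + k))) →
      SameAt (p, q) (ofZigHor Z H) η := by
    intro p q h
    refine forall_edgeAt (P := fun e => e ∈ ofZigHor Z H ↔ e ∈ η) |>.2 ⟨?_, ?_, ?_⟩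
    · rw [zig_mem_ofZigHor, hZη _ _ (by omega)]
    · rw [zig_mem_ofZigHor, hZη _ _ (by omega)]
    · rw [edgeAt_H_mem_ofZigHor, edgeAt_H]
      by_cases hb : IsBlack (p, q)
      · simp only [hb, true_and, not_true, false_and, or_false, if_true, hH]
        split_ifs
        · rfl
        all_goals first | omega | rfl
      · simp only [hb, true_and, not_false_iff, false_and, false_or, if_false, hH]
        split_ifs
        · rfl
        all_goals first | omega | rfl
  have hsameξ : ∀ p q, c + 4 ≤ q → SameAt (p, q) (ofZigHor Z H) ξ := by
    intro p q h
    refine forall_edgeAt (P := fun e => e ∈ ofZigHor Z H ↔ e ∈ ξ) |>.2 ⟨?_, ?_, ?_⟩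
    · rw [zig_mem_ofZigHor, hZξ _ _ (by omega)]
    · rw [zig_mem_ofZigHor, hZξ _ _ (by omega)]
    · rw [edgeAt_H_mem_ofZigHor, edgeAt_H]
      have h1 : ¬ q < c := by omega
      by_cases hb : IsBlack (p, q)
      · simp only [hb, true_and, not_true, false_and, or_false, if_true, hH, if_neg h1, if_pos h]
      · simp only [hb, true_and, not_false_iff, false_and, false_or, if_false, hH, if_neg h1,
          if_pos h]
  refine ⟨ofZigHor Z H, ofZigHor_subset _ _, ?_, fun v hv => hsameη v.1 v.2 (Or.inl hv),
    fun v hv => hsameξ v.1 v.2 hv, ?_⟩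
  · have hsame : ∀ v, v ∉ box o k n → SameAt v (ofZigHor Z H) η := by
      rintro ⟨p, q⟩ hv
      by_cases h : c + 4 ≤ q
      · exact (hsameξ p q h).trans (hξ.sameAt hη hv)
      · refine hsameη p q ?_
        rw [mem_box] at hv
        simp only at hv
        omega
    intro e he heΛ
    obtain ⟨v, d, rfl⟩ := mem_edgeSet.1 he
    rw [edgeAt_mem_edges, not_and_or] at heΛ
    refine Iff.trans ?_ (hη _ he (fun h => heΛ.elim (fun h' => h' (edgeAt_mem_edges.1 h).1)
      fun h' => h' (edgeAt_mem_edges.1 h).2))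
    rcases heΛ with h | h
    · exact hsame v h d
    · rw [← edgeAt_nbr]
      exact hsame _ h d
  · rintro ⟨p, q⟩ hq
    simp only at hq
    by_cases hqc : q < c
    · obtain ⟨d, hd⟩ := hval (p, q) hqc
      exact ⟨d, ((hsameη p q (Or.inl hqc)).oddAt_iff d).2 hd⟩
    by_cases hp : o.1 ≤ p ∧ p < o.1 + k
    · rw [exists_oddAt_iff_zig, zig_mem_ofZigHor, zig_mem_ofZigHor, edgeAt_H_mem_ofZigHor]
      rcases lt_trichotomy q (s p) with h | h | h
      · rw [hZl p q hp (by omega) h, hZl p (q - 1) hp (by omega) (by omega)]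
        have : (q - 1 - c) % 2 = 1 ↔ ¬ (q - c) % 2 = 1 := by omega
        tauto
      · subst h
        rcases hs3 p with ⟨h1, h2, h3⟩ | ⟨h1, h2, h3⟩
        · have hb : IsBlack (p, s p) := (hblack _ _).2 h3
          have : H p (s p) ↔ ¬ Z p (s p - 1) := by
            simp only [hH]
            rw [if_neg (by omega), if_neg (by omega), if_pos (by omega), if_pos h2]
          tauto
        · have hb : ¬ IsBlack (p, s p) := by rw [hblack]; omega
          have : H (p - 1) (s p) ↔ ¬ Z p (s p - 1) := by
            simp only [hH]
            rw [if_neg (by omega), if_neg (by omega), if_pos (by omega), if_neg (by omega),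
              sub_add_cancel]
          tauto
      · rw [hZr p q hp h.le (by omega), hZr p (q - 1) hp (by omega) (by omega)]
        have : (c + 3 - (q - 1)) % 2 = 0 ↔ ¬ (c + 3 - q) % 2 = 0 := by omega
        tauto
    · obtain ⟨d, hd⟩ := hω.1.exists_oddAt (p, q)
      have h1 : SameAt (p, q) η ω := hη.sameAt hω.2 fun h' => hp (mem_box.1 h').1
      exact ⟨d, (((hsameη p q (Or.inr ⟨hq, hp⟩)).trans h1).oddAt_iff d).2 hd⟩

theorem State.exists_bridge (hk : 2 ≤ k) (η ξ : State (box o k n) bd) {c : ℤ} (hc : o.2 ≤ c)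
    (hc' : c + 4 ≤ o.2 + n) : ∃ ζ : State (box o k n) bd,
      (∀ v : Vert, v.2 < c → SameAt v ζ.1 η.1) ∧ ∀ v : Vert, c + 4 ≤ v.2 → SameAt v ζ.1 ξ.1 := by
  obtain ⟨ζ, h1, h2, h3, h4, h5⟩ := OneTwo.exists_bridge hk η.2 η.2.2 ξ.2.2 hc hc'
    fun v _ => η.2.1.exists_oddAt v
  refine ⟨⟨ζ, isConfig_iff.2 ⟨h1, fun v => ?_⟩, h2⟩, h3, h4⟩
  by_cases hv : v.2 < c + 4
  · exact h5 v hv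
  · obtain ⟨d, hd⟩ := ξ.2.1.exists_oddAt v
    exact ⟨d, ((h4 v (not_lt.1 hv)).oddAt_iff d).2 hd⟩

theorem card_columns_le {o : Vert} {k n : ℕ} {c : ℤ} {S : Finset Vert} (hS : S ⊆ box o k n)
    (hc : ∀ v ∈ S, c ≤ v.2 ∧ v.2 < c + 8) : S.card ≤ 8 * k := by
  have h : S ⊆ Finset.Ico o.1 (o.1 + k) ×ˢ Finset.Ico c (c + 8) := by
    intro v hv
    have h1 := hS hv
    rw [mem_box] at h1
    simp only [Finset.mem_product, Finset.mem_Ico]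
    exact ⟨h1.1, hc v hv⟩
  refine (Finset.card_le_card h).trans (le_of_eq ?_)
  simp [mul_comm]

/-- Two consecutive bridges, from `η` to `ξ` and back to `η`, change eight columns only and make the
state agree with `ξ` across the cut between them. -/
theorem linked_right (hk : 2 ≤ k) {c : ℤ} (hc : o.2 ≤ c) (hc' : c + 8 ≤ o.2 + n) :
    Linked (box o k n) bd (8 * k) {v | c ≤ v.2} {v | c + 4 ≤ v.2} {v | c + 8 ≤ v.2} where
  inner_subset v (hv : c + 8 ≤ v.2) := show c + 4 ≤ v.2 by omega
  subset_outer v (hv : c + 4 ≤ v.2) := show c ≤ v.2 by omega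
  card_le := by
    refine card_columns_le (o := o) (n := n) (c := c) (fun v hv => ?_) fun v hv => ?_ <;>
      simp only [Finset.mem_filter] at hv
    · exact hv.1
    obtain ⟨-, h1, h2⟩ := hv
    change c ≤ v.2 at h1
    change ¬ c + 8 ≤ v.2 at h2
    exact ⟨h1, not_le.1 h2⟩
  exists_state η ξ := by
    obtain ⟨ζ₁, h1, h2⟩ := State.exists_bridge hk η ξ hc (by omega)
    obtain ⟨ζ₂, h3, h4⟩ := State.exists_bridge hk ζ₁ η (c := c + 4) (by omega) (by omega)
    refine ⟨ζ₂, fun v hv => ?_, fun v hv => ?_, ?_⟩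
    · have hv : ¬ c ≤ v.2 := hv
      exact (h3 v (by omega)).trans (h1 v (by omega))
    · have hv : c + 8 ≤ v.2 := hv
      exact h4 v (by omega)
    · refine (agree_of_sameAt (ξ := ζ₁.1) fun v hv => ?_).trans
        (agree_of_sameAt_compl fun v hv => ?_)
      · exact (h2 v hv).symm
      · have hv : ¬ c + 4 ≤ v.2 := hv
        exact (h3 v (by omega)).symm

theorem linked_left (hk : 2 ≤ k) {c : ℤ} (hc : o.2 ≤ c) (hc' : c + 8 ≤ o.2 + n) :
    Linked (box o k n) bd (8 * k) {v | v.2 < c + 8} {v | v.2 < c + 4} {v | v.2 < c} where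
  inner_subset v (hv : v.2 < c) := show v.2 < c + 4 by omega
  subset_outer v (hv : v.2 < c + 4) := show v.2 < c + 8 by omega
  card_le := by
    refine card_columns_le (o := o) (n := n) (c := c) (fun v hv => ?_) fun v hv => ?_ <;>
      simp only [Finset.mem_filter] at hv
    · exact hv.1
    obtain ⟨-, h1, h2⟩ := hv
    change v.2 < c + 8 at h1
    change ¬ v.2 < c at h2
    exact ⟨not_lt.1 h2, h1⟩
  exists_state η ξ := by
    obtain ⟨ζ₁, h1, h2⟩ := State.exists_bridge hk ξ η (c := c + 4) (by omega) (by omega)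
    obtain ⟨ζ₂, h3, h4⟩ := State.exists_bridge hk η ζ₁ hc (by omega)
    refine ⟨ζ₂, fun v hv => ?_, fun v hv => ?_, ?_⟩
    · have hv : ¬ v.2 < c + 8 := hv
      exact (h4 v (by omega)).trans (h2 v (by omega))
    · exact h3 v hv
    · refine (agree_of_sameAt (ξ := ζ₁.1) fun v hv => ?_).trans
        (agree_of_sameAt_compl fun v hv => ?_)
      · exact (h1 v hv).symm
      · have hv : ¬ v.2 < c + 4 := hv
        exact (h4 v (by omega)).symm

end Bridge

end OneTwo

namespace OneTwo

/-! ### Influence of one window on the average over another -/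

section Local

variable {Λ : Finset Vert} {bd : Set (Sym2 Vert)} {a b c : ℝ}

/-- The two states differ only inside `X`. -/
def SameOff (X : Finset Vert) (η ξ : State Λ bd) : Prop := ∀ e ∉ edges X, (e ∈ η.1 ↔ e ∈ ξ.1)

theorem sameOff_equivalence (X : Finset Vert) :
    Equivalence (SameOff X : State Λ bd → State Λ bd → Prop) where
  refl _ _ _ := Iff.rfl
  symm h e he := (h e he).symm
  trans h h' e he := (h e he).trans (h' e he)

theorem sameOff_of_edgeAt {X : Finset Vert} {η ξ : State Λ bd}
    (h : ∀ v d, (v ∉ X ∨ nbr d v ∉ X) → (edgeAt v d ∈ η.1 ↔ edgeAt v d ∈ ξ.1)) :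
    SameOff X η ξ := by
  intro e he
  by_cases hE : e ∈ hexLattice.edgeSet
  · obtain ⟨v, d, rfl⟩ := mem_edgeSet.1 hE
    rw [edgeAt_mem_edges, not_and_or] at he
    exact h v d he
  · exact ⟨fun h' => absurd (η.2.1.1 h') hE, fun h' => absurd (ξ.2.1.1 h') hE⟩

theorem SameOff.edgeAt_iff {X : Finset Vert} {η ξ : State Λ bd} (h : SameOff X η ξ) {v : Vert}
    {d : Dir} (hv : v ∉ X ∨ nbr d v ∉ X) : edgeAt v d ∈ η.1 ↔ edgeAt v d ∈ ξ.1 :=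
  h _ fun h' => hv.elim (fun h1 => h1 (edgeAt_mem_edges.1 h').1)
    fun h1 => h1 (edgeAt_mem_edges.1 h').2

theorem glue_sameOff {A : Set Vert} {Y : Finset Vert} {ξ ζ : State Λ bd} (h : Agree A ξ.1 ζ.1)
    (hY : ∀ v d, v ∉ A → nbr d v ∉ A → (v ∉ Y ∨ nbr d v ∉ Y) →
      (edgeAt v d ∈ ξ.1 ↔ edgeAt v d ∈ ζ.1)) : SameOff Y ξ (glue A ξ ζ) := by
  refine sameOff_of_edgeAt fun v d hvd => ?_
  by_cases hv : v ∈ A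
  · exact (glue_sameAt h hv d).symm
  · by_cases hu : nbr d v ∈ A
    · have := glue_sameAt h hu d
      rw [edgeAt_nbr] at this
      exact this.symm
    · exact (hY v d hv hu hvd).trans (glue_sameAt_compl h hv d).symm

/-- A change in `Y` alters no edge that touches `X`, so both averages run over the same inner
configurations and can be coupled exactly; gluing along `X` transports one class to the other
without loss. -/
theorem classAvg_sub_le_of_disjoint (ha : 0 < a) (hb : 0 < b) (hc : 0 < c) {X Y : Finset Vert}
    (hXY : ∀ v ∈ X, v ∉ Y) {f : State Λ bd → ℝ} {D : ℝ}
    (hX : ∀ η ξ, SameOff X η ξ → |f η - f ξ| ≤ D) (hY : ∀ η ξ, SameOff Y η ξ → |f η - f ξ| ≤ D)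
    {x y : State Λ bd} (hxy : SameOff Y x y) :
    classAvg (fun ξ => weight Λ a b c ξ.1) (SameOff X) f x -
      classAvg (fun ξ => weight Λ a b c ξ.1) (SameOff X) f y ≤ D := by
  classical
  have hE : ∀ z : State Λ bd, ∀ ξ, SameOff X z ξ → Agree (X : Set Vert) ξ.1 z.1 :=
    fun z ξ hξ v _ d hd => ((hξ.edgeAt_iff (Or.inr hd)).symm)
  have hag : Agree (X : Set Vert) x.1 y.1 := fun v hv d _ => hxy.edgeAt_iff (Or.inl (hXY v hv))
  have hglue : ∀ z ξ ζ : State Λ bd, SameOff X z ξ → Agree (X : Set Vert) ζ.1 ξ.1 →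
      SameOff X z (glue X ζ ξ) := by
    intro z ξ ζ hξ h
    refine sameOff_of_edgeAt fun v d hvd => (hξ.edgeAt_iff hvd).trans ?_
    rcases hvd with hv | hv
    · exact (glue_sameAt_compl h hv d).symm
    · have := glue_sameAt_compl h hv d
      rw [edgeAt_nbr] at this
      exact this.symm
  have key := average_sub_average_le (ε := 0) ha hb hc (D := D) (f := f) (A := X)
    (Q := Finset.univ.filter fun ξ => SameOff X x ξ)
    (Q' := Finset.univ.filter fun ξ => SameOff X y ξ)
    ⟨x, Finset.mem_filter.2 ⟨Finset.mem_univ _, (sameOff_equivalence X).refl x⟩⟩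
    ⟨y, Finset.mem_filter.2 ⟨Finset.mem_univ _, (sameOff_equivalence X).refl y⟩⟩ le_rfl
    (by
      intro ξ hξ ζ hζ h
      simp only [Finset.mem_filter, Finset.mem_univ, true_and] at hξ hζ ⊢
      exact ⟨hglue _ _ _ hξ h.symm, hglue _ _ _ hζ h⟩)
    (by
      intro ξ hξ ζ hζ h
      simp only [Finset.mem_filter, Finset.mem_univ, true_and] at hξ hζ
      refine hY _ _ (glue_sameOff h fun v d hv hu hvd => ?_)
      exact (hξ.edgeAt_iff (Or.inl hv)).symm.trans
        ((hxy.edgeAt_iff hvd).trans (hζ.edgeAt_iff (Or.inl hv))))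
    (by
      intro ζ hζ
      simp only [Finset.mem_filter, Finset.mem_univ, true_and] at hζ ⊢
      exact ⟨x, (sameOff_equivalence X).refl x, hag.trans (hE _ _ hζ).symm⟩)
    (by
      intro ξ hξ
      simp only [Finset.mem_filter, Finset.mem_univ, true_and] at hξ ⊢
      exact ⟨y, (sameOff_equivalence X).refl y, hag.symm.trans (hE _ _ hξ).symm⟩)
    (by
      intro ξ hξ ξ' hξ'
      simp only [Finset.mem_filter, Finset.mem_univ, true_and] at hξ hξ'
      have h1 : Agree (X : Set Vert) ξ.1 ξ'.1 := (hE _ _ hξ).trans (hE _ _ hξ').symm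
      rw [fiberWeight_congr _ h1, fiberWeight_congr _ h1]
      linarith)
    (by
      intro ζ hζ ζ' hζ'
      simp only [Finset.mem_filter, Finset.mem_univ, true_and] at hζ hζ'
      exact hX _ _ ((sameOff_equivalence X).trans ((sameOff_equivalence X).symm hζ) hζ'))
  rw [add_zero, one_mul] at key
  exact key

/-- The states are coupled on `E`, the side of the overlap away from `Y`. Coupled states differ only
inside `Y`, which costs `D`; decay of correlations across `S \ E` makes the laws of the boundary
values on `E` comparable up to 5/4. -/
theorem classAvg_sub_le_of_overlap (ha : 0 < a) (hb : 0 < b) (hc : 0 < c) {m T : ℕ}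
    {A B C : ℕ → Set Vert} {S E : Set Vert} {X Y : Finset Vert}
    (hl : ∀ s < T, Linked Λ bd m (B s) (A s) (C s)) (hBA : ∀ s < T, ∀ s' < s, B s ⊆ A s')
    (hE : ∀ s < T, E ⊆ C s) (hS : ∀ s < T, B s ⊆ S) (hES : E ⊆ S)
    (hbr : ∀ η ξ : State Λ bd, ∃ ζ : State Λ bd,
      (∀ v ∉ S, SameAt v ζ.1 η.1) ∧ ∀ v ∈ E, SameAt v ζ.1 ξ.1)
    (hT : (1 - ((8 * weightRatio a b c) ^ m)⁻¹) ^ T ≤ 1 / 5)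
    (hSX : ∀ v ∈ Λ, v ∈ S → v ∉ E → v ∈ X) (hYE : ∀ v ∈ Y, v ∉ E)
    (hXY : ∀ v ∈ X, v ∉ E → v ∈ Y) {f : State Λ bd → ℝ} {D : ℝ}
    (hX : ∀ η ξ, SameOff X η ξ → |f η - f ξ| ≤ D) (hY : ∀ η ξ, SameOff Y η ξ → |f η - f ξ| ≤ D)
    {x y : State Λ bd} (hxy : SameOff Y x y) :
    classAvg (fun ξ => weight Λ a b c ξ.1) (SameOff X) f x -
      classAvg (fun ξ => weight Λ a b c ξ.1) (SameOff X) f y ≤ (1 + 1 / 4) * D := by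
  classical
  -- The classes of `x` and `y` prescribe the same edges near `E`, because `E` avoids `Y`. This is
  -- why parts on `E` may be moved from one class to the other.
  have hclose : ∀ z z' η ξ ζ : State Λ bd, SameOff Y z' z → SameOff X z η → SameOff X z' ξ →
      (∀ v ∉ S, SameAt v ζ.1 η.1) → (∀ v ∈ E, SameAt v ζ.1 ξ.1) → SameOff X z ζ := by
    intro z z' η ξ ζ hz hη hξ h1 h2
    have hvE : ∀ v d, v ∈ E → (v ∉ X ∨ nbr d v ∉ X) →
        (edgeAt v d ∈ z.1 ↔ edgeAt v d ∈ ζ.1) := by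
      intro v d hv hvd
      exact (hz.edgeAt_iff (Or.inl fun h => hYE v h hv)).symm.trans
        ((hξ.edgeAt_iff hvd).trans (h2 v hv d).symm)
    refine sameOff_of_edgeAt fun v d hvd => ?_
    by_cases hv : v ∈ E
    · exact hvE v d hv hvd
    by_cases hu : nbr d v ∈ E
    · have := hvE (nbr d v) d hu (by rw [nbr_nbr]; exact hvd.symm)
      rwa [edgeAt_nbr] at this
    refine (hη.edgeAt_iff hvd).trans ?_
    have hor : v ∉ S ∨ nbr d v ∉ S ∨ v ∉ Λ ∨ nbr d v ∉ Λ := by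
      by_contra hn
      simp only [not_or, not_not] at hn
      obtain ⟨e1, e2, e3, e4⟩ := hn
      exact hvd.elim (fun h => h (hSX v e3 e1 hv)) fun h => h (hSX _ e4 e2 hu)
    have hsame : ∀ u, u ∉ S ∨ u ∉ Λ → SameAt u η.1 ζ.1 := by
      rintro u (h | h)
      · exact (h1 u h).symm
      · exact State.sameAt_of_notMem _ _ h
    by_cases hvs : v ∉ S ∨ v ∉ Λ
    · exact hsame v hvs d
    · have := hsame (nbr d v) (by tauto) d
      rwa [edgeAt_nbr] at this
  set Q : State Λ bd → Finset (State Λ bd) := fun z => Finset.univ.filter fun ξ => SameOff X z ξ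
    with hQdef
  have hmem : ∀ z ξ, ξ ∈ Q z ↔ SameOff X z ξ := by
    intro z ξ
    simp only [hQdef, Finset.mem_filter, Finset.mem_univ, true_and]
  have hrefl : ∀ z : State Λ bd, SameOff Y z z := (sameOff_equivalence Y).refl
  have hQ : ∀ z z', SameOff Y z' z → ∀ η ∈ Q z, ∀ ξ, ξ ∈ Q z ∨ ξ ∈ Q z' → ∀ ζ : State Λ bd,
      (∀ v ∉ S, SameAt v ζ.1 η.1) → (∀ v ∈ E, SameAt v ζ.1 ξ.1) → ζ ∈ Q z := by
    intro z z' hz η hη ξ hξ ζ h1 h2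
    simp only [hmem] at hη hξ ⊢
    rcases hξ with hξ | hξ
    · exact hclose z z η ξ ζ (hrefl z) hη hξ h1 h2
    · exact hclose z z' η ξ ζ hz hη hξ h1 h2
  have hyx := (sameOff_equivalence Y).symm hxy
  have hex : ∀ z z', SameOff Y z' z → ∀ ζ ∈ Q z', ∃ ξ ∈ Q z, Agree E ξ.1 ζ.1 := by
    intro z z' hz ζ hζ
    obtain ⟨ξ, h1, h2⟩ := hbr z ζ
    exact ⟨ξ, hQ z z' hz z ((hmem _ _).2 ((sameOff_equivalence X).refl z)) ζ (Or.inr hζ) ξ h1 h2,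
      agree_of_sameAt h2⟩
  have hg : ∀ z z', SameOff Y z' z → ∀ ξ ∈ Q z, ∀ ζ ∈ Q z', Agree E ζ.1 ξ.1 →
      glue E ζ ξ ∈ Q z := by
    intro z z' hz ξ hξ ζ hζ h
    exact hQ z z' hz ξ hξ ζ (Or.inr hζ) _ (fun v hv => glue_sameAt_compl h fun h' => hv (hES h'))
      fun v hv => glue_sameAt h hv
  exact average_sub_average_le (Q := Q x) (Q' := Q y) (A := E) ha hb hc
    ⟨x, (hmem _ _).2 ((sameOff_equivalence X).refl x)⟩
    ⟨y, (hmem _ _).2 ((sameOff_equivalence X).refl y)⟩ (by norm_num)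
    (fun ξ hξ ζ hζ h => ⟨hg x y hyx ξ hξ ζ hζ h.symm, hg y x hxy ζ hζ ξ hξ h⟩)
    (by
      intro ξ hξ ζ hζ h
      rw [hmem] at hξ hζ
      refine hY _ _ (glue_sameOff h fun v d hv hu hvd => ?_)
      have hvd' : v ∉ X ∨ nbr d v ∉ X :=
        hvd.imp (fun h' h'' => h' (hXY _ h'' hv)) fun h' h'' => h' (hXY _ h'' hu)
      exact (hξ.edgeAt_iff hvd').symm.trans
        ((hxy.edgeAt_iff hvd).trans (hζ.edgeAt_iff hvd')))
    (hex x y hyx)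
    (hex y x hxy)
    (fun ξ _ ξ' _ => fiberWeight_ratio_le ha hb hc hl hBA hE hS (hQ x y hyx)
      (fun η hη ξ hξ => hQ y x hxy η hη ξ hξ.symm) hT ξ ξ')
    (by
      intro ζ hζ ζ' hζ'
      rw [hmem] at hζ hζ'
      exact hX _ _ ((sameOff_equivalence X).trans ((sameOff_equivalence X).symm hζ) hζ'))

end Local

end OneTwo

namespace OneTwo

/-! ### Overlapping windows and their contraction -/

theorem mem_edges_iff_forall {Λ : Finset Vert} {e : Sym2 Vert} :
    e ∈ edges Λ ↔ e ∈ hexLattice.edgeSet ∧ ∀ v ∈ e, v ∈ Λ := by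
  classical
  rw [edges, Finset.mem_filter, Finset.mem_sym2_iff, and_comm]

theorem nbr_snd (d : Dir) (v : Vert) : v.2 - 1 ≤ (nbr d v).2 ∧ (nbr d v).2 ≤ v.2 + 1 := by
  cases d <;> simp only [nbr] <;> split_ifs <;> simp only [] <;> omega

theorem faceVert_snd (f : Vert) (i : ZMod 6) :
    f.2 ≤ (faceVert f i).2 ∧ (faceVert f i).2 ≤ f.2 + 2 := by
  refine zmod_six_forall (P := fun i => f.2 ≤ (faceVert f i).2 ∧ (faceVert f i).2 ≤ f.2 + 2)
    ?_ ?_ ?_ ?_ ?_ ?_ i <;> simp [faceVert]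

theorem mem_edges_of_mem_symmDiff {Λ : Finset Vert} {bd ω ω' : Set (Sym2 Vert)}
    (h : Compat Λ bd ω) (h' : Compat Λ bd ω') {e : Sym2 Vert} (he : e ∈ symmDiff ω ω') :
    e ∈ edges Λ := h.subset_edges h' he

/-- A move takes place in three consecutive columns. -/
theorem Step.exists_columns {o : Vert} {k n : ℕ} {bd ω ω' : Set (Sym2 Vert)}
    (h : Step (box o k n) bd ω ω') :
    ∃ q, o.2 ≤ q ∧ ∀ e ∈ symmDiff ω ω', ∀ v ∈ e, q ≤ v.2 ∧ v.2 ≤ q + 2 := by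
  obtain ⟨h1, h2, ⟨v, d, h3⟩ | h3⟩ := h
  · have hm : edgeAt v d ∈ edges (box o k n) :=
      mem_edges_of_mem_symmDiff h1 h2 (h3 ▸ Set.mem_singleton _)
    obtain ⟨h4, h5⟩ := edgeAt_mem_edges.1 hm
    have h6 := (mem_box.1 h4).2.1
    have h7 := (mem_box.1 h5).2.1
    have h8 := nbr_snd d v
    refine ⟨min v.2 (nbr d v).2, le_min h6 h7, ?_⟩
    intro e he u hu
    rw [h3, Set.mem_singleton_iff] at he
    subst he
    rcases Sym2.mem_iff.1 hu with rfl | rfl <;> omega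
  · obtain ⟨f, hf, h4⟩ := h3.exists_face h1 h2
    refine ⟨f.2, ?_, ?_⟩
    · classical
      have h5 := (Finset.mem_filter.1 hf).2.2 0
      exact (mem_box.1 h5).2.1
    · intro e he u hu
      rw [h4] at he
      obtain ⟨i, rfl⟩ := he
      rcases Sym2.mem_iff.1 hu with rfl | rfl
      · exact faceVert_snd f i
      · exact faceVert_snd f (i + 1)

/-- The `i`-th of `R` overlapping windows of the box; it consists of two blocks of `L` columns,
and the last one contains all the remaining columns. -/
noncomputable def window (o : Vert) (k n L R i : ℕ) : Finset Vert :=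
  box (o.1, o.2 + i * L) k (if i + 1 < R then 2 * L else n - i * L)

section Window

variable {o : Vert} {k n L R i j : ℕ}

theorem mem_window (hR : (R + 1) * L ≤ n) (hi : i < R) {v : Vert} :
    v ∈ window o k n L R i ↔ (o.1 ≤ v.1 ∧ v.1 < o.1 + k) ∧ o.2 + i * L ≤ v.2 ∧
      ((i + 1 < R ∧ v.2 < o.2 + (i + 2) * L) ∨ (i + 1 = R ∧ v.2 < o.2 + n)) := by
  have h1 : i * L ≤ n := (Nat.mul_le_mul_right L (by omega)).trans hR
  rw [window, mem_box]
  split_ifs with h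
  · have : o.2 + i * L + ((2 * L : ℕ) : ℤ) = o.2 + (i + 2) * L := by push_cast; ring
    rw [this]
    have : ¬ i + 1 = R := by omega
    tauto
  · have : o.2 + i * L + ((n - i * L : ℕ) : ℤ) = o.2 + n := by
      rw [Nat.cast_sub h1]
      push_cast
      ring
    rw [this]
    have : i + 1 = R := by omega
    tauto

theorem window_subset (hR : (R + 1) * L ≤ n) (hi : i < R) :
    window o k n L R i ⊆ box o k n := by
  intro v hv
  rw [mem_window hR hi] at hv
  have h0 : (0 : ℤ) ≤ i * L := by positivity
  obtain ⟨h1, h2, h3⟩ := hv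
  refine mem_box.2 ⟨h1, by omega, ?_⟩
  rcases h3 with ⟨h3, h4⟩ | ⟨-, h4⟩
  · have : (i + 2) * L ≤ n := (Nat.mul_le_mul_right L (by omega)).trans hR
    zify at this
    omega
  · exact h4

theorem card_window_le (hR : n < (R + 2) * L) : (window o k n L R i).card ≤ 3 * (k * L) := by
  have h1 : (window o k n L R i).card = k * (if i + 1 < R then 2 * L else n - i * L) := by
    rw [window, box, Finset.card_product, Int.card_Ico, Int.card_Ico, add_sub_cancel_left,
      add_sub_cancel_left, Int.toNat_natCast, Int.toNat_natCast]
  rw [h1]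
  have h2 : (if i + 1 < R then 2 * L else n - i * L) ≤ 3 * L := by
    split_ifs with h
    · omega
    · have : (R + 2) * L ≤ (i + 3) * L := Nat.mul_le_mul_right L (by omega)
      have : (i + 3) * L = i * L + 3 * L := by ring
      omega
  calc _ ≤ k * (3 * L) := Nat.mul_le_mul_left k h2
    _ = 3 * (k * L) := by ring

/-- A move occupies at most three columns and consecutive windows overlap in `L ≥ 2` columns, so the
window of the block containing the first of these columns, or the last window, contains the move. -/
theorem exists_window {bd ω ω' : Set (Sym2 Vert)} (hR : (R + 1) * L ≤ n) (hR1 : 1 ≤ R)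
    (hL : 2 ≤ L) (h : Step (box o k n) bd ω ω') :
    ∃ i < R, symmDiff ω ω' ⊆ ↑(edges (window o k n L R i)) := by
  obtain ⟨q, hq, h1⟩ := h.exists_columns
  obtain ⟨t, ht⟩ := Int.le.dest hq
  have h2 : t / L * L ≤ t := Nat.div_mul_le_self t L
  have h3 : t < (t / L + 1) * L := (Nat.div_lt_iff_lt_mul (by omega)).1 (Nat.lt_succ_self _)
  have h4 : min (t / L) (R - 1) * L ≤ t := (Nat.mul_le_mul_right L (min_le_left _ _)).trans h2
  have hi : min (t / L) (R - 1) < R := by omega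
  refine ⟨min (t / L) (R - 1), hi, fun e he => ?_⟩
  have h5 := mem_edges_iff_forall.1 (mem_edges_of_mem_symmDiff h.1 h.2.1 he)
  refine mem_edges_iff_forall.2 ⟨h5.1, fun v hv => (mem_window hR hi).2 ?_⟩
  obtain ⟨h6, -, h7⟩ := mem_box.1 (h5.2 v hv)
  obtain ⟨h8, h9⟩ := h1 e he v hv
  refine ⟨h6, by zify at h4; push_cast; omega, ?_⟩
  by_cases hlt : t / L < R - 1
  · rw [min_eq_left hlt.le]
    refine Or.inl ⟨by omega, ?_⟩
    have : (t / L + 2) * L = (t / L + 1) * L + L := by ring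
    have h10 : t + 2 < (t / L + 2) * L := by omega
    have h11 : ((t + 2 : ℕ) : ℤ) < (((t / L + 2) * L : ℕ) : ℤ) := by exact_mod_cast h10
    rw [Nat.cast_mul, Nat.cast_add] at h11
    push_cast at h11 ⊢
    omega
  · exact Or.inr ⟨by omega, h7⟩

/-- Every vertex lies in at most three windows. -/
theorem card_windows_le (hR : (R + 1) * L ≤ n) (hL : 0 < L) (v : Vert) :
    (Finset.univ.filter fun i : Fin R => v ∈ window o k n L R i).card ≤ 3 := by
  classical
  set t := (v.2 - o.2).toNat with ht
  have h : ((Finset.univ.filter fun i : Fin R => v ∈ window o k n L R i).image Fin.val) ⊆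
      {t / L, t / L - 1, R - 1} := by
    intro j hj
    obtain ⟨i, hi, rfl⟩ := Finset.mem_image.1 hj
    have h1 := (mem_window hR i.2).1 (Finset.mem_filter.1 hi).2
    obtain ⟨-, h2, h3⟩ := h1
    have h0 : (0 : ℤ) ≤ i * L := by positivity
    have h4 : (i : ℕ) ≤ t / L := by
      rw [Nat.le_div_iff_mul_le hL]
      zify
      omega
    simp only [Finset.mem_insert, Finset.mem_singleton]
    rcases h3 with ⟨h5, h6⟩ | ⟨h5, -⟩
    · have h7 : t / L < i + 2 := by
        rw [Nat.div_lt_iff_lt_mul hL]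
        zify
        omega
      omega
    · omega
  rw [← Finset.card_image_of_injective _ Fin.val_injective]
  exact (Finset.card_le_card h).trans Finset.card_le_three

end Window

section WindowContraction

variable {o : Vert} {k n T R : ℕ} {bd : Set (Sym2 Vert)} {a b c : ℝ}

/-- A change inside the averaged window has no effect, a change in a window at distance at least two
costs `D`, and a change in an adjacent window costs `5/4 * D`. -/
theorem classAvg_window_sub_le (hk : 2 ≤ k) (ha : 0 < a) (hb : 0 < b) (hc : 0 < c) (hT0 : 1 ≤ T)
    (hT : (1 - ((8 * weightRatio a b c) ^ (8 * k))⁻¹) ^ T ≤ 1 / 5)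
    (hR : (R + 1) * (8 * T) ≤ n) {f : State (box o k n) bd → ℝ} {D : ℝ}
    (hf : ∀ i < R, ∀ η ξ, SameOff (window o k n (8 * T) R i) η ξ → |f η - f ξ| ≤ D)
    {i j : ℕ} (hi : i < R) (hj : j < R) {x y : State (box o k n) bd}
    (hxy : SameOff (window o k n (8 * T) R j) x y) :
    classAvg (fun ξ => weight (box o k n) a b c ξ.1) (SameOff (window o k n (8 * T) R i)) f x -
      classAvg (fun ξ => weight (box o k n) a b c ξ.1) (SameOff (window o k n (8 * T) R i)) f y ≤
      D * (1 - (if i = j then 1 else 0) + 1 / 4 * (if j + 1 = i then 1 else 0) +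
        1 / 4 * (if i + 1 = j then 1 else 0)) := by
  set L := 8 * T with hL
  have hLT : (L : ℤ) = 8 * T := by rw [hL]; push_cast; ring
  have hblock : ∀ m : ℕ, m < R + 2 → (m : ℤ) * L ≤ n := by
    intro m hm
    exact_mod_cast (Nat.mul_le_mul_right L (by omega)).trans hR
  rcases lt_trichotomy i j with hij | rfl | hij
  · by_cases hij1 : i + 1 = j
    · subst hij1
      rw [if_neg (by omega), if_neg (by omega), if_pos rfl]
      have hc1 := hblock (i + 2) (by omega)
      push_cast at hc1
      have e1 : ((i : ℤ) + 2) * L = i * L + 2 * L := by ring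
      have e2 : (((i + 1 : ℕ) : ℤ)) * L = i * L + L := by push_cast; ring
      have e3 : (((i + 1 : ℕ) : ℤ) + 2) * L = i * L + 3 * L := by push_cast; ring
      have e0 : (0 : ℤ) ≤ i * L := by positivity
      rw [e1] at hc1
      set u : ℤ := o.2 + i * L + 2 * L with hu
      -- The overlap consists of `8 * T` columns, which hold `T` successive cuts of eight columns
      -- each, numbered from the side of the change in window `i + 1`.
      have := classAvg_sub_le_of_overlap ha hb hc (m := 8 * k) (T := T)
        (B := fun s => {v : Vert | v.2 < u - 8 * s - 8 + 8})
        (A := fun s => {v : Vert | v.2 < u - 8 * s - 8 + 4})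
        (C := fun s => {v : Vert | v.2 < u - 8 * s - 8})
        (S := {v : Vert | v.2 < u}) (E := {v : Vert | v.2 < u - L})
        (X := window o k n L R i) (Y := window o k n L R (i + 1)) (f := f) (D := D)
        (x := x) (y := y)
        (fun s hs => linked_left hk (by omega) (by omega))
        (fun s _ s' hs v (hv : v.2 < _) => show v.2 < _ by omega)
        (fun s hs v (hv : v.2 < _) => show v.2 < _ by omega)
        (fun s _ v (hv : v.2 < _) => show v.2 < _ by omega)
        (fun v (hv : v.2 < _) => show v.2 < _ by omega)
        (fun η ξ => by
          obtain ⟨ζ, h1, h2⟩ := State.exists_bridge hk ξ η (c := u - L) (by omega) (by omega)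
          refine ⟨ζ, fun v hv => h2 v ?_, h1⟩
          have hv : ¬ v.2 < u := hv
          omega)
        hT
        (fun v hv (h1 : v.2 < u) (h2 : ¬ v.2 < u - L) => by
          rw [mem_window hR hi, e1]
          exact ⟨(mem_box.1 hv).1, by omega, Or.inl ⟨hj, by omega⟩⟩)
        (fun v hv (h1 : v.2 < u - L) => by
          rw [mem_window hR hj, e2] at hv
          omega)
        (fun v hv (h1 : ¬ v.2 < u - L) => by
          rw [mem_window hR hi, e1] at hv
          rw [mem_window hR hj, e2, e3]
          refine ⟨hv.1, by omega, ?_⟩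
          by_cases h : i + 1 + 1 < R
          · exact Or.inl ⟨h, by omega⟩
          · exact Or.inr ⟨by omega, by omega⟩)
        (hf i hi) (hf _ hj) hxy
      refine this.trans (le_of_eq ?_)
      ring
    · rw [if_neg (by omega), if_neg (by omega), if_neg hij1]
      have := classAvg_sub_le_of_disjoint ha hb hc (X := window o k n L R i)
        (Y := window o k n L R j) (f := f) (D := D) (x := x) (y := y) (fun v hv hv' => by
          rw [mem_window hR hi] at hv
          rw [mem_window hR hj] at hv'
          have h1 : ((i : ℤ) + 2) * L ≤ j * L := by
            refine mul_le_mul_of_nonneg_right ?_ (by positivity)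
            omega
          omega) (hf i hi) (hf j hj) hxy
      refine this.trans (le_of_eq ?_)
      ring
  · rw [if_pos rfl, if_neg (Nat.succ_ne_self i)]
    unfold classAvg
    rw [classSum_congr (sameOff_equivalence _) hxy, classSum_congr (sameOff_equivalence _) hxy]
    simp
  · by_cases hij1 : j + 1 = i
    · subst hij1
      rw [if_neg (by omega), if_pos rfl, if_neg (by omega)]
      have hc1 := hblock (j + 2) (by omega)
      push_cast at hc1
      have e1 : ((j : ℤ) + 2) * L = j * L + 2 * L := by ring
      have e2 : (((j + 1 : ℕ) : ℤ)) * L = j * L + L := by push_cast; ring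
      have e3 : (((j + 1 : ℕ) : ℤ) + 2) * L = j * L + 3 * L := by push_cast; ring
      have e0 : (0 : ℤ) ≤ j * L := by positivity
      rw [e1] at hc1
      set u : ℤ := o.2 + j * L + L with hu
      have := classAvg_sub_le_of_overlap ha hb hc (m := 8 * k) (T := T)
        (B := fun s => {v : Vert | u + 8 * s ≤ v.2})
        (A := fun s => {v : Vert | u + 8 * s + 4 ≤ v.2})
        (C := fun s => {v : Vert | u + 8 * s + 8 ≤ v.2})
        (S := {v : Vert | u ≤ v.2}) (E := {v : Vert | u + L ≤ v.2})
        (X := window o k n L R (j + 1)) (Y := window o k n L R j) (f := f) (D := D)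
        (x := x) (y := y)
        (fun s hs => linked_right hk (by omega) (by omega))
        (fun s _ s' hs v (hv : _ ≤ v.2) => show _ ≤ v.2 by omega)
        (fun s hs v (hv : _ ≤ v.2) => show _ ≤ v.2 by omega)
        (fun s _ v (hv : _ ≤ v.2) => show _ ≤ v.2 by omega)
        (fun v (hv : _ ≤ v.2) => show _ ≤ v.2 by omega)
        (fun η ξ => by
          obtain ⟨ζ, h1, h2⟩ := State.exists_bridge hk η ξ (c := u) (by omega) (by omega)
          refine ⟨ζ, fun v hv => h1 v ?_, fun v hv => h2 v ?_⟩
          · have hv : ¬ u ≤ v.2 := hv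
            omega
          · have hv : u + L ≤ v.2 := hv
            omega)
        hT
        (fun v hv (h1 : u ≤ v.2) (h2 : ¬ u + L ≤ v.2) => by
          have h3 := (mem_box.1 hv).2.2
          rw [mem_window hR hi, e2, e3]
          refine ⟨(mem_box.1 hv).1, by omega, ?_⟩
          by_cases h : j + 1 + 1 < R
          · exact Or.inl ⟨h, by omega⟩
          · exact Or.inr ⟨by omega, by omega⟩)
        (fun v hv (h1 : u + L ≤ v.2) => by
          rw [mem_window hR hj, e1] at hv
          omega)
        (fun v hv (h1 : ¬ u + L ≤ v.2) => by
          rw [mem_window hR hi, e2] at hv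
          rw [mem_window hR hj, e1]
          exact ⟨hv.1, by omega, Or.inl ⟨hi, by omega⟩⟩)
        (hf _ hi) (hf j hj) hxy
      refine this.trans (le_of_eq ?_)
      ring
    · rw [if_neg (by omega), if_neg hij1, if_neg (by omega)]
      have := classAvg_sub_le_of_disjoint ha hb hc (X := window o k n L R i)
        (Y := window o k n L R j) (f := f) (D := D) (x := x) (y := y) (fun v hv hv' => by
          rw [mem_window hR hi] at hv
          rw [mem_window hR hj] at hv'
          have h1 : ((j : ℤ) + 2) * L ≤ i * L := by
            refine mul_le_mul_of_nonneg_right ?_ (by positivity)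
            omega
          omega) (hf i hi) (hf j hj) hxy
      refine this.trans (le_of_eq ?_)
      ring

/-- The window of the change contributes 0 and its at most two neighbours exceed `D` by at most `D /
4` each, so the total is at most `R - 1 + 1/2` times `D`. -/
theorem sum_classAvg_window_le (hk : 2 ≤ k) (ha : 0 < a) (hb : 0 < b) (hc : 0 < c) (hT0 : 1 ≤ T)
    (hT : (1 - ((8 * weightRatio a b c) ^ (8 * k))⁻¹) ^ T ≤ 1 / 5)
    (hR : (R + 1) * (8 * T) ≤ n) {f : State (box o k n) bd → ℝ} {D : ℝ} (hD : 0 ≤ D)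
    (hf : ∀ i < R, ∀ η ξ, SameOff (window o k n (8 * T) R i) η ξ → |f η - f ξ| ≤ D)
    {j : Fin R} {x y : State (box o k n) bd}
    (hxy : SameOff (window o k n (8 * T) R j) x y) :
    ∑ i : Fin R, |classAvg (fun ξ => weight (box o k n) a b c ξ.1)
        (SameOff (window o k n (8 * T) R i)) f x -
      classAvg (fun ξ => weight (box o k n) a b c ξ.1)
        (SameOff (window o k n (8 * T) R i)) f y| ≤ ((Fintype.card (Fin R) : ℝ) - 1 / 2) * D := by
  have h1 : ∀ i : Fin R, |classAvg (fun ξ => weight (box o k n) a b c ξ.1)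
        (SameOff (window o k n (8 * T) R i)) f x -
      classAvg (fun ξ => weight (box o k n) a b c ξ.1)
        (SameOff (window o k n (8 * T) R i)) f y| ≤
      D * (1 - (if (i : ℕ) = j then 1 else 0) + 1 / 4 * (if (j : ℕ) + 1 = i then 1 else 0) +
        1 / 4 * (if (i : ℕ) + 1 = j then 1 else 0)) := by
    intro i
    rw [abs_le']
    refine ⟨classAvg_window_sub_le hk ha hb hc hT0 hT hR hf i.2 j.2 hxy, ?_⟩
    rw [neg_sub]
    exact classAvg_window_sub_le hk ha hb hc hT0 hT hR hf i.2 j.2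
      ((sameOff_equivalence _).symm hxy)
  refine (Finset.sum_le_sum fun i _ => h1 i).trans ?_
  rw [← Finset.mul_sum, mul_comm]
  refine mul_le_mul_of_nonneg_right ?_ hD
  rw [Finset.sum_add_distrib, Finset.sum_add_distrib, Finset.sum_sub_distrib, ← Finset.mul_sum,
    ← Finset.mul_sum]
  have h2 : ∑ i : Fin R, (if (i : ℕ) = j then (1 : ℝ) else 0) = 1 := by
    simp [← Fin.ext_iff]
  have h3 : ∀ P : Fin R → Prop, ∀ [DecidablePred P], (∀ i i', P i → P i' → i = i') →
      ∑ i : Fin R, (if P i then (1 : ℝ) else 0) ≤ 1 := by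
    intro P _ hP
    rw [Finset.sum_boole]
    exact_mod_cast Finset.card_le_one.2 fun i hi i' hi' =>
      hP i i' (Finset.mem_filter.1 hi).2 (Finset.mem_filter.1 hi').2
  have h4 := h3 (fun i => (j : ℕ) + 1 = i) fun i i' e e' => Fin.ext (e.symm.trans e')
  have h5 := h3 (fun i => (i : ℕ) + 1 = j) fun i i' e e' => Fin.ext (by omega)
  simp only [Finset.sum_const, Finset.card_univ, nsmul_eq_mul, mul_one]
  rw [h2]
  linarith

end WindowContraction

end OneTwo

namespace OneTwo

/-! ### Conditional variance in one window -/

/-- A function that changes by at most `m` in each step changes along a path inside `Q` by at most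
`m` times the number of elements of `Q`. -/
theorem sub_le_of_reflTransGen {S : Type*} {ρ : S → S → Prop} {f : S → ℝ} {m : ℝ} (hm : 0 ≤ m)
    {Q : Finset S} {x y : S} (hx : x ∈ Q) (hQ : ∀ u ∈ Q, ∀ v, ρ u v → v ∈ Q)
    (hf : ∀ u ∈ Q, ∀ v, ρ u v → f v ≤ f u + m) (hxy : Relation.ReflTransGen ρ x y) :
    f y ≤ f x + Q.card * m := by
  classical
  have hmem : ∀ z, Relation.ReflTransGen ρ x z → z ∈ Q := by
    intro z hz
    induction hz with
    | refl => exact hx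
    | tail _ h ih => exact hQ _ ih _ h
  have key : ∀ N : ℕ, ∀ z, Relation.ReflTransGen ρ x z →
      (Q.filter fun u => f u < f z).card ≤ N → f z ≤ f x + N * m := by
    intro N
    induction N with
    | zero =>
      intro z _ hN
      rw [Nat.le_zero, Finset.card_eq_zero, Finset.filter_eq_empty_iff] at hN
      simpa using hN hx
    | succ N ih =>
      intro z hz hN
      by_cases hlt : f z ≤ f x
      · have : 0 ≤ ((N + 1 : ℕ) : ℝ) * m := by positivity
        linarith
      -- On the way to `z` the path leaves the region below the level `f z`, and the last point `u`
      -- before that is within `m` of the level. Fewer elements lie below `f u`, so the induction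
      -- applies without making the path simple.
      have hcross : ∀ w, Relation.ReflTransGen ρ x w →
          (∃ u, Relation.ReflTransGen ρ x u ∧ f u < f z ∧ f z ≤ f u + m) ∨ f w < f z := by
        intro w hw
        induction hw with
        | refl => exact Or.inr (not_le.1 hlt)
        | @tail w w' hw h ihw =>
          rcases ihw with h' | h'
          · exact Or.inl h'
          · by_cases h'' : f w' < f z
            · exact Or.inr h''
            · exact Or.inl ⟨w, hw, h', (not_lt.1 h'').trans (hf w (hmem w hw) w' h)⟩
      obtain ⟨u, hu, h1, h2⟩ := (hcross z hz).resolve_right (lt_irrefl _)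
      have h3 : (Q.filter fun v => f v < f u).card < (Q.filter fun v => f v < f z).card := by
        refine Finset.card_lt_card ⟨fun v hv => ?_, fun h => ?_⟩
        · obtain ⟨h4, h5⟩ := Finset.mem_filter.1 hv
          exact Finset.mem_filter.2 ⟨h4, h5.trans h1⟩
        · have := h (Finset.mem_filter.2 ⟨hmem u hu, h1⟩)
          exact lt_irrefl _ (Finset.mem_filter.1 this).2
      have h4 := ih u hu (by omega)
      push_cast
      linarith
  exact key _ y hxy (Finset.card_filter_le _ _)

section LocalPoincare

variable {Λ : Finset Vert} {bd : Set (Sym2 Vert)} {a b c : ℝ}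

/-- A move inside `W`. -/
def LocalStep (W : Finset Vert) (η ξ : State Λ bd) : Prop :=
  SameOff W η ξ ∧ Step Λ bd η.1 ξ.1

theorem sameOff_iff_agreesOutside {W : Finset Vert} {η ξ : State Λ bd} :
    SameOff W η ξ ↔ AgreesOutside W η.1 ξ.1 := by
  constructor
  · exact fun h e _ he => (h e he).symm
  · intro h e he
    by_cases hE : e ∈ hexLattice.edgeSet
    · exact (h e hE he).symm
    · exact ⟨fun h' => absurd (η.2.1.1 h') hE, fun h' => absurd (ξ.2.1.1 h') hE⟩

/-- A window is itself a box, so irreducibility applies to it with the state `x` as its boundary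
condition. -/
theorem reflTransGen_localStep {o : Vert} {k n : ℕ} (hW : box o k n ⊆ Λ) {x y : State Λ bd}
    (h : SameOff (box o k n) x y) : Relation.ReflTransGen (LocalStep (box o k n)) x y := by
  have hlift : ∀ ω, Compat (box o k n) x.1 ω → Compat Λ bd ω := fun ω hω =>
    ⟨hω.1, fun e he heΛ => (hω.2 e he fun h' => heΛ (edges_mono hW h')).trans (x.2.2 e he heΛ)⟩
  have hx : Compat (box o k n) x.1 x.1 := ⟨x.2.1, fun _ _ _ => Iff.rfl⟩
  have hy : Compat (box o k n) x.1 y.1 := ⟨y.2.1, sameOff_iff_agreesOutside.1 h⟩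
  have key : ∀ ω, Reach (box o k n) x.1 x.1 ω → ∀ z : State Λ bd, z.1 = ω →
      Relation.ReflTransGen (LocalStep (box o k n)) x z := by
    intro ω hω
    induction hω with
    | refl =>
      intro z hz
      rw [Subtype.ext hz]
    | @tail ω ω' _ hs ih =>
      intro z hz
      refine (ih ⟨ω, hlift ω hs.1⟩ rfl).tail ⟨sameOff_iff_agreesOutside.2 ?_, ?_⟩
      · rw [hz]
        exact fun e he heW => (hs.2.1.2 e he heW).trans (hs.1.2 e he heW).symm
      · rw [hz]
        exact ⟨hlift ω hs.1, hlift ω' hs.2.1, hs.2.2⟩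
  exact key y.1 (reach_box hx hy) y rfl

open Classical in
theorem card_sameOff_le (W : Finset Vert) (x : State Λ bd) :
    (Finset.univ.filter fun ξ => SameOff W x ξ).card ≤ 8 ^ W.card := by
  have hcard : (edges W).powerset.card ≤ 8 ^ W.card := by
    rw [Finset.card_powerset]
    calc 2 ^ (edges W).card ≤ 2 ^ (3 * W.card) := Nat.pow_le_pow_right two_pos (card_edges_le W)
      _ = 8 ^ W.card := by rw [pow_mul]; norm_num
  refine le_trans (Finset.card_le_card_of_injOn (fun η => (edges W).filter fun e => e ∈ η.1)
    (fun η _ => Finset.mem_powerset.2 (Finset.filter_subset _ _)) ?_) hcard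
  intro η hη ξ hξ h
  have h1 := (Finset.mem_filter.1 hη).2
  have h2 := (Finset.mem_filter.1 hξ).2
  apply Subtype.ext
  ext e
  by_cases he : e ∈ edges W
  · simpa [he] using Finset.ext_iff.1 h e
  · exact (h1 e he).symm.trans (h2 e he)

theorem SameOff.weight_le (ha : 0 < a) (hb : 0 < b) (hc : 0 < c) {W : Finset Vert}
    {x u : State Λ bd} (h : SameOff W x u) :
    weight Λ a b c x.1 ≤ weightRatio a b c ^ W.card * weight Λ a b c u.1 :=
  weight_le_of_sameAt ha hb hc x.2.1 u.2.1 fun _ _ hv _ => h.edgeAt_iff (Or.inl hv)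

open Classical in
theorem sq_sub_le_sum_localStep {o : Vert} {k n : ℕ} (hW : box o k n ⊆ Λ) (f : State Λ bd → ℝ)
    {x y : State Λ bd} (h : SameOff (box o k n) x y) :
    (f x - f y) ^ 2 ≤ ((8 : ℝ) ^ (box o k n).card) ^ 2 *
      ∑ u with SameOff (box o k n) x u, ∑ v with LocalStep (box o k n) u v, (f u - f v) ^ 2 := by
  set W := box o k n
  set Q : Finset (State Λ bd) := Finset.univ.filter fun u => SameOff W x u with hQ
  set σ := ∑ u ∈ Q, ∑ v with LocalStep W u v, (f u - f v) ^ 2 with hσ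
  have hmem : ∀ u, u ∈ Q ↔ SameOff W x u := by
    intro u
    simp only [hQ, Finset.mem_filter, Finset.mem_univ, true_and]
  have hx : x ∈ Q := (hmem x).2 ((sameOff_equivalence W).refl x)
  have hclosed : ∀ u ∈ Q, ∀ v, LocalStep W u v → v ∈ Q := fun u hu v huv =>
    (hmem v).2 ((sameOff_equivalence W).trans ((hmem u).1 hu) huv.1)
  have hσ0 : 0 ≤ σ := Finset.sum_nonneg fun u _ => Finset.sum_nonneg fun v _ => sq_nonneg _
  have hstep : ∀ u ∈ Q, ∀ v, LocalStep W u v → |f u - f v| ≤ √σ := by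
    intro u hu v huv
    apply Real.abs_le_sqrt
    refine le_trans ?_ (Finset.single_le_sum (f := fun u => ∑ v with LocalStep W u v,
      (f u - f v) ^ 2) (fun u _ => Finset.sum_nonneg fun v _ => sq_nonneg _) hu)
    exact Finset.single_le_sum (f := fun v => (f u - f v) ^ 2) (fun v _ => sq_nonneg _)
      (Finset.mem_filter.2 ⟨Finset.mem_univ v, huv⟩)
  have hpath := reflTransGen_localStep hW h
  have h1 := sub_le_of_reflTransGen (f := f) (Real.sqrt_nonneg σ) hx hclosed
    (fun u hu v huv => by
      have := (abs_le.1 (hstep u hu v huv)).1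
      linarith) hpath
  have h2 := sub_le_of_reflTransGen (f := fun z => - f z) (Real.sqrt_nonneg σ) hx hclosed
    (fun u hu v huv => by
      have := (abs_le.1 (hstep u hu v huv)).2
      linarith) hpath
  have h3 : |f x - f y| ≤ Q.card * √σ := by
    rw [abs_le]
    constructor <;> linarith
  have h4 : (Q.card : ℝ) ≤ 8 ^ W.card := by exact_mod_cast card_sameOff_le W x
  calc (f x - f y) ^ 2 = |f x - f y| ^ 2 := (sq_abs _).symm
    _ ≤ (8 ^ W.card * √σ) ^ 2 := by
        refine pow_le_pow_left₀ (abs_nonneg _) (h3.trans ?_) 2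
        exact mul_le_mul_of_nonneg_right h4 (Real.sqrt_nonneg σ)
    _ = (8 ^ W.card) ^ 2 * σ := by rw [mul_pow, Real.sq_sqrt hσ0]

open Classical in
-- Two states of a class are joined by moves inside the window, which bounds the difference of `f`
-- by the local energy. The factor `8 ^ m` bounds the number of states in a class, squared for the
-- path and once more for the sum over starting points; `weightRatio ^ m` compares weights within
-- the class.
theorem sum_sub_classAvg_le {o : Vert} {k n m : ℕ} (ha : 0 < a) (hb : 0 < b) (hc : 0 < c)
    (hW : box o k n ⊆ Λ) (hm : (box o k n).card ≤ m) (f : State Λ bd → ℝ) :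
    ∑ x : State Λ bd, weight Λ a b c x.1 * f x * (f x -
        classAvg (fun ξ => weight Λ a b c ξ.1) (SameOff (box o k n)) f x) ≤
      ((8 : ℝ) ^ m) ^ 3 * weightRatio a b c ^ m / 2 *
        ∑ u : State Λ bd, ∑ v with LocalStep (box o k n) u v,
          weight Λ a b c u.1 * (f u - f v) ^ 2 := by
  set W := box o k n with hWdef
  set w : State Λ bd → ℝ := fun ξ => weight Λ a b c ξ.1 with hw
  have hw0 : ∀ ξ, 0 < w ξ := fun ξ => weight_pos ha hb hc ξ.2.1 Λ
  have hr := sameOff_equivalence (Λ := Λ) (bd := bd) W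
  have h1 := one_le_weightRatio ha hb hc
  set E : State Λ bd → ℝ := fun u => ∑ v with LocalStep W u v, (f u - f v) ^ 2 with hE
  have hE0 : ∀ u, 0 ≤ E u := fun u => Finset.sum_nonneg fun v _ => sq_nonneg _
  have h8 : ((8 : ℝ) ^ W.card) ≤ 8 ^ m := pow_le_pow_right₀ (by norm_num) hm
  have e1 := sum_sub_classAvg hw0 hr f
  change ∑ x, w x * f x * (f x - classAvg w (SameOff W) f x) ≤ _
  rw [e1]
  have e2 : ∑ x, ∑ y with SameOff W x y, w x * w y / (∑ z with SameOff W x z, w z) *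
      (f x - f y) ^ 2 ≤ ∑ x, w x * ((8 ^ m) ^ 2 * ∑ u with SameOff W x u, E u) := by
    refine Finset.sum_le_sum fun x _ => ?_
    have hZ := classSum_pos hw0 hr x
    have e3 : ∀ y ∈ Finset.univ.filter fun y => SameOff W x y,
        w x * w y / (∑ z with SameOff W x z, w z) * (f x - f y) ^ 2 ≤
        w y * (w x / (∑ z with SameOff W x z, w z) *
          ((8 ^ m) ^ 2 * ∑ u with SameOff W x u, E u)) := by
      intro y hy
      have e4 := sq_sub_le_sum_localStep hW f (Finset.mem_filter.1 hy).2
      have e5 : (f x - f y) ^ 2 ≤ (8 ^ m) ^ 2 * ∑ u with SameOff W x u, E u :=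
        e4.trans (mul_le_mul_of_nonneg_right (pow_le_pow_left₀ (by positivity) h8 2)
          (Finset.sum_nonneg fun u _ => hE0 u))
      have := mul_le_mul_of_nonneg_left e5
        (mul_pos (hw0 y) (div_pos (hw0 x) hZ)).le
      refine le_trans (le_of_eq ?_) (this.trans (le_of_eq ?_)) <;> ring
    refine (Finset.sum_le_sum e3).trans (le_of_eq ?_)
    rw [← Finset.sum_mul]
    field_simp
  have e6 : ∑ x, w x * ((8 ^ m) ^ 2 * ∑ u with SameOff W x u, E u) =
      (8 ^ m) ^ 2 * ∑ u, E u * ∑ x with SameOff W u x, w x := by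
    simp only [Finset.mul_sum, Finset.sum_filter]
    rw [Finset.sum_comm]
    refine Finset.sum_congr rfl fun u _ => Finset.sum_congr rfl fun x _ => ?_
    by_cases h : SameOff W x u
    · rw [if_pos h, if_pos (hr.symm h)]
      ring
    · rw [if_neg h, if_neg fun h' => h (hr.symm h')]
      ring
  have e7 : ∀ u, ∑ x with SameOff W u x, w x ≤ 8 ^ m * weightRatio a b c ^ m * w u := by
    intro u
    calc ∑ x with SameOff W u x, w x
        ≤ ∑ x with SameOff W u x, weightRatio a b c ^ m * w u := by
          refine Finset.sum_le_sum fun x hx => ?_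
          refine ((hr.symm (Finset.mem_filter.1 hx).2).weight_le ha hb hc).trans ?_
          exact mul_le_mul_of_nonneg_right (pow_le_pow_right₀ h1 hm) (hw0 u).le
      _ = (Finset.univ.filter fun x => SameOff W u x).card * (weightRatio a b c ^ m * w u) := by
          rw [Finset.sum_const, nsmul_eq_mul]
      _ ≤ 8 ^ m * (weightRatio a b c ^ m * w u) := by
          refine mul_le_mul_of_nonneg_right ?_ (mul_nonneg (by positivity) (hw0 u).le)
          refine le_trans ?_ h8
          exact_mod_cast card_sameOff_le W u
      _ = _ := by ring
  have e8 : ∑ u, E u * ∑ x with SameOff W u x, w x ≤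
      8 ^ m * weightRatio a b c ^ m * ∑ u, ∑ v with LocalStep W u v, w u * (f u - f v) ^ 2 := by
    rw [Finset.mul_sum]
    refine Finset.sum_le_sum fun u _ => ?_
    refine (mul_le_mul_of_nonneg_left (e7 u) (hE0 u)).trans (le_of_eq ?_)
    rw [← Finset.mul_sum]
    ring
  have e9 := mul_le_mul_of_nonneg_left e8 (by positivity : (0 : ℝ) ≤ (8 ^ m) ^ 2)
  rw [e6] at e2
  calc _ ≤ ((8 ^ m) ^ 2 * (8 ^ m * weightRatio a b c ^ m *
        ∑ u, ∑ v with LocalStep W u v, w u * (f u - f v) ^ 2)) / 2 := by linarith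
    _ = _ := by ring

end LocalPoincare

end OneTwo

namespace OneTwo

/-! ### The Poincaré inequality for the chain -/

section Transition

variable {Λ : Finset Vert} {bd : Set (Sym2 Vert)} {a b c : ℝ}

theorem transition_of_ne {η ξ : State Λ bd} (h : η ≠ ξ) :
    transition Λ bd a b c η ξ = rate Λ a b c η.1 ξ.1 := by
  rw [transition, if_neg h]

theorem half_le_transition_self (ha : 0 < a) (hb : 0 < b) (hc : 0 < c) (η : State Λ bd) :
    1 / 2 ≤ transition Λ bd a b c η η := by
  classical
  rw [transition, if_pos rfl]
  have := sum_rate_le ha hb hc Λ bd η (Finset.univ.erase η)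
  linarith

theorem partition_pos (ha : 0 < a) (hb : 0 < b) (hc : 0 < c) [Nonempty (State Λ bd)] :
    0 < ∑ η : State Λ bd, weight Λ a b c η.1 :=
  Finset.sum_pos (fun η _ => weight_pos ha hb hc η.2.1 Λ) Finset.univ_nonempty

theorem isLazyReversible_transition (ha : 0 < a) (hb : 0 < b) (hc : 0 < c)
    [Nonempty (State Λ bd)] : IsLazyReversible (transition Λ bd a b c) (gibbs Λ bd a b c) where
  pos η := div_pos (weight_pos ha hb hc η.2.1 Λ) (partition_pos ha hb hc)
  sum_eq_one := by
    unfold gibbs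
    rw [← Finset.sum_div, div_self (partition_pos ha hb hc).ne']
  nonneg η ξ := by
    by_cases h : η = ξ
    · subst h
      linarith [half_le_transition_self ha hb hc η]
    · rw [transition_of_ne h]
      exact (rate_upper ha hb hc Λ η.1 ξ.1).1
  row_sum η := by
    classical
    rw [← Finset.add_sum_erase _ _ (Finset.mem_univ η)]
    have h : ∑ ξ ∈ Finset.univ.erase η, transition Λ bd a b c η ξ =
        ∑ ξ ∈ Finset.univ.erase η, rate Λ a b c η.1 ξ.1 :=
      Finset.sum_congr rfl fun ξ hξ => transition_of_ne (Finset.ne_of_mem_erase hξ).symm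
    rw [h, transition, if_pos rfl]
    ring
  reversible η ξ := by
    by_cases h : η = ξ
    · rw [h]
    · have h1 := weight_mul_rate ha hb hc η.2 ξ.2
      rw [transition_of_ne h, transition_of_ne (Ne.symm h)]
      unfold gibbs
      rw [div_mul_eq_mul_div, h1, div_mul_eq_mul_div]
  half_le η := half_le_transition_self ha hb hc η

end Transition

section Poincare

variable {o : Vert} {k n T : ℕ} {bd : Set (Sym2 Vert)} {a b c : ℝ}

open Classical in
theorem card_localStep_window_le {L R : ℕ} (hR : (R + 1) * L ≤ n) (hL : 0 < L)
    {u v : State (box o k n) bd} (huv : u ≠ v) :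
    (Finset.univ.filter fun i : Fin R => LocalStep (window o k n L R i) u v).card ≤ 3 := by
  obtain ⟨e, he⟩ : ∃ e, ¬ (e ∈ u.1 ↔ e ∈ v.1) := by
    by_contra hn
    exact huv (Subtype.ext (Set.ext fun e => not_not.1 fun h => hn ⟨e, h⟩))
  induction e with
  | h p q =>
    refine (Finset.card_le_card fun i hi => ?_).trans (card_windows_le (o := o) (k := k) hR hL p)
    have h1 := (Finset.mem_filter.1 hi).2.1
    refine Finset.mem_filter.2 ⟨Finset.mem_univ _, ?_⟩
    by_contra hp
    exact he (h1 _ fun h => hp ((mem_edges_iff_forall.1 h).2 p (Sym2.mem_mk_left p q)))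

/-- The constant in the comparison of a window with its local moves. -/
noncomputable def windowConst (m : ℕ) (a b c : ℝ) : ℝ :=
  ((8 : ℝ) ^ m) ^ 3 * weightRatio a b c ^ m

theorem windowConst_pos (m : ℕ) (ha : 0 < a) (hb : 0 < b) (hc : 0 < c) :
    0 < windowConst m a b c :=
  mul_pos (by positivity) (pow_pos (zero_lt_one.trans_le (one_le_weightRatio ha hb hc)) _)

/-- Passage from unnormalised weights to `gibbs`. The factor 3 is the maximal number of windows
containing a vertex, and 6 includes the 1/2 of the Dirichlet form. -/
theorem poincare_of_sum_le {Λ : Finset Vert} (ha : 0 < a) (hb : 0 < b) (hc : 0 < c)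
    [Nonempty (State Λ bd)] {ρ κ : ℝ} (hκ : 0 < κ)
    (h : ∀ f : State Λ bd → ℝ, ∑ ξ, weight Λ a b c ξ.1 * f ξ = 0 →
      ρ * ∑ x, weight Λ a b c x.1 * f x ^ 2 ≤
        3 * κ * ∑ x, ∑ y, weight Λ a b c x.1 * transition Λ bd a b c x y * (f x - f y) ^ 2) :
    Poincare (transition Λ bd a b c) (gibbs Λ bd a b c) (ρ / (6 * κ)) := by
  set w : State Λ bd → ℝ := fun ξ => weight Λ a b c ξ.1 with hw
  set P := transition Λ bd a b c with hP
  have hZ : 0 < ∑ ξ, w ξ := partition_pos ha hb hc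
  intro f hf
  have hgibbs : ∀ ξ, gibbs Λ bd a b c ξ = w ξ / ∑ ξ, w ξ := fun ξ => rfl
  have hf' : ∑ ξ, w ξ * f ξ = 0 := by
    simp only [hgibbs, div_mul_eq_mul_div] at hf
    rw [← Finset.sum_div, div_eq_zero_iff] at hf
    exact hf.resolve_right hZ.ne'
  have hfin : ρ * ∑ x, w x * f x ^ 2 ≤ 3 * κ * ∑ x, ∑ y, w x * P x y * (f x - f y) ^ 2 := h f hf'
  have e1 : ∑ x, gibbs Λ bd a b c x * f x ^ 2 = (∑ x, w x * f x ^ 2) / ∑ ξ, w ξ := by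
    rw [Finset.sum_div]
    exact Finset.sum_congr rfl fun x _ => by rw [hgibbs]; ring
  have e2 : ∑ x, ∑ y, gibbs Λ bd a b c x * P x y * (f x - f y) ^ 2 =
      (∑ x, ∑ y, w x * P x y * (f x - f y) ^ 2) / ∑ ξ, w ξ := by
    rw [Finset.sum_div]
    refine Finset.sum_congr rfl fun x _ => ?_
    rw [Finset.sum_div]
    exact Finset.sum_congr rfl fun y _ => by rw [hgibbs]; ring
  rw [e1, e2, ← mul_div_assoc, div_right_comm]
  refine div_le_div_of_nonneg_right ?_ hZ.le
  rw [div_mul_eq_mul_div, div_le_iff₀ (by positivity)]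
  linarith

theorem rate_le_transition {Λ : Finset Vert} {u v : State Λ bd} {ρ m : ℝ} (ha : 0 < a)
    (hb : 0 < b) (hc : 0 < c) (hρ : ρ = rateConst Λ a b c * (min (min a b) c / max (max a b) c))
    (huv : u ≠ v) (hm0 : 0 ≤ m) (hm : m ≤ 3) (hs : ¬ Step Λ bd u.1 v.1 → m = 0) :
    ρ * m ≤ 3 * transition Λ bd a b c u v := by
  have h0 := (rate_upper ha hb hc Λ u.1 v.1).1
  rw [transition_of_ne huv]
  by_cases h : Step Λ bd u.1 v.1
  · have h1 : ρ ≤ rate Λ a b c u.1 v.1 := hρ ▸ rate_lower ha hb hc h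
    have h2 := mul_le_mul h1 hm hm0 h0
    linarith
  · rw [hs h, mul_zero]
    linarith

theorem rateConst_mul_nonneg (ha : 0 < a) (hb : 0 < b) (hc : 0 < c) (Λ : Finset Vert) :
    0 ≤ rateConst Λ a b c * (min (min a b) c / max (max a b) c) :=
  mul_nonneg (rateConst_nonneg ha hb hc Λ)
    (div_pos (lt_min (lt_min ha hb) hc) (lt_of_lt_of_le hc (le_max_right _ _))).le

/-- The whole box serves as a single window whose class average is 0. This covers boxes too short
for two blocks, so that the threshold on `n` need not depend on the weights. -/
theorem poincare_transition_of_card_le (ha : 0 < a) (hb : 0 < b) (hc : 0 < c) {m : ℕ}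
    (hm : (box o k n).card ≤ m) [Nonempty (State (box o k n) bd)] :
    Poincare (transition (box o k n) bd a b c) (gibbs (box o k n) bd a b c)
      (rateConst (box o k n) a b c * (min (min a b) c / max (max a b) c) /
        (6 * windowConst m a b c)) := by
  classical
  refine poincare_of_sum_le ha hb hc (windowConst_pos m ha hb hc) ?_
  set Λ := box o k n
  set κ := windowConst m a b c
  set ρ := rateConst Λ a b c * (min (min a b) c / max (max a b) c) with hρ
  intro f hf
  have hall : ∀ x y : State Λ bd, SameOff Λ x y := fun x y =>
    sameOff_of_edgeAt fun v d hv => by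
      rcases hv with hv | hv
      · exact State.sameAt_of_notMem x y hv d
      · rw [← edgeAt_nbr]
        exact State.sameAt_of_notMem x y hv d
  have h1 := sum_sub_classAvg_le ha hb hc (Finset.Subset.refl Λ) hm f
  have h2 : ∀ x, classAvg (fun ξ : State Λ bd => weight Λ a b c ξ.1) (SameOff Λ) f x = 0 := by
    intro x
    rw [classAvg, Finset.filter_true_of_mem fun y _ => hall x y, hf, zero_div]
  have h3 : ρ * ∑ u : State Λ bd, ∑ v with LocalStep Λ u v,
      weight Λ a b c u.1 * (f u - f v) ^ 2 ≤
      3 * ∑ u, ∑ v, weight Λ a b c u.1 * transition Λ bd a b c u v * (f u - f v) ^ 2 := by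
    simp only [Finset.mul_sum, Finset.sum_filter]
    refine Finset.sum_le_sum fun u _ => Finset.sum_le_sum fun v _ => ?_
    by_cases huv : u = v
    · simp [huv]
    have h4 := rate_le_transition (m := if LocalStep Λ u v then 1 else 0) ha hb hc hρ huv
      (by split_ifs <;> norm_num) (by split_ifs <;> norm_num)
      (fun hs => if_neg fun h => hs h.2)
    have h5 := mul_le_mul_of_nonneg_right h4
      (mul_nonneg (weight_pos ha hb hc u.2.1 Λ).le (sq_nonneg (f u - f v)))
    split_ifs at h5 ⊢ <;> linarith
  have h6 : ∑ x : State Λ bd, weight Λ a b c x.1 * f x ^ 2 ≤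
      κ / 2 * ∑ u : State Λ bd, ∑ v with LocalStep Λ u v,
        weight Λ a b c u.1 * (f u - f v) ^ 2 := by
    refine le_trans (le_of_eq ?_) h1
    refine Finset.sum_congr rfl fun x _ => ?_
    rw [h2]
    ring
  have hρ0 : 0 ≤ ρ := rateConst_mul_nonneg ha hb hc Λ
  have hκ0 : 0 < κ := windowConst_pos m ha hb hc
  have h7 := mul_le_mul_of_nonneg_left h6 hρ0
  have h8 := mul_le_mul_of_nonneg_left h3 hκ0.le
  have h9 : 0 ≤ ∑ u, ∑ v, weight Λ a b c u.1 * transition Λ bd a b c u v * (f u - f v) ^ 2 :=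
    Finset.sum_nonneg fun u _ => Finset.sum_nonneg fun v _ =>
      mul_nonneg (mul_nonneg (weight_pos ha hb hc u.2.1 Λ).le
        ((isLazyReversible_transition ha hb hc).nonneg u v)) (sq_nonneg _)
  have h10 := mul_nonneg hκ0.le h9
  linarith

/-- The variance is bounded by the conditional variances in the windows, these by the local moves,
and each move is counted in at most three windows. -/
theorem poincare_transition (hk : 2 ≤ k) (ha : 0 < a) (hb : 0 < b) (hc : 0 < c) (hT0 : 1 ≤ T)
    (hT : (1 - ((8 * weightRatio a b c) ^ (8 * k))⁻¹) ^ T ≤ 1 / 5) (hn : 16 * T ≤ n)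
    [Nonempty (State (box o k n) bd)] :
    Poincare (transition (box o k n) bd a b c) (gibbs (box o k n) bd a b c)
      (rateConst (box o k n) a b c * (min (min a b) c / max (max a b) c) /
        (6 * windowConst (3 * (k * (8 * T))) a b c)) := by
  classical
  refine poincare_of_sum_le ha hb hc (windowConst_pos _ ha hb hc) ?_
  set Λ := box o k n with hΛ
  set κ := windowConst (3 * (k * (8 * T))) a b c with hκ
  set ρ := rateConst Λ a b c * (min (min a b) c / max (max a b) c) with hρ
  set w : State Λ bd → ℝ := fun ξ => weight Λ a b c ξ.1 with hw
  set P := transition Λ bd a b c with hP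
  have hw0 : ∀ ξ, 0 < w ξ := fun ξ => weight_pos ha hb hc ξ.2.1 Λ
  have hκ0 : 0 < κ := windowConst_pos _ ha hb hc
  intro f hf'
  -- `R + 1` is the number of complete blocks of `8 * T` columns; the remainder goes to the last
  -- window.
  obtain ⟨R, hR1, hR, hR'⟩ : ∃ R, 1 ≤ R ∧ (R + 1) * (8 * T) ≤ n ∧ n < (R + 2) * (8 * T) := by
    have h1 : n / (8 * T) * (8 * T) ≤ n := Nat.div_mul_le_self _ _
    have h2 : n < (n / (8 * T) + 1) * (8 * T) :=
      (Nat.div_lt_iff_lt_mul (by omega)).1 (Nat.lt_succ_self _)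
    have h3 : 2 ≤ n / (8 * T) := (Nat.le_div_iff_mul_le (by omega)).2 (by omega)
    refine ⟨n / (8 * T) - 1, by omega, ?_, ?_⟩
    · rwa [Nat.sub_add_cancel (by omega)]
    · rwa [show n / (8 * T) - 1 + 2 = n / (8 * T) + 1 by omega]
  have : Nonempty (Fin R) := ⟨⟨0, hR1⟩⟩
  have hvar := variance_le_of_contraction (ι := Fin R) hw0
    (fun i => SameOff (window o k n (8 * T) R i)) (fun i => sameOff_equivalence _)
    (by
      intro x y
      have hreach : ∀ ω, Reach Λ bd x.1 ω → ∀ z : State Λ bd, z.1 = ω →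
          Relation.ReflTransGen (fun x y => ∃ i : Fin R, SameOff (window o k n (8 * T) R i) x y)
            x z := by
        intro ω hω
        induction hω with
        | refl =>
          intro z hz
          rw [Subtype.ext hz]
        | @tail ω ω' _ hs ih =>
          intro z hz
          refine (ih ⟨ω, hs.1⟩ rfl).tail ?_
          obtain ⟨i, hi, hsub⟩ := exists_window hR hR1 (by omega) hs
          refine ⟨⟨i, hi⟩, fun e he => ?_⟩
          have h1 : e ∉ symmDiff ω ω' := fun h => he (hsub h)
          rw [mem_symmDiff_iff] at h1
          rw [hz]
          change e ∈ ω ↔ _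
          tauto
      exact hreach y.1 (reach_box x.2 y.2) y rfl)
    (fun f D hD hfD j x y hxy => sum_classAvg_window_le hk ha hb hc hT0 hT hR hD
      (fun i hi => hfD ⟨i, hi⟩) hxy) hf'
  have hwin : ∑ i : Fin R, ∑ x, w x * f x * (f x -
      classAvg w (SameOff (window o k n (8 * T) R i)) f x) ≤
      ∑ i : Fin R, κ / 2 * ∑ u, ∑ v with LocalStep (window o k n (8 * T) R i) u v,
        w u * (f u - f v) ^ 2 :=
    Finset.sum_le_sum fun i _ => sum_sub_classAvg_le ha hb hc (window_subset hR i.2)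
      (card_window_le hR') f
  have hcount : ∑ i : Fin R, ∑ u, ∑ v with LocalStep (window o k n (8 * T) R i) u v,
        w u * (f u - f v) ^ 2 =
      ∑ u, ∑ v, ((Finset.univ.filter fun i : Fin R =>
        LocalStep (window o k n (8 * T) R i) u v).card : ℝ) * (w u * (f u - f v) ^ 2) := by
    rw [Finset.sum_comm]
    refine Finset.sum_congr rfl fun u _ => ?_
    simp only [Finset.sum_filter]
    rw [Finset.sum_comm]
    refine Finset.sum_congr rfl fun v _ => ?_
    rw [← Finset.sum_filter, Finset.sum_const, nsmul_eq_mul]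
  have hstep : ∀ u v, ρ * (((Finset.univ.filter fun i : Fin R =>
      LocalStep (window o k n (8 * T) R i) u v).card : ℝ) * (w u * (f u - f v) ^ 2)) ≤
      3 * (w u * P u v * (f u - f v) ^ 2) := by
    intro u v
    by_cases huv : u = v
    · simp [huv]
    have h1 := rate_le_transition (m := ((Finset.univ.filter fun i : Fin R =>
        LocalStep (window o k n (8 * T) R i) u v).card : ℝ)) ha hb hc hρ huv (Nat.cast_nonneg _)
      (by exact_mod_cast card_localStep_window_le hR (by omega) huv)
      (fun hs => by rw [Finset.filter_false_of_mem fun i _ hi => hs hi.2]; simp)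
    have := mul_le_mul_of_nonneg_right h1 (mul_nonneg (hw0 u).le (sq_nonneg (f u - f v)))
    linarith
  have htot : ρ * ∑ u, ∑ v, ((Finset.univ.filter fun i : Fin R =>
        LocalStep (window o k n (8 * T) R i) u v).card : ℝ) * (w u * (f u - f v) ^ 2) ≤
      3 * ∑ u, ∑ v, w u * P u v * (f u - f v) ^ 2 := by
    rw [Finset.mul_sum, Finset.mul_sum]
    refine Finset.sum_le_sum fun u _ => ?_
    rw [Finset.mul_sum, Finset.mul_sum]
    exact Finset.sum_le_sum fun v _ => hstep u v
  rw [← Finset.mul_sum, hcount] at hwin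
  have hρ0 : 0 ≤ ρ := rateConst_mul_nonneg ha hb hc Λ
  have h1 := mul_le_mul_of_nonneg_left (hvar.trans hwin) hρ0
  have h2 := mul_le_mul_of_nonneg_left htot hκ0.le
  change ρ * ∑ x, w x * f x ^ 2 ≤ 3 * κ * ∑ u, ∑ v, w u * P u v * (f u - f v) ^ 2
  linarith

end Poincare

end OneTwo

namespace OneTwo

/-! ### Distant states and the two bounds on the mixing time -/

section LowerBound

variable {o : Vert} {k n : ℕ} {bd : Set (Sym2 Vert)}

/-- There is a state whose first zigzag path has all its edges of one direction present and
all those of the other direction absent, except near the ends. -/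
theorem exists_alternating_state (hk : 2 ≤ k) (hn : 8 ≤ n) (ω : State (box o k n) bd) (σ : Prop) :
    ∃ ζ : State (box o k n) bd, ∀ q, o.2 + 4 ≤ q → q < o.2 + n - 4 →
      (zig (o.1, q) ∈ ζ.1 ↔ (IsBlack (o.1, q) ↔ σ)) := by
  classical
  set Λ := box o k n with hΛ
  set Z : ℤ → ℤ → Prop := fun p q =>
    if zig (p, q) ∈ edges Λ then (IsBlack (p, q) ↔ σ) else zig (p, q) ∈ ω.1 with hZ
  set H : ℤ → ℤ → Prop := fun p q => hor (p, q) ∈ ω.1 with hH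
  have hout : AgreesOutside Λ bd (ofZigHor Z H) := by
    intro e he heΛ
    refine Iff.trans ?_ (ω.2.2 e he heΛ)
    obtain ⟨⟨p, q⟩, d, rfl⟩ := mem_edgeSet.1 he
    refine forall_edgeAt (P := fun e => e ∉ edges Λ → (e ∈ ofZigHor Z H ↔ e ∈ ω.1)) |>.2
      ⟨?_, ?_, ?_⟩ d heΛ
    · intro h
      rw [zig_mem_ofZigHor]
      simp only [hZ, if_neg h]
    · intro h
      rw [zig_mem_ofZigHor]
      simp only [hZ, if_neg h]
    · intro h
      rw [edgeAt_H_mem_ofZigHor, edgeAt_H]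
      by_cases hb : IsBlack (p, q) <;> simp [hb, hH]
  have hzig : ∀ p q, (o.1 ≤ p ∧ p < o.1 + k) → o.2 ≤ q → q + 1 < o.2 + n →
      (Z p q ↔ (IsBlack (p, q) ↔ σ)) := by
    intro p q hp h1 h2
    have : zig (p, q) ∈ edges Λ := by
      obtain ⟨d, hd⟩ := zig_eq_edgeAt (p, q)
      refine mem_edges_iff_forall.2 ⟨hd ▸ edgeAt_mem_edgeSet _ _, fun v hv => ?_⟩
      rcases Sym2.mem_iff.1 hv with rfl | rfl <;> rw [hΛ, mem_box] <;> simp only <;> omega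
    simp only [hZ, if_pos this]
  -- The alternating pattern may violate the vertex condition at the ends of the paths, so it is
  -- only required to have the right boundary condition; a bridge at each end replaces the first and
  -- the last four columns.
  obtain ⟨ζ₁, -, h2, -, h4, h5⟩ := exists_bridge hk ω.2 ω.2.2 hout (c := o.2) le_rfl (by omega)
    fun v _ => ω.2.1.exists_oddAt v
  obtain ⟨ζ₂, g1, g2, g3, g4, g5⟩ := exists_bridge hk ω.2 h2 ω.2.2 (c := o.2 + n - 4) (by omega)
    (by omega) (by
      rintro ⟨p, q⟩ hq
      simp only at hq
      by_cases hq4 : q < o.2 + 4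
      · exact h5 _ hq4
      have hsame := h4 (p, q) (not_lt.1 hq4)
      by_cases hp : o.1 ≤ p ∧ p < o.1 + k
      · obtain ⟨d, hd⟩ : ∃ d, OddAt (ofZigHor Z H) (p, q) d := by
          rw [exists_oddAt_iff_zig, zig_mem_ofZigHor, zig_mem_ofZigHor,
            hzig p q hp (by omega) (by omega), hzig p (q - 1) hp (by omega) (by omega)]
          have : IsBlack (p, q - 1) ↔ ¬ IsBlack (p, q) := by
            simp only [IsBlack, Int.even_iff]
            omega
          tauto
        exact ⟨d, (hsame.oddAt_iff d).2 hd⟩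
      · obtain ⟨d, hd⟩ := ω.2.1.exists_oddAt (p, q)
        have h6 := (h2.sameAt ω.2.2 (v := (p, q)) fun h => hp (mem_box.1 h).1)
        exact ⟨d, (h6.oddAt_iff d).2 hd⟩)
  refine ⟨⟨ζ₂, isConfig_iff.2 ⟨g1, fun v => ?_⟩, g2⟩, fun q hq hq' => ?_⟩
  · by_cases hv : v.2 < o.2 + n - 4 + 4
    · exact g5 v hv
    · obtain ⟨d, hd⟩ := ω.2.1.exists_oddAt v
      exact ⟨d, ((g4 v (not_lt.1 hv)).oddAt_iff d).2 hd⟩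
  · obtain ⟨d, hd⟩ := zig_eq_edgeAt (o.1, q)
    have e1 := (g3 (o.1, q) hq' d).trans (h4 (o.1, q) hq d)
    rw [← hd, zig_mem_ofZigHor, hzig o.1 q ⟨le_rfl, by omega⟩ (by omega) (by omega)] at e1
    exact e1

/-- The two alternating patterns on the first path are complementary, hence differ at each of the `n
- 8` zigzag edges between the two bridges. -/
theorem exists_far_states (hk : 2 ≤ k) (hn : 8 ≤ n) [Nonempty (State (box o k n) bd)] :
    ∃ x y : State (box o k n) bd, n ≤ (symmDiff x.1 y.1).ncard + 8 := by
  classical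
  obtain ⟨ω⟩ := ‹Nonempty (State (box o k n) bd)›
  obtain ⟨x, hx⟩ := exists_alternating_state hk hn ω True
  obtain ⟨y, hy⟩ := exists_alternating_state hk hn ω False
  refine ⟨x, y, ?_⟩
  have h1 : (((Finset.Ico (o.2 + 4) (o.2 + n - 4)).image fun q => zig (o.1, q) :
      Finset (Sym2 Vert)) : Set (Sym2 Vert)) ⊆ symmDiff x.1 y.1 := by
    intro e he
    obtain ⟨q, hq, rfl⟩ := Finset.mem_image.1 (Finset.mem_coe.1 he)
    rw [Finset.mem_Ico] at hq
    rw [mem_symmDiff_iff, hx q hq.1 hq.2, hy q hq.1 hq.2]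
    tauto
  have h2 := Set.ncard_le_ncard h1 (finite_of_subset_edges (Compat.subset_edges x.2 y.2))
  rw [Set.ncard_coe_finset, Finset.card_image_of_injective _ fun q q' h =>
    (Prod.ext_iff.1 (zig_inj.1 h)).2, Int.card_Ico] at h2
  omega

end LowerBound

section Speed

variable {Λ : Finset Vert} {bd : Set (Sym2 Vert)} {a b c : ℝ}

open Classical in
-- The largest change in a single step is a face move, which affects six edges.
theorem ncard_symmDiff_le {t : ℕ} {x z : State Λ bd}
    (h : (transition Λ bd a b c ^ t) x z ≠ 0) : (symmDiff x.1 z.1).ncard ≤ 6 * t := by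
  induction t generalizing z with
  | zero =>
    have : x = z := by
      by_contra hn
      exact h (by rw [pow_zero, Matrix.one_apply_ne hn])
    simp [this]
  | succ t ih =>
    rw [pow_succ, Matrix.mul_apply] at h
    obtain ⟨y, -, hy⟩ := Finset.exists_ne_zero_of_sum_ne_zero h
    have h1 := ih (left_ne_zero_of_mul hy)
    have h2 : (symmDiff y.1 z.1).ncard ≤ 6 := by
      by_cases hyz : y = z
      · simp [hyz]
      · have h3 := right_ne_zero_of_mul hy
        rw [transition_of_ne hyz] at h3
        rcases rate_cases a b c h3 with ⟨v, d, h4⟩ | ⟨f, -, h4, -⟩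
        · rw [h4, Set.ncard_singleton]
          norm_num
        · rw [h4, ← Set.image_univ]
          refine (Set.ncard_image_le Set.finite_univ).trans ?_
          rw [Set.ncard_univ, Nat.card_eq_fintype_card, ZMod.card]
    have h5 : symmDiff x.1 z.1 ⊆ symmDiff x.1 y.1 ∪ symmDiff y.1 z.1 := symmDiff_triangle _ _ _
    have h6 := Set.ncard_le_ncard h5 ((finite_of_subset_edges (Compat.subset_edges x.2 y.2)).union
      (finite_of_subset_edges (Compat.subset_edges y.2 z.2)))
    have h7 := Set.ncard_union_le (symmDiff x.1 y.1) (symmDiff y.1 z.1)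
    omega

theorem quarter_lt_distAt_of_far (ha : 0 < a) (hb : 0 < b) (hc : 0 < c) {t : ℕ} {x y : State Λ bd}
    (h : 12 * t < (symmDiff x.1 y.1).ncard) :
    1 / 4 < distAt (transition Λ bd a b c) (gibbs Λ bd a b c) t := by
  have : Nonempty (State Λ bd) := ⟨x⟩
  refine quarter_lt_distAt (isLazyReversible_transition ha hb hc) (x := x) (y := y) fun z => ?_
  by_contra hn
  rw [not_or] at hn
  have h1 := ncard_symmDiff_le hn.1
  have h2 := ncard_symmDiff_le hn.2
  have h3 : symmDiff x.1 y.1 ⊆ symmDiff x.1 z.1 ∪ symmDiff y.1 z.1 := by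
    rw [symmDiff_comm y.1]
    exact symmDiff_triangle _ _ _
  have h4 := Set.ncard_le_ncard h3 ((finite_of_subset_edges (Compat.subset_edges x.2 z.2)).union
    (finite_of_subset_edges (Compat.subset_edges y.2 z.2)))
  have h5 := Set.ncard_union_le (symmDiff x.1 z.1) (symmDiff y.1 z.1)
  omega

end Speed

section UpperBound

variable {o : Vert} {k n : ℕ} {bd : Set (Sym2 Vert)} {a b c : ℝ}

theorem card_box (o : Vert) (k n : ℕ) : (box o k n).card = k * n := by
  simp [box]

/-- There are at most `8 ^ (k * n)` states, and the weights of any two of them differ by at most a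
factor `weightRatio ^ (k * n)`. -/
theorem le_gibbs (ha : 0 < a) (hb : 0 < b) (hc : 0 < c) (x : State (box o k n) bd) :
    (((8 * weightRatio a b c) ^ (k * n))⁻¹ : ℝ) ≤ gibbs (box o k n) bd a b c x := by
  classical
  have : Nonempty (State (box o k n) bd) := ⟨x⟩
  have h1 := one_le_weightRatio ha hb hc
  have hall : ∀ y : State (box o k n) bd, SameOff (box o k n) x y := fun y =>
    sameOff_iff_agreesOutside.2 fun e he heΛ => (y.2.2 e he heΛ).trans (x.2.2 e he heΛ).symm
  have hx := weight_pos ha hb hc x.2.1 (box o k n)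
  have h2 : ∑ y : State (box o k n) bd, weight (box o k n) a b c y.1 ≤
      (8 * weightRatio a b c) ^ (k * n) * weight (box o k n) a b c x.1 := by
    calc ∑ y : State (box o k n) bd, weight (box o k n) a b c y.1
        ≤ ∑ y : State (box o k n) bd, weightRatio a b c ^ (k * n) *
            weight (box o k n) a b c x.1 := by
          refine Finset.sum_le_sum fun y _ => ?_
          have := ((sameOff_equivalence _).symm (hall y)).weight_le ha hb hc
          rwa [card_box] at this
      _ = (Finset.univ : Finset (State (box o k n) bd)).card * (weightRatio a b c ^ (k * n) *
            weight (box o k n) a b c x.1) := by rw [Finset.sum_const, nsmul_eq_mul]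
      _ ≤ 8 ^ (k * n) * (weightRatio a b c ^ (k * n) * weight (box o k n) a b c x.1) := by
          refine mul_le_mul_of_nonneg_right ?_ (mul_nonneg (by positivity) hx.le)
          have := card_sameOff_le (box o k n) x
          rw [Finset.filter_true_of_mem fun y _ => hall y, card_box] at this
          exact_mod_cast this
      _ = _ := by rw [mul_pow]; ring
  rw [gibbs, inv_eq_one_div, div_le_div_iff₀ (by positivity) (partition_pos ha hb hc), one_mul,
    mul_comm]
  exact h2

/-- There are at most three edges and one face per vertex, so the normalisation involves at most `2
* 4 * k * n`. An edge must exist, since otherwise `rateConst` would be 0. -/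
theorem le_rateConst (ha : 0 < a) (hb : 0 < b) (hc : 0 < c) (hk : 1 ≤ k) (hn : 2 ≤ n) :
    (weightRatio a b c)⁻¹ / (8 * (k * n)) ≤ rateConst (box o k n) a b c := by
  classical
  have hmin : 0 < min (min a b) c := lt_min (lt_min ha hb) hc
  have hmax : 0 < max (max a b) c := lt_of_lt_of_le hc (le_max_right _ _)
  have hE : 0 < (edges (box o k n)).card := by
    refine Finset.card_pos.2 ⟨zig o, ?_⟩
    obtain ⟨d, hd⟩ := zig_eq_edgeAt o
    refine mem_edges_iff_forall.2 ⟨hd ▸ edgeAt_mem_edgeSet _ _, fun v hv => ?_⟩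
    rcases Sym2.mem_iff.1 hv with rfl | rfl <;> rw [mem_box]
    · omega
    · dsimp only
      omega
  have hE' : (edges (box o k n)).card ≤ 3 * (k * n) := by
    have := card_edges_le (box o k n)
    rwa [card_box] at this
  have hF : (faces (box o k n)).card ≤ k * n := by
    rw [← card_box o k n]
    exact Finset.card_filter_le _ _
  have h1 : (0 : ℝ) < (edges (box o k n)).card := by exact_mod_cast hE
  have h2 : ((edges (box o k n)).card : ℝ) ≤ 3 * (k * n) := by exact_mod_cast hE'
  have h3 : ((faces (box o k n)).card : ℝ) ≤ k * n := by exact_mod_cast hF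
  have h4 : (0 : ℝ) ≤ (faces (box o k n)).card := Nat.cast_nonneg _
  rw [rateConst, weightRatio, inv_div, div_div]
  refine div_le_div_of_nonneg_left hmin.le (by positivity) ?_
  rw [mul_comm]
  exact mul_le_mul_of_nonneg_left (by linarith) hmax.le

theorem Poincare.mono {S : Type} [Fintype S] {P : Matrix S S ℝ} {π : S → ℝ} {l l' : ℝ}
    (hπ : ∀ x, 0 ≤ π x) (h : Poincare P π l) (hl : l' ≤ l) : Poincare P π l' := fun f hf =>
  (mul_le_mul_of_nonneg_right hl
    (Finset.sum_nonneg fun x _ => mul_nonneg (hπ x) (sq_nonneg _))).trans (h f hf)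

/-- The spectral gap of the chain on a box with `n` columns is at least of order `1 / n`. -/
theorem exists_poincare (hk : 2 ≤ k) (ha : 0 < a) (hb : 0 < b) (hc : 0 < c) :
    ∃ l : ℝ, 0 < l ∧ l ≤ 1 ∧ ∀ n : ℕ, 2 ≤ n → ∀ (o : Vert) (bd : Set (Sym2 Vert)),
      Nonempty (State (box o k n) bd) →
        Poincare (transition (box o k n) bd a b c) (gibbs (box o k n) bd a b c) (l / n) := by
  have hr := one_le_weightRatio ha hb hc
  obtain ⟨T, hT0, hT⟩ : ∃ T : ℕ, 1 ≤ T ∧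
      (1 - ((8 * weightRatio a b c) ^ (8 * k))⁻¹) ^ T ≤ 1 / 5 := by
    have hM : (1 : ℝ) ≤ (8 * weightRatio a b c) ^ (8 * k) := one_le_pow₀ (by linarith)
    have h0 : 0 ≤ 1 - ((8 * weightRatio a b c) ^ (8 * k))⁻¹ :=
      sub_nonneg.2 (inv_le_one_of_one_le₀ hM)
    have h1 : 1 - ((8 * weightRatio a b c) ^ (8 * k))⁻¹ < 1 :=
      sub_lt_self _ (inv_pos.2 (by linarith))
    obtain ⟨T, hT⟩ := exists_pow_lt_of_lt_one (by norm_num : (0 : ℝ) < 1 / 5) h1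
    exact ⟨T + 1, by omega, (pow_le_pow_of_le_one h0 h1.le (Nat.le_succ T)).trans hT.le⟩
  set κ := windowConst (3 * (k * (8 * T))) a b c with hκ
  have hκ0 : 0 < κ := windowConst_pos _ ha hb hc
  have hk0 : (0 : ℝ) < k := by exact_mod_cast (by omega : 0 < k)
  set l := (weightRatio a b c)⁻¹ * (weightRatio a b c)⁻¹ / (48 * k * κ) with hl
  have hr0 : 0 < (weightRatio a b c)⁻¹ := inv_pos.2 (by linarith)
  have hl0 : 0 < l := by positivity
  refine ⟨min l 1, lt_min hl0 one_pos, min_le_right _ _, fun n hn o bd hne => ?_⟩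
  have hP : Poincare (transition (box o k n) bd a b c) (gibbs (box o k n) bd a b c)
      (rateConst (box o k n) a b c * (min (min a b) c / max (max a b) c) / (6 * κ)) := by
    -- `T` depends on the weights, whereas the threshold on `n` must not; short boxes are therefore
    -- treated as one window, with the same constant.
    by_cases h : 16 * T ≤ n
    · exact poincare_transition hk ha hb hc hT0 hT h
    · refine poincare_transition_of_card_le ha hb hc ?_
      rw [card_box]
      calc k * n ≤ k * (16 * T) := Nat.mul_le_mul_left k (by omega)
        _ ≤ k * (24 * T) := Nat.mul_le_mul_left k (by omega)
        _ = 3 * (k * (8 * T)) := by ring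
  refine hP.mono (fun x => ((isLazyReversible_transition ha hb hc).pos x).le) ?_
  have hn0 : (0 : ℝ) < n := by exact_mod_cast (by omega : 0 < n)
  have h1 := le_rateConst (o := o) ha hb hc (by omega : 1 ≤ k) hn
  have h2 : min (min a b) c / max (max a b) c = (weightRatio a b c)⁻¹ := by
    rw [weightRatio, inv_div]
  rw [h2]
  calc min l 1 / n ≤ l / n := div_le_div_of_nonneg_right (min_le_left _ _) hn0.le
    _ = (weightRatio a b c)⁻¹ / (8 * (k * n)) * (weightRatio a b c)⁻¹ / (6 * κ) := by
        rw [hl]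
        field_simp
        norm_num
    _ ≤ _ := div_le_div_of_nonneg_right (mul_le_mul_of_nonneg_right h1 hr0.le) (by positivity)

/-- The squared deviation is at most `(1 - l / n) ^ t` divided by the smallest probability, whose
logarithm is of order `-n`. The summand `log 16` brings the deviation down to 1/4. -/
theorem distAt_le_quarter (ha : 0 < a) (hb : 0 < b) (hc : 0 < c) (hn : 1 ≤ n)
    [Nonempty (State (box o k n) bd)] {l : ℝ} (hl1 : l ≤ 1)
    (hP : Poincare (transition (box o k n) bd a b c) (gibbs (box o k n) bd a b c) (l / n)) {t : ℕ}
    (ht : (k * Real.log (8 * weightRatio a b c) + Real.log 16) * n ≤ l / n * t) :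
    distAt (transition (box o k n) bd a b c) (gibbs (box o k n) bd a b c) t ≤ 1 / 4 := by
  have hlazy := isLazyReversible_transition (Λ := box o k n) (bd := bd) ha hb hc
  have hr := one_le_weightRatio ha hb hc
  have hn1 : (1 : ℝ) ≤ n := by exact_mod_cast hn
  have hle : l / n ≤ 1 := by
    rw [div_le_one (by linarith)]
    linarith
  set M : ℝ := (8 * weightRatio a b c) ^ (k * n) with hM
  have hM0 : 0 < M := by positivity
  have hdecay : (1 - l / n) ^ t ≤ M⁻¹ * 16⁻¹ := by
    have h1 : (1 - l / n) ^ t ≤ Real.exp (-(l / n)) ^ t :=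
      pow_le_pow_left₀ (sub_nonneg.2 hle) (Real.one_sub_le_exp_neg _) t
    rw [← Real.exp_nat_mul] at h1
    refine h1.trans ?_
    have h2 : M⁻¹ * 16⁻¹ = Real.exp (-(Real.log M + Real.log 16)) := by
      rw [neg_add, Real.exp_add, Real.exp_neg, Real.exp_neg, Real.exp_log hM0,
        Real.exp_log (by norm_num)]
    rw [h2, Real.exp_le_exp, hM, Real.log_pow]
    have h3 : 0 ≤ Real.log 16 := Real.log_nonneg (by norm_num)
    have h4 : Real.log 16 ≤ Real.log 16 * n := le_mul_of_one_le_right h3 hn1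
    push_cast
    linarith
  refine distAt_le fun x A => ?_
  classical
  have h1 := hlazy.abs_sub_le hP hle t x A
  have h2 := le_gibbs ha hb hc x
  rw [← hM] at h2
  set y := |∑ z ∈ A, (transition (box o k n) bd a b c ^ t) x z -
    ∑ z ∈ A, gibbs (box o k n) bd a b c z| with hy
  have h3 : M⁻¹ * y ^ 2 ≤ M⁻¹ * 16⁻¹ :=
    (mul_le_mul_of_nonneg_right h2 (sq_nonneg _)).trans (h1.trans hdecay)
  have h4 : y ^ 2 ≤ 16⁻¹ := le_of_mul_le_mul_left h3 (inv_pos.2 hM0)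
  have h5 : y ^ 2 ≤ (1 / 4 : ℝ) ^ 2 := h4.trans (by norm_num)
  exact le_of_sq_le_sq h5 (by norm_num)

end UpperBound

end OneTwo

theorem theorem2p3 (k : ℕ) (hk : 2 ≤ k) :
    ∃ (N : ℕ) (B : ℝ), 0 < B ∧
      ∀ a b c : ℝ, 0 < a → 0 < b → 0 < c →
        ∃ C : ℝ, 0 < C ∧
          ∀ n : ℕ, N ≤ n → ∀ (o : OneTwo.Vert) (bd : Set (Sym2 OneTwo.Vert)),
            OneTwo.Admissible (OneTwo.box o k n) bd →
              (∀ ν : OneTwo.State (OneTwo.box o k n) bd → ℝ,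
                OneTwo.IsStationary (OneTwo.transition (OneTwo.box o k n) bd a b c) ν ↔
                  ν = OneTwo.gibbs (OneTwo.box o k n) bd a b c) ∧
              ∃ t : ℕ,
                OneTwo.IsMixingTime (OneTwo.transition (OneTwo.box o k n) bd a b c)
                  (OneTwo.gibbs (OneTwo.box o k n) bd a b c) (1 / 4) t ∧
                B * (n : ℝ) ≤ (t : ℝ) ∧ (t : ℝ) ≤ C * (n : ℝ) ^ 2 := by
  -- If `24 * t < n`, then `12 * t < n / 2 ≤ n - 8` as soon as `n ≥ 16`, so two states at distance
  -- `n - 8` are too far apart to meet after `t` steps from each.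
  refine ⟨16, 1 / 24, by norm_num, fun a b c ha hb hc => ?_⟩
  obtain ⟨l, hl0, hl1, hl⟩ := OneTwo.exists_poincare hk ha hb hc
  have hr := OneTwo.one_le_weightRatio ha hb hc
  set K : ℝ := k * Real.log (8 * OneTwo.weightRatio a b c) + Real.log 16 with hK
  have hK0 : 0 < K := by
    have h1 : 0 < Real.log 16 := Real.log_pos (by norm_num)
    have h2 : 0 ≤ Real.log (8 * OneTwo.weightRatio a b c) := Real.log_nonneg (by linarith)
    positivity
  -- The additional 1 absorbs the rounding up of `K / l * n ^ 2`, since `n ^ 2 ≥ 1`.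
  refine ⟨K / l + 1, by positivity, fun n hn o bd ⟨ω, hω⟩ => ?_⟩
  have hne : Nonempty (OneTwo.State (OneTwo.box o k n) bd) := ⟨⟨ω, hω⟩⟩
  have hlazy := OneTwo.isLazyReversible_transition (Λ := OneTwo.box o k n) (bd := bd) ha hb hc
  have hP := hl n (by omega) o bd hne
  have hn0 : (0 : ℝ) < n := by exact_mod_cast (by omega : 0 < n)
  have hn1 : (1 : ℝ) ≤ n := by exact_mod_cast (by omega : 1 ≤ n)
  refine ⟨hlazy.isStationary_iff hP (by positivity), ?_⟩
  have hs := Nat.le_ceil (K / l * (n : ℝ) ^ 2)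
  have hs' := Nat.ceil_lt_add_one (show 0 ≤ K / l * (n : ℝ) ^ 2 by positivity)
  set s := ⌈K / l * (n : ℝ) ^ 2⌉₊
  have hs0 : (0 : ℝ) < s := lt_of_lt_of_le (by positivity) hs
  have hdist := OneTwo.distAt_le_quarter ha hb hc (by omega) hl1 hP (t := s) (by
    rw [← hK]
    calc K * n = l / n * (K / l * (n : ℝ) ^ 2) := by field_simp
      _ ≤ l / n * s := mul_le_mul_of_nonneg_left hs (by positivity))
  obtain ⟨t, ht, hts⟩ := OneTwo.exists_isMixingTime (by exact_mod_cast hs0) hdist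
  refine ⟨t, ht, ?_, ?_⟩
  · obtain ⟨x, y, hxy⟩ := OneTwo.exists_far_states (o := o) (bd := bd) hk (by omega : 8 ≤ n)
    by_contra hlt
    have h1 : 12 * t < (symmDiff x.1 y.1).ncard := by
      rw [not_le] at hlt
      have h2 : (24 * t : ℝ) < n := by linarith
      have h3 : 24 * t < n := by exact_mod_cast h2
      omega
    exact absurd ht.1.2 (not_le.2 (OneTwo.quarter_lt_distAt_of_far ha hb hc h1))
  · have h1 : (t : ℝ) ≤ s := by exact_mod_cast hts
    have h2 : (1 : ℝ) ≤ (n : ℝ) ^ 2 := one_le_pow₀ hn1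
    linarith
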